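/- **Setting.** Let $\mathbf k$ be an ordinary differential field of characteristic $0$ with derivation $\delta$, let $\mathbf k\{Y\}=\mathbf k\{y_1,\dots,y_n\}$ be the ring of differential polynomials, and fix a ranking, i.e. a total order on the derivatives $y_i^{(j)}$ with $\delta^j u\ge u$, and $u\ge v\Rightarrow\delta^j u\ge\delta^j v$. For $f\notin\mathbf k$ let $\mathrm{ld}\,f$ be its leader (highest derivative occurring in it), $\mathrm{lv}\,f\in Y$ the indeterminate of which $\mathrm{ld}\,f$ is a derivative, $\mathrm{rk}\,f=(\mathrm{ld}\,f)^d$ its rank, where $d=\deg_{\mathrm{ld} f}f$, $\mathbf i_f$ the coefficient of $(\mathrm{ld}\,f)^d$ (initial) and $\mathbf s_f=\partial f/\partial(\mathrm{ld}\,f)$ (separant). Ranks are compared first by leader, then by degree; elements of $\mathbf k$ have lower rank than all others. For a finite set $F$, $H_F$ is the set of initials and separants of its elements and $\mathrm{lv}\,F$ the set of its leading variables. $[F]$ and $\{F\}$ are the differential and the radical differential ideal generated by $F$, and $I:S^\infty=\{a\mid sa\in I\text{ for some product }s\text{ of elements of }S\}$ (with the empty product $1$ allowed). A polynomial $f$ is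 *partially reduced* w.r.t. $g$ if no proper derivative of $\mathrm{ld}\,g$ occurs in $f$, *algebraically reduced* if $\deg_{\mathrm{ld}\, g}f<\deg_{\mathrm{ld}\, g}g$, and *reduced* if both hold. A system $(\mathbb A,H)$ of finite sets is *regular* if $\mathbb A\subset\mathbf k\{Y\}\setminus\mathbf k$ is autoreduced (each element is reduced w.r.t. every other one), all elements of $H$ are partially reduced w.r.t. all elements of $\mathbb A$, and $H\supseteq H_{\mathbb A}$. $\mathsf{algrem}(f,\mathbb B)$ denotes a polynomial that is algebraically reduced w.r.t. all elements of $\mathbb B$ and is obtained from $f$ by finitely many pseudo-divisions by elements of $\mathbb B$, where a pseudo-division by $g$ replaces a polynomial $p$ with $\deg_{\mathrm{ld}\,g}p\ge\deg_{\mathrm{ld}\,g}g$ by a polynomial $r$ with $\mathbf i_g^e\,p=qg+r$ for some $e\ge0$ and $q$, and $\deg_{\mathrm{ld}\,g}r<\deg_{\mathrm{ld}\,g}g$; for a set $G$, $\mathsf{algrem}(G,\mathbb B)=\{\mathsf{algrem}(g,\mathbb B)\mid g\in G\}$. Let $\mathbb B^0$ (resp. $\mathbb B^*$) be the set of elements of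 $\mathbb B$ that have minimal (resp. maximal) rank among the elements of $\mathbb B$ with the same leading variable. For a finite set $F$ let $m_y(F)$ be the maximal order of a derivative of $y$ occurring in $F$ ($0$ if there is none), $M(F)=\sum_{y\in Y}m_y(F)$, and, for $Z\subsetneq Y$, $M_Z(F)=(n-|Z|)\sum_{y\in Z}m_y(F)+\sum_{y\notin Z}m_y(F)$. **Algorithm Differentiate&Autoreduce**$(\mathbb C,(m_y)_y)$. Start with $\mathbb D:=\mathbb C$, $\mathbb B:=\varnothing$. Let $(\delta\mathbb B^*)_{m}$ be the set of those $f\in\delta\mathbb B^*$ whose leader $y^{(j)}$ satisfies $j\le m_y$. While $\mathbb D\cup(\delta\mathbb B^*)_{m}\ne\varnothing$: let $f$ be an element of least rank of this set; if $f\in\mathbb D$, put $\bar f:=\mathsf{algrem}(f,\mathbb B)$ and remove $f$ from $\mathbb D$, otherwise put $\bar f:=\mathsf{algrem}(f,\mathbb B\cup(\delta\mathbb B^0\setminus\{f\}))$; if $\mathrm{rk}\,\bar f\ne\mathrm{rk}\,f$ return $\{1\}$; add $\bar f$ to $\mathbb B$. At the end return $\mathbb B$. **Algorithm RGBound**$(F_0,H_0)$.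 Start with $T:=\varnothing$, $U:=\{(F_0,\varnothing,H_0)\}$. While $U\neq\varnothing$: take and remove any $(F,\mathbb C,H)\in U$; let $f$ be an element of $F$ of least rank, $D:=\{C\in\mathbb C\mid\mathrm{lv}\,C=\mathrm{lv}\,f\}$, $G:=(F\cup D)\setminus\{f\}$, $\bar{\mathbb C}:=(\mathbb C\setminus D)\cup\{f\}$, and let $\mathbb B$ be the result of Differentiate&Autoreduce$(\bar{\mathbb C},(m_y(G\cup\bar{\mathbb C}\cup H))_y)$. If $\mathbb B\ne\{1\}$, put $\bar F:=\mathsf{algrem}(G,\mathbb B)\setminus\{0\}$ and $\bar H:=\mathsf{algrem}(H,\mathbb B)\cup H_{\mathbb B}$, and if $\bar F\cap\mathbf k=\varnothing$ and $0\notin\bar H$, then add $(\mathbb B^0,\bar H)$ to $T$ if $\bar F=\varnothing$, and add $(\bar F,\mathbb B^0,\bar H)$ to $U$ otherwise. Finally, if $\mathbf s_f\notin\mathbf k$, add $(F\cup\{\mathbf s_f\},\mathbb C,H)$ to $U$ and, if moreover $\mathbf i_f\notin\mathbf k$, also $(F\cup\{\mathbf i_f\},\mathbb C,H)$. Return $T$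 when $U=\varnothing$. **Proposition.** Let $F_0,H_0\subset\mathbf k\{Y\}$ be finite sets with $F_0\ne\varnothing$ and $F_0\cap\mathbf k=\varnothing$. Whatever choices are made where the algorithms leave a choice (including the choice of the pseudo-divisions in $\mathsf{algrem}$): 1. RGBound$(F_0,H_0)$ terminates: every sequence of successive pseudo-divisions by elements of a finite set is finite, every run of RGBound (with the loops of the calls of Differentiate&Autoreduce included) is finite, and every instruction that is reached can be carried out, so that a run ends only with $U=\varnothing$. 2. Every triple $(F,\mathbb C,H)$ that is ever in $U$ satisfies $M(F\cup\mathbb C\cup H)\le(n-1)!\cdot M(F_0\cup H_0)$; moreover, if $l=|\mathrm{lv}\,\mathbb C|<n$, then $M_{\mathrm{lv}\,\mathbb C}(F\cup\mathbb C\cup H)\le(n-1)(n-2)\cdots(n-l)\cdot M(F_0\cup H_0)$. 3. The returned set $T$ is a finite set of regular systems with $\{F_0\}:H_0^\infty=\bigcap_{(\mathbb A,H)\in T}[\mathbb A]:H^\infty$ (the empty intersection being $\mathbf k\{Y\}$), and $M(\mathbb A\cup H)\le(n-1)!\cdot M(F_0\cup H_0)$ for all $(\mathbb A,H)\in T$.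 -/

import Mathlib

/-! ## Ordinary differential polynomials -/

/-- The derivative `y_var^(ord)` of one of the differential indeterminates `y_1, …, y_n`. -/
@[ext]
structure DVar (n : ℕ) where
  var : Fin n
  ord : ℕ

/-- `δ^j u`. -/
def DVar.shift {n : ℕ} (j : ℕ) (u : DVar n) : DVar n := ⟨u.var, u.ord + j⟩

/-- A total order on the derivatives is a ranking: `θ u ≥ u`, and `u ≥ v` implies `θ u ≥ θ v`,
for all derivative operators `θ = δ^j`. -/
structure IsRanking (n : ℕ) [LinearOrder (DVar n)] : Prop where
  le_shift : ∀ (j : ℕ) (u : DVar n), u ≤ u.shift j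
  shift_le_shift : ∀ (j : ℕ) (u v : DVar n), v ≤ u → v.shift j ≤ u.shift j

/-- The ring `k{y_1, …, y_n}`. -/
abbrev DPoly (k : Type*) [Field k] (n : ℕ) := MvPolynomial (DVar n) k

noncomputable section

namespace RG

open MvPolynomial
open scoped Differential Classical

instance instDecEqDPoly {k : Type*} [Field k] {n : ℕ} : DecidableEq (DPoly k n) :=
  Classical.decEq _

section Ring

variable {k : Type*} [Field k] {n : ℕ}

/-- The differential polynomials that lie in the base field. -/
def constants (k : Type*) [Field k] (n : ℕ) : Set (DPoly k n) := Set.range C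

section Derivation

variable [Differential k]

/-- Differentiation of the coefficients. -/
def coeffDerivFun (f : DPoly k n) : DPoly k n :=
  ∑ m ∈ f.support, monomial m ((coeff m f)′)

lemma coeff_coeffDerivFun (f : DPoly k n) (m : DVar n →₀ ℕ) :
    coeff m (coeffDerivFun f) = (coeff m f)′ := by
  rw [coeffDerivFun, coeff_sum]
  simp only [coeff_monomial]
  rw [Finset.sum_ite_eq' f.support m]
  split_ifs with h
  · rfl
  · rw [notMem_support_iff.mp h, map_zero]

/-- Differentiation of the coefficients, as a derivation. -/
def coeffDeriv (k : Type*) [Field k] [Differential k] (n : ℕ) :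
    Derivation ℤ (DPoly k n) (DPoly k n) :=
  Derivation.mk'
    (AddMonoidHom.toIntLinearMap
      { toFun := coeffDerivFun
        map_zero' := by
          ext m; rw [coeff_coeffDerivFun]; simp
        map_add' := fun f g => by
          ext m; simp only [coeff_coeffDerivFun, coeff_add, map_add] })
    (fun f g => by
      ext m
      simp only [AddMonoidHom.coe_toIntLinearMap, AddMonoidHom.coe_mk, ZeroHom.coe_mk,
        smul_eq_mul, coeff_add]
      rw [mul_comm g, coeff_coeffDerivFun, coeff_mul, coeff_mul, coeff_mul, map_sum,
        ← Finset.sum_add_distrib]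
      refine Finset.sum_congr rfl fun x _ => ?_
      rw [Derivation.leibniz, coeff_coeffDerivFun, coeff_coeffDerivFun, smul_eq_mul, smul_eq_mul,
        mul_comm (coeff x.2 g)])

/-- The derivation `δ` of `k{y_1, …, y_n}`: it extends the derivation of `k` and maps
`y_i^(j)` to `y_i^(j+1)`. -/
def delta (k : Type*) [Field k] [Differential k] (n : ℕ) :
    Derivation ℤ (DPoly k n) (DPoly k n) :=
  coeffDeriv k n + (mkDerivation k fun u : DVar n => (X (u.shift 1) : DPoly k n)).restrictScalars ℤ

lemma delta_C (a : k) : delta k n (C a) = C (a′) := by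
  have h : coeffDeriv k n (C a) = C (a′) := by
    ext m
    change coeff m (coeffDerivFun (C a)) = _
    rw [coeff_coeffDerivFun, coeff_C, coeff_C]
    split_ifs <;> simp
  simp [delta, h]

lemma delta_X (u : DVar n) : delta k n (X u) = X (u.shift 1) := by
  have h : coeffDeriv k n (X u) = 0 := by
    ext m
    change coeff m (coeffDerivFun (X u)) = _
    rw [coeff_coeffDerivFun, coeff_X]
    split_ifs <;> simp
  simp [delta, h]

/-- An ideal closed under `δ`. -/
def IsDiffIdeal (I : Ideal (DPoly k n)) : Prop := ∀ f ∈ I, delta k n f ∈ I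

/-- `[F]`, the differential ideal generated by `F`. -/
def diffIdeal (F : Set (DPoly k n)) : Ideal (DPoly k n) :=
  sInf {I | F ⊆ I ∧ IsDiffIdeal I}

/-- `{F}`, the radical differential ideal generated by `F`. -/
def radDiffIdeal (F : Set (DPoly k n)) : Ideal (DPoly k n) :=
  sInf {I | F ⊆ I ∧ IsDiffIdeal I ∧ I.IsRadical}

end Derivation

/-- The saturated ideal `I : S^∞`. -/
def saturation (I : Ideal (DPoly k n)) (S : Set (DPoly k n)) : Ideal (DPoly k n) where
  carrier := {a | ∃ s ∈ Submonoid.closure S, s * a ∈ I}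
  zero_mem' := ⟨1, one_mem _, by simp⟩
  add_mem' := by
    rintro a b ⟨s, hs, ha⟩ ⟨t, ht, hb⟩
    refine ⟨s * t, mul_mem hs ht, ?_⟩
    have : s * t * (a + b) = t * (s * a) + s * (t * b) := by ring
    rw [this]
    exact I.add_mem (I.mul_mem_left _ ha) (I.mul_mem_left _ hb)
  smul_mem' := by
    rintro c a ⟨s, hs, ha⟩
    refine ⟨s, hs, ?_⟩
    have : s * (c • a) = c * (s * a) := by rw [smul_eq_mul]; ring
    rw [this]
    exact I.mul_mem_left _ ha

/-! ## Orders -/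

/-- `m_y(F)`: the maximal order of a derivative of `y` occurring in `F` (zero if there is none). -/
def maxOrd (F : Finset (DPoly k n)) (y : Fin n) : ℕ :=
  F.sup fun f => (f.vars.filter fun u => u.var = y).sup DVar.ord

/-- `M(F) = ∑_y m_y(F)`. -/
def sumOrd (F : Finset (DPoly k n)) : ℕ := ∑ y, maxOrd F y

/-- `M_Z(F) = (n - |Z|) ∑_{y ∈ Z} m_y(F) + ∑_{y ∉ Z} m_y(F)`. -/
def weightedOrd (Z : Finset (Fin n)) (F : Finset (DPoly k n)) : ℕ :=
  (n - Z.card) * ∑ y ∈ Z, maxOrd F y + ∑ y ∈ Zᶜ, maxOrd F y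

/-- The coefficient of `u^d` in `f`, viewed as a univariate polynomial in `u`. -/
def coeffIn (u : DVar n) (d : ℕ) (f : DPoly k n) : DPoly k n :=
  ∑ m ∈ f.support with m u = d, monomial (m.erase u) (coeff m f)

end Ring

/-! ## Leaders, ranks, reduction -/

section Ranking

variable {k : Type*} [Field k] {n : ℕ} [LinearOrder (DVar n)]

/-- The leader of `f`; it is `⊥` exactly when `f` lies in `k`. -/
def leader (f : DPoly k n) : WithBot (DVar n) := f.vars.max

/-- The leading variable of `f`; it is `⊥` exactly when `f` lies in `k`. -/
def lv (f : DPoly k n) : WithBot (Fin n) := (leader f).map DVar.var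

/-- The set of the leading variables of the elements of `F`. -/
def lvSet (F : Finset (DPoly k n)) : Finset (Fin n) :=
  Finset.univ.filter fun y => ∃ f ∈ F, lv f = (y : WithBot (Fin n))

/-- The rank `u_f^d` of `f`, ranks being compared first by the leader, then by the degree;
it is `⊥` exactly when `f` lies in `k`. -/
def rank (f : DPoly k n) : WithBot (DVar n ×ₗ ℕ) :=
  (leader f).map fun u => toLex (u, degreeOf u f)

/-- The initial of `f` (of no significance for `f` in `k`). -/
def initial (f : DPoly k n) : DPoly k n :=
  if h : f.vars.Nonempty then coeffIn (f.vars.max' h) (degreeOf (f.vars.max' h) f) f else f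

/-- The separant of `f`, which is the partial derivative of `f` by its leader
(of no significance for `f` in `k`). -/
def separant (f : DPoly k n) : DPoly k n :=
  if h : f.vars.Nonempty then pderiv (f.vars.max' h) f else 0

/-- `H_F`, the set of initials and separants of the elements of `F`. -/
def inisep (F : Finset (DPoly k n)) : Finset (DPoly k n) :=
  F.image initial ∪ F.image separant

/-- No proper derivative of the leader of `g` appears in `f`. -/
def PartiallyReduced (f g : DPoly k n) : Prop :=
  ∀ u : DVar n, leader g = u → ∀ v ∈ f.vars, ¬ (v.var = u.var ∧ u.ord < v.ord)

/-- The degree of `f` in the leader of `g` is less than that of `g`. -/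
def AlgReduced (f g : DPoly k n) : Prop :=
  ∀ u : DVar n, leader g = u → degreeOf u f < degreeOf u g

/-- `f` is reduced w.r.t. `g`. -/
def Reduced (f g : DPoly k n) : Prop := PartiallyReduced f g ∧ AlgReduced f g

/-- Autoreduced sets of nonconstant differential polynomials. -/
def Autoreduced (A : Finset (DPoly k n)) : Prop :=
  (∀ f ∈ A, f ∉ constants k n) ∧ ∀ f ∈ A, ∀ g ∈ A, f ≠ g → Reduced f g

/-- The system `A = 0, H ≠ 0` is regular. -/
def IsRegularSystem (A H : Finset (DPoly k n)) : Prop :=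
  Autoreduced A ∧ (∀ h ∈ H, ∀ a ∈ A, PartiallyReduced h a) ∧ inisep A ⊆ H

/-- One algebraic pseudo-division: `f` is not algebraically reduced w.r.t. `g ∈ B`, and `r` is a
pseudo-remainder of `f` by `g`, both viewed as univariate polynomials in the leader `u` of `g`. -/
def PseudoStep (B : Finset (DPoly k n)) (f r : DPoly k n) : Prop :=
  ∃ g ∈ B, ∃ u : DVar n, leader g = u ∧ degreeOf u g ≤ degreeOf u f ∧
    degreeOf u r < degreeOf u g ∧ ∃ (e : ℕ) (q : DPoly k n), initial g ^ e * f = q * g + r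

/-- `r` is a possible value of `algrem(f, B)`: it arises from `f` by finitely many
pseudo-divisions by elements of `B`, and it is algebraically reduced w.r.t. all of `B`. -/
def AlgRem (B : Finset (DPoly k n)) (f r : DPoly k n) : Prop :=
  Relation.ReflTransGen (PseudoStep B) f r ∧ ∀ g ∈ B, AlgReduced r g

/-- `R` is a possible value of `algrem(G, B) = {algrem(g, B) | g ∈ G}`. -/
def AlgRemSet (B G R : Finset (DPoly k n)) : Prop :=
  ∃ ρ : DPoly k n → DPoly k n, (∀ g ∈ G, AlgRem B g (ρ g)) ∧ R = G.image ρ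

/-- `B^0 = {min B_v | v ∈ lv B}`. -/
def lowest (B : Finset (DPoly k n)) : Finset (DPoly k n) :=
  B.filter fun f => ∀ g ∈ B, lv g = lv f → rank f ≤ rank g

/-- `B^* = {max B_v | v ∈ lv B}`. -/
def highest (B : Finset (DPoly k n)) : Finset (DPoly k n) :=
  B.filter fun f => ∀ g ∈ B, lv g = lv f → rank g ≤ rank f

/-- The elements of `F` whose leader `y^(j)` satisfies `j ≤ m_y`. -/
def bounded (m : Fin n → ℕ) (F : Finset (DPoly k n)) : Finset (DPoly k n) :=
  F.filter fun f => ∀ u : DVar n, leader f = u → u.ord ≤ m u.var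

end Ranking

/-! ## The algorithm

The loops are given by a nondeterministic transition relation: every choice that the pseudo-code
leaves open (the triple to be treated, an element of least rank, the order in which
pseudo-divisions are carried out) is left open. -/

section Algorithm

variable {k : Type*} [Field k] [Differential k] {n : ℕ} [LinearOrder (DVar n)]

/-- `D ∪ (δ B^*)_{m_i}`, the set that controls the loop of Differentiate&Autoreduce. -/
def candidates (m : Fin n → ℕ) (D B : Finset (DPoly k n)) : Finset (DPoly k n) :=
  D ∪ bounded m ((highest B).image (delta k n))

/-- `f` is an element of least rank of `F`. -/
def IsLeastRank (F : Finset (DPoly k n)) (f : DPoly k n) : Prop :=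
  f ∈ F ∧ ∀ g ∈ F, rank f ≤ rank g

/-- The set w.r.t. which `f` is reduced in the loop of Differentiate&Autoreduce. -/
def divisors (D B : Finset (DPoly k n)) (f : DPoly k n) : Finset (DPoly k n) :=
  if f ∈ D then B else B ∪ ((lowest B).image (delta k n)).erase f

end Algorithm

/-- A system `(F, C, H)` in the list `U`. -/
@[ext]
structure Triple (k : Type*) [Field k] (n : ℕ) where
  F : Finset (DPoly k n)
  C : Finset (DPoly k n)
  H : Finset (DPoly k n)

/-- An output system `(A, H)`. -/
@[ext]
structure Sys (k : Type*) [Field k] (n : ℕ) where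
  A : Finset (DPoly k n)
  H : Finset (DPoly k n)

instance instDecEqTriple {k : Type*} [Field k] {n : ℕ} : DecidableEq (Triple k n) :=
  Classical.decEq _

instance instDecEqSys {k : Type*} [Field k] {n : ℕ} : DecidableEq (Sys k n) :=
  Classical.decEq _

section Algorithm

variable {k : Type*} [Field k] {n : ℕ} [LinearOrder (DVar n)]

/-- `{C ∈ 𝐂 | lv C = lv f}`. -/
def conflict (t : Triple k n) (f : DPoly k n) : Finset (DPoly k n) :=
  t.C.filter fun c => lv c = lv f

/-- `G = F ∪ D \ {f}`, where `D` is the set `conflict t f`. -/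
def newG (t : Triple k n) (f : DPoly k n) : Finset (DPoly k n) :=
  (t.F ∪ conflict t f).erase f

/-- The set `𝐂 \ D ∪ {f}`, where `D` is the set `conflict t f`. -/
def newC (t : Triple k n) (f : DPoly k n) : Finset (DPoly k n) :=
  insert f (t.C \ conflict t f)

/-- The numbers that are passed to Differentiate&Autoreduce. -/
def callOrd (t : Triple k n) (f : DPoly k n) (y : Fin n) : ℕ :=
  maxOrd (newG t f ∪ newC t f ∪ t.H) y

/-- The systems with the separant, respectively the initial, of `f` added. -/
def splits (t : Triple k n) (f : DPoly k n) : Finset (Triple k n) :=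
  if separant f ∈ constants k n then ∅
  else insert ⟨insert (separant f) t.F, t.C, t.H⟩
    (if initial f ∈ constants k n then ∅ else {⟨insert (initial f) t.F, t.C, t.H⟩})

end Algorithm

/-- The configurations of RGBound: either at the head of the main loop, with the sets `U` and `T`,
or at the head of the loop of a call of Differentiate&Autoreduce, made for the triple `t` (already
removed from `U`) and its element `f`, with the current sets `D` and `B` of that loop. -/
inductive Config (k : Type*) [Field k] (n : ℕ)
  | main (U : Finset (Triple k n)) (T : Finset (Sys k n))
  | auto (U : Finset (Triple k n)) (T : Finset (Sys k n)) (t : Triple k n) (f : DPoly k n)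
      (D B : Finset (DPoly k n))

/-- The transitions of RGBound. -/
inductive Step {k : Type*} [Field k] [Differential k] {n : ℕ} [LinearOrder (DVar n)] :
    Config k n → Config k n → Prop
  /-- A triple is taken and removed from `U`, an element `f` of least rank of its first component
  is chosen, and Differentiate&Autoreduce is called. -/
  | call (U : Finset (Triple k n)) (T : Finset (Sys k n)) (t : Triple k n) (f : DPoly k n)
      (ht : t ∈ U) (hf : IsLeastRank t.F f) :
      Step (.main U T) (.auto (U.erase t) T t f (newC t f) ∅)
  /-- The loop of Differentiate&Autoreduce: the remainder `gbar` of `g` has the rank of `g`.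
  (If `g` is not in `D`, then `D` does not change.) -/
  | loop (U : Finset (Triple k n)) (T : Finset (Sys k n)) (t : Triple k n) (f : DPoly k n)
      (D B : Finset (DPoly k n)) (g gbar : DPoly k n)
      (hg : IsLeastRank (candidates (callOrd t f) D B) g)
      (hrem : AlgRem (divisors D B g) g gbar) (hrank : rank gbar = rank g) :
      Step (.auto U T t f D B) (.auto U T t f (D.erase g) (insert gbar B))
  /-- Differentiate&Autoreduce returns `{1}`. -/
  | unit (U : Finset (Triple k n)) (T : Finset (Sys k n)) (t : Triple k n) (f : DPoly k n)
      (D B : Finset (DPoly k n)) (g gbar : DPoly k n)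
      (hg : IsLeastRank (candidates (callOrd t f) D B) g)
      (hrem : AlgRem (divisors D B g) g gbar) (hrank : rank gbar ≠ rank g) :
      Step (.auto U T t f D B) (.main (U ∪ splits t f) T)
  /-- Differentiate&Autoreduce returns `B`; the remainders show that the system is inconsistent. -/
  | discard (U : Finset (Triple k n)) (T : Finset (Sys k n)) (t : Triple k n) (f : DPoly k n)
      (D B : Finset (DPoly k n)) (RF RH : Finset (DPoly k n))
      (hdone : candidates (callOrd t f) D B = ∅)
      (hG : AlgRemSet B (newG t f) RF) (hH : AlgRemSet B t.H RH)
      (hbad : (∃ r ∈ RF.erase 0, r ∈ constants k n) ∨ (0 : DPoly k n) ∈ RH ∪ inisep B) :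
      Step (.auto U T t f D B) (.main (U ∪ splits t f) T)
  /-- Differentiate&Autoreduce returns `B`; a system is added to the output. -/
  | output (U : Finset (Triple k n)) (T : Finset (Sys k n)) (t : Triple k n) (f : DPoly k n)
      (D B : Finset (DPoly k n)) (RF RH : Finset (DPoly k n))
      (hdone : candidates (callOrd t f) D B = ∅)
      (hG : AlgRemSet B (newG t f) RF) (hH : AlgRemSet B t.H RH)
      (hH0 : (0 : DPoly k n) ∉ RH ∪ inisep B) (hempty : RF.erase 0 = ∅) :
      Step (.auto U T t f D B)
        (.main (U ∪ splits t f) (insert ⟨lowest B, RH ∪ inisep B⟩ T))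
  /-- Differentiate&Autoreduce returns `B`; a new triple is added to `U`. -/
  | push (U : Finset (Triple k n)) (T : Finset (Sys k n)) (t : Triple k n) (f : DPoly k n)
      (D B : Finset (DPoly k n)) (RF RH : Finset (DPoly k n))
      (hdone : candidates (callOrd t f) D B = ∅)
      (hG : AlgRemSet B (newG t f) RF) (hH : AlgRemSet B t.H RH)
      (hconst : ∀ r ∈ RF.erase 0, r ∉ constants k n)
      (hH0 : (0 : DPoly k n) ∉ RH ∪ inisep B) (hne : (RF.erase 0).Nonempty) :
      Step (.auto U T t f D B)
        (.main (insert ⟨RF.erase 0, lowest B, RH ∪ inisep B⟩ U ∪ splits t f) T)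

/-- The initial configuration `U = {(F₀, ∅, H₀)}`, `T = ∅`. -/
def start {k : Type*} [Field k] {n : ℕ} (F₀ H₀ : Finset (DPoly k n)) : Config k n :=
  .main {⟨F₀, ∅, H₀⟩} ∅

/-- The configurations that occur in some run of RGBound on the input `(F₀, H₀)`. -/
def Reachable {k : Type*} [Field k] [Differential k] {n : ℕ} [LinearOrder (DVar n)]
    (F₀ H₀ : Finset (DPoly k n)) (c : Config k n) : Prop :=
  Relation.ReflTransGen Step (start F₀ H₀) c

end RG

end

open RG

noncomputable section

namespace RG

open MvPolynomial
open scoped Differential Classical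

/-! ## Differential polynomials as univariate polynomials -/

section Uni

variable {k : Type*} [Field k] {n : ℕ}

/-! Every transition preserves an invariant (`ConfigInv`) and lowers a well-founded measure
(`configMeasure`). Three threads are combined.

Ideals. `{F} : H^∞` is the least radical differential ideal that contains `F` and modulo which
multiplication by each element of `H` is injective (`sysIdeal_le`, `Cancels`). Pseudo-division
multiplies by a power of an initial that cancels and subtracts a multiple of the divisor, so modulo
such an ideal a polynomial, its initial and its separant may be exchanged for those of its
remainder. Hence a successful call of Differentiate&Autoreduce does not change the ideal saturated
by the initial and separant of `f` (`callIdeal_eq`), and an unsuccessful one shows that this ideal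
is the unit ideal. The difference to the ideal of the triple is made up by the branches `s_f = 0`
and `i_f = 0` (`sysIdeal_eq_inf_insert`, `tripleIdeal_eq`). For an output system, `{A} : H^∞ = [A] :
H^∞`, because the latter is radical: a membership involves finitely many derivatives of elements of
`A`, these form a triangular set, and the ideal of a triangular set, saturated by its initials and
separants, is radical (`isRadical_saturation_inisep`).

Orders. Let the leaders passed to a call have orders `a_y`, and let `m_y` be the bounds. The
elements of `B` have distinct leaders `y^(j)` with `a_y ≤ j ≤ m_y`, so there are at most `∑ (m_y -
a_y)` differentiations. Each of them raises the orders of the non-leading variables by at most one,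
whereas after reduction the leading variables occur to order at most `a_y`. The weight `n - |Z|` in
`M_Z` balances this gain against this loss, so that `M_Z` does not grow. A new leading variable
costs the factor `n - |Z| - 1` (`weightedOrd_insert_le`), and the product of these factors is at
most `(n-1)!`. Once all variables are leading, no order grows.

Termination. The triples that replace a triple are smaller: either `C` gets smaller least ranks
(`tripleLT_exit`), or `C` is unchanged and the least rank in `F` drops (`tripleLT_of_mem_splits`).
So `U` decreases in the multiset ordering, and within a call the size of `B` is bounded
(`card_le_sum_succ`). -/

lemma coeff_coeffIn (u : DVar n) (d : ℕ) (f : DPoly k n) (m : DVar n →₀ ℕ) :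
    coeff m (coeffIn u d f) = if m u = 0 then coeff (m + Finsupp.single u d) f else 0 := by
  rw [coeffIn, coeff_sum]
  simp only [coeff_monomial]
  split_ifs with h
  · by_cases hm : m + Finsupp.single u d ∈ f.support
    · rw [Finset.sum_eq_single_of_mem (m + Finsupp.single u d)]
      · rw [if_pos]
        ext v
        by_cases hv : v = u
        · subst hv; simp [h]
        · simp [Finsupp.erase_ne hv]
      · simp [h, hm, Finset.mem_filter]
      · intro m' hm' hne
        rw [if_neg]
        rintro rfl
        apply hne
        rw [← (Finset.mem_filter.mp hm').2, Finsupp.erase_add_single]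
    · rw [notMem_support_iff.mp hm]
      refine Finset.sum_eq_zero fun m' hm' => if_neg ?_
      rintro rfl
      apply hm
      rw [← (Finset.mem_filter.mp hm').2, Finsupp.erase_add_single]
      exact (Finset.mem_filter.mp hm').1
  · refine Finset.sum_eq_zero fun m' _ => if_neg ?_
    rintro rfl
    exact h Finsupp.erase_same

/-- `f`, viewed as a univariate polynomial in `u`. -/
def toUni (u : DVar n) : DPoly k n →ₐ[k] Polynomial (DPoly k n) :=
  aeval fun v => if v = u then Polynomial.X else Polynomial.C (X v)

lemma toUni_X_self (u : DVar n) : toUni u (X u : DPoly k n) = Polynomial.X := by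
  simp [toUni]

lemma toUni_X_of_ne {u v : DVar n} (h : v ≠ u) :
    toUni u (X v : DPoly k n) = Polynomial.C (X v) := by
  simp [toUni, h]

lemma toUni_C (u : DVar n) (a : k) : toUni u (C a : DPoly k n) = Polynomial.C (C a) := by
  rw [toUni, aeval_C]; rfl

lemma toUni_monomial (u : DVar n) (m : DVar n →₀ ℕ) (a : k) :
    toUni u (monomial m a) = Polynomial.C (monomial (m.erase u) a) * Polynomial.X ^ (m u) := by
  have h : ∀ m' : DVar n →₀ ℕ, m' u = 0 →
      toUni u (monomial m' a) = Polynomial.C (monomial m' a) := by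
    intro m' hm'
    induction m' using Finsupp.induction with
    | zero => exact toUni_C u a
    | single_add v b m' hv hb ih =>
      have hvu : v ≠ u := by
        rintro rfl
        simp at hm'
        exact hb hm'.1
      have h0 : m' u = 0 := by
        simpa [Finsupp.single_eq_of_ne (Ne.symm hvu)] using hm'
      rw [add_comm, monomial_add_single, map_mul, map_pow, toUni_X_of_ne hvu, ih h0]
      simp
  conv_lhs => rw [← Finsupp.erase_add_single u m]
  rw [monomial_add_single, map_mul, map_pow, toUni_X_self, h _ Finsupp.erase_same]

/-- This is the bridge that makes the library of univariate polynomials available for initials and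
degrees. -/
lemma coeff_toUni (u : DVar n) (d : ℕ) (f : DPoly k n) :
    (toUni u f).coeff d = coeffIn u d f := by
  conv_lhs => rw [f.as_sum]
  rw [map_sum, Polynomial.finsetSum_coeff, coeffIn, Finset.sum_filter]
  refine Finset.sum_congr rfl fun m _ => ?_
  rw [toUni_monomial, Polynomial.coeff_C_mul_X_pow]
  simp only [eq_comm]

lemma natDegree_toUni (u : DVar n) (f : DPoly k n) :
    (toUni u f).natDegree = degreeOf u f := by
  apply le_antisymm
  · rw [Polynomial.natDegree_le_iff_coeff_eq_zero]
    intro N hN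
    rw [coeff_toUni, coeffIn, Finset.filter_eq_empty_iff.mpr, Finset.sum_empty]
    intro m hm h
    exact absurd (monomial_le_degreeOf u hm) (by omega)
  · rw [degreeOf_le_iff]
    intro m hm
    apply Polynomial.le_natDegree_of_ne_zero
    rw [coeff_toUni]
    intro h
    have := congrArg (coeff (m.erase u)) h
    rw [coeff_coeffIn, if_pos Finsupp.erase_same, Finsupp.erase_add_single] at this
    exact mem_support_iff.mp hm this

lemma eval_toUni (u : DVar n) (f : DPoly k n) : (toUni u f).eval (X u) = f := by
  have : (((Polynomial.aeval (X u : DPoly k n)).restrictScalars k).comp (toUni u)) =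
      AlgHom.id k (DPoly k n) := by
    apply MvPolynomial.algHom_ext
    intro v
    by_cases h : v = u
    · subst h; simp [toUni_X_self]
    · simp [toUni_X_of_ne h]
  have h := congrArg (fun φ => φ f) this
  simpa [Polynomial.aeval_def] using h

lemma toUni_injective (u : DVar n) : Function.Injective (toUni u : DPoly k n → _) :=
  fun f g h => by rw [← eval_toUni u f, h, eval_toUni]

lemma derivative_toUni (u : DVar n) (f : DPoly k n) :
    (toUni u f).derivative = toUni u (pderiv u f) := by
  induction f using MvPolynomial.induction_on with
  | C a => simp
  | add p q hp hq => simp [hp, hq]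
  | mul_X p v hp =>
    rw [map_mul, Polynomial.derivative_mul, hp, Derivation.leibniz, map_add, smul_eq_mul,
      smul_eq_mul, map_mul, map_mul]
    by_cases h : v = u
    · subst h; simp [toUni_X_self]; ring
    · simp [toUni_X_of_ne h, pderiv_X_of_ne h]; ring

lemma notMem_vars_iff {u : DVar n} {f : DPoly k n} : u ∉ f.vars ↔ degreeOf u f = 0 := by
  rw [mem_vars_iff_degreeOf_ne_zero, not_not]

lemma toUni_of_notMem {u : DVar n} {f : DPoly k n} (h : u ∉ f.vars) :
    toUni u f = Polynomial.C f := by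
  have h0 : (toUni u f).natDegree = 0 := by rw [natDegree_toUni, notMem_vars_iff.mp h]
  rw [Polynomial.eq_C_of_natDegree_eq_zero h0]
  congr 1
  conv_rhs => rw [← eval_toUni u f, Polynomial.eq_C_of_natDegree_eq_zero h0, Polynomial.eval_C]

lemma notMem_vars_coeffIn (u : DVar n) (d : ℕ) (f : DPoly k n) : u ∉ (coeffIn u d f).vars := by
  rw [mem_vars_iff_mem_support]
  rintro ⟨m, hm, hu⟩
  rw [mem_support_iff, coeff_coeffIn] at hm
  rw [Finsupp.mem_support_iff] at hu
  exact hm (if_neg hu)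

lemma degreeOf_coeffIn_le (u v : DVar n) (d : ℕ) (f : DPoly k n) :
    degreeOf v (coeffIn u d f) ≤ degreeOf v f := by
  rw [degreeOf_le_iff]
  intro m hm
  rw [mem_support_iff, coeff_coeffIn] at hm
  split_ifs at hm with h
  · have := monomial_le_degreeOf v (mem_support_iff.mpr hm)
    rw [Finsupp.add_apply] at this
    omega
  · exact absurd rfl hm

lemma coeffIn_eq_zero_of_lt {u : DVar n} {d : ℕ} {f : DPoly k n} (h : degreeOf u f < d) :
    coeffIn u d f = 0 := by
  rw [← coeff_toUni]
  exact Polynomial.coeff_eq_zero_of_natDegree_lt (by rwa [natDegree_toUni])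

lemma coeffIn_mul_of_notMem {u : DVar n} {d : ℕ} {f g : DPoly k n} (h : u ∉ g.vars) :
    coeffIn u d (f * g) = coeffIn u d f * g := by
  rw [← coeff_toUni, map_mul, toUni_of_notMem h, Polynomial.coeff_mul_C, coeff_toUni]

lemma coeffIn_add (u : DVar n) (d : ℕ) (f g : DPoly k n) :
    coeffIn u d (f + g) = coeffIn u d f + coeffIn u d g := by
  simp only [← coeff_toUni, map_add, Polynomial.coeff_add]

lemma coeffIn_degreeOf_ne_zero {u : DVar n} {f : DPoly k n} (h : f ≠ 0) :
    coeffIn u (degreeOf u f) f ≠ 0 := by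
  rw [← coeff_toUni, ← natDegree_toUni, Polynomial.coeff_natDegree,
    Polynomial.leadingCoeff_ne_zero]
  exact fun h0 => h (toUni_injective u (by rw [h0, map_zero]))

lemma degreeOf_le_of_coeffIn {u : DVar n} {f : DPoly k n} {d : ℕ}
    (h : ∀ N, d < N → coeffIn u N f = 0) : degreeOf u f ≤ d := by
  rw [← natDegree_toUni, Polynomial.natDegree_le_iff_coeff_eq_zero]
  intro N hN
  rw [coeff_toUni, h N hN]

lemma degreeOf_pderiv_le (u v : DVar n) (f : DPoly k n) :
    degreeOf v (pderiv u f) ≤ degreeOf v f := by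
  rw [degreeOf_le_iff]
  intro m hm
  rw [mem_support_iff, coeff_pderiv] at hm
  have := monomial_le_degreeOf v (mem_support_iff.mpr (left_ne_zero_of_mul hm))
  rw [Finsupp.add_apply] at this
  omega

lemma degreeOf_pderiv_self_lt {u : DVar n} {f : DPoly k n} (h : 0 < degreeOf u f) :
    degreeOf u (pderiv u f) < degreeOf u f := by
  rw [degreeOf_lt_iff h]
  intro m hm
  rw [mem_support_iff, coeff_pderiv] at hm
  have := monomial_le_degreeOf u (mem_support_iff.mpr (left_ne_zero_of_mul hm))
  rw [Finsupp.add_apply, Finsupp.single_eq_same] at this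
  omega

lemma vars_subset_of_degreeOf_le {f g : DPoly k n} (h : ∀ v, degreeOf v f ≤ degreeOf v g) :
    f.vars ⊆ g.vars := by
  intro v hv
  rw [mem_vars_iff_degreeOf_ne_zero] at hv ⊢
  have := h v
  omega

lemma mem_constants_iff {f : DPoly k n} : f ∈ constants k n ↔ f.vars = ∅ := by
  constructor
  · rintro ⟨a, rfl⟩; exact vars_C
  · intro h
    exact ⟨_, (vars_eq_empty_iff_eq_C.mp h).symm⟩

end Uni

/-! ## Leaders, initials and separants -/

section Leader

variable {k : Type*} [Field k] {n : ℕ} [LinearOrder (DVar n)]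

lemma leader_eq_iff {f : DPoly k n} {u : DVar n} :
    leader f = u ↔ u ∈ f.vars ∧ ∀ v ∈ f.vars, v ≤ u := by
  constructor
  · intro h
    exact ⟨Finset.mem_of_max h, fun v hv => Finset.le_max_of_eq hv h⟩
  · rintro ⟨h1, h2⟩
    apply le_antisymm
    · exact Finset.max_le fun v hv => WithBot.coe_le_coe.mpr (h2 v hv)
    · exact Finset.le_max h1

lemma leader_eq_bot_iff {f : DPoly k n} : leader f = ⊥ ↔ f ∈ constants k n := by
  rw [leader, Finset.max_eq_bot, mem_constants_iff]

lemma exists_leader {f : DPoly k n} (h : f ∉ constants k n) : ∃ u : DVar n, leader f = u := by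
  rw [← leader_eq_bot_iff] at h
  obtain ⟨u, hu⟩ := WithBot.ne_bot_iff_exists.mp h
  exact ⟨u, hu.symm⟩

lemma leader_mem {f : DPoly k n} {u : DVar n} (h : leader f = u) : u ∈ f.vars :=
  (leader_eq_iff.mp h).1

lemma le_leader {f : DPoly k n} {u v : DVar n} (h : leader f = u) (hv : v ∈ f.vars) : v ≤ u :=
  (leader_eq_iff.mp h).2 v hv

lemma notMem_constants_of_leader {f : DPoly k n} {u : DVar n} (h : leader f = u) :
    f ∉ constants k n := by
  rw [← leader_eq_bot_iff, h]
  exact WithBot.coe_ne_bot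

lemma ne_zero_of_leader {f : DPoly k n} {u : DVar n} (h : leader f = u) : f ≠ 0 := by
  rintro rfl
  exact notMem_constants_of_leader h ⟨0, map_zero _⟩

lemma degreeOf_leader_pos {f : DPoly k n} {u : DVar n} (h : leader f = u) :
    0 < degreeOf u f :=
  Nat.pos_of_ne_zero (mem_vars_iff_degreeOf_ne_zero.mp (leader_mem h))

lemma lv_of_leader {f : DPoly k n} {u : DVar n} (h : leader f = u) : lv f = u.var := by
  rw [lv, h, WithBot.map_coe]

lemma lv_eq_iff {f : DPoly k n} {y : Fin n} :
    lv f = y ↔ ∃ u : DVar n, leader f = u ∧ u.var = y := by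
  constructor
  · intro h
    by_cases hf : f ∈ constants k n
    · rw [lv, leader_eq_bot_iff.mpr hf] at h
      exact absurd h.symm WithBot.coe_ne_bot
    · obtain ⟨u, hu⟩ := exists_leader hf
      rw [lv_of_leader hu] at h
      exact ⟨u, hu, WithBot.coe_injective h⟩
  · rintro ⟨u, hu, rfl⟩
    exact lv_of_leader hu

lemma rank_of_leader {f : DPoly k n} {u : DVar n} (h : leader f = u) :
    rank f = (toLex (u, degreeOf u f) : DVar n ×ₗ ℕ) := by
  rw [rank, h, WithBot.map_coe]

lemma rank_eq_iff {f g : DPoly k n} {u : DVar n} (h : leader g = u) :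
    rank f = rank g ↔ leader f = u ∧ degreeOf u f = degreeOf u g := by
  constructor
  · intro hr
    rw [rank_of_leader h] at hr
    by_cases hf : f ∈ constants k n
    · rw [rank, leader_eq_bot_iff.mpr hf] at hr
      exact absurd hr.symm WithBot.coe_ne_bot
    · obtain ⟨v, hv⟩ := exists_leader hf
      rw [rank_of_leader hv] at hr
      have h1 := toLex.injective (WithBot.coe_injective hr)
      rw [Prod.mk.injEq] at h1
      obtain ⟨rfl, h2⟩ := h1
      exact ⟨hv, h2⟩
  · rintro ⟨h1, h2⟩
    rw [rank_of_leader h, rank_of_leader h1, h2]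

lemma leader_le_of_rank_le {f g : DPoly k n} (h : rank f ≤ rank g) : leader f ≤ leader g := by
  by_cases hf : f ∈ constants k n
  · rw [leader_eq_bot_iff.mpr hf]; exact bot_le
  obtain ⟨u, hu⟩ := exists_leader hf
  by_cases hg : g ∈ constants k n
  · rw [rank_of_leader hu, rank, leader_eq_bot_iff.mpr hg] at h
    exact absurd h (by simp)
  obtain ⟨v, hv⟩ := exists_leader hg
  rw [rank_of_leader hu, rank_of_leader hv, WithBot.coe_le_coe, Prod.Lex.toLex_le_toLex] at h
  rw [hu, hv, WithBot.coe_le_coe]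
  rcases h with h | h
  · exact h.le
  · exact h.1.le

lemma rank_lt_of_leader_lt {f g : DPoly k n} (h : leader f < leader g) : rank f < rank g := by
  by_contra hlt
  exact absurd (leader_le_of_rank_le (not_lt.mp hlt)) (not_le.mpr h)

lemma initial_of_leader {f : DPoly k n} {u : DVar n} (h : leader f = u) :
    initial f = coeffIn u (degreeOf u f) f := by
  have hne : f.vars.Nonempty := ⟨u, leader_mem h⟩
  have hm : f.vars.max' hne = u := by
    have := Finset.coe_max' hne
    rw [leader] at h
    rw [h] at this
    exact WithBot.coe_injective this
  rw [initial, dif_pos hne, hm]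

lemma separant_of_leader {f : DPoly k n} {u : DVar n} (h : leader f = u) :
    separant f = pderiv u f := by
  have hne : f.vars.Nonempty := ⟨u, leader_mem h⟩
  have hm : f.vars.max' hne = u := by
    have := Finset.coe_max' hne
    rw [leader] at h
    rw [h] at this
    exact WithBot.coe_injective this
  rw [separant, dif_pos hne, hm]

lemma notMem_vars_initial {f : DPoly k n} {u : DVar n} (h : leader f = u) :
    u ∉ (initial f).vars := by
  rw [initial_of_leader h]
  exact notMem_vars_coeffIn _ _ _

lemma initial_ne_zero {f : DPoly k n} {u : DVar n} (h : leader f = u) : initial f ≠ 0 := by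
  rw [initial_of_leader h]
  exact coeffIn_degreeOf_ne_zero (ne_zero_of_leader h)

lemma degreeOf_initial_le (f : DPoly k n) (v : DVar n) :
    degreeOf v (initial f) ≤ degreeOf v f := by
  by_cases hf : f ∈ constants k n
  · rw [initial, dif_neg]
    rw [mem_constants_iff.mp hf]; simp
  · obtain ⟨u, hu⟩ := exists_leader hf
    rw [initial_of_leader hu]
    exact degreeOf_coeffIn_le _ _ _ _

lemma degreeOf_separant_le (f : DPoly k n) (v : DVar n) :
    degreeOf v (separant f) ≤ degreeOf v f := by
  by_cases hf : f ∈ constants k n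
  · rw [separant, dif_neg]
    · simp
    rw [mem_constants_iff.mp hf]; simp
  · obtain ⟨u, hu⟩ := exists_leader hf
    rw [separant_of_leader hu]
    exact degreeOf_pderiv_le _ _ _

lemma vars_initial_subset (f : DPoly k n) : (initial f).vars ⊆ f.vars :=
  vars_subset_of_degreeOf_le (degreeOf_initial_le f)

lemma vars_separant_subset (f : DPoly k n) : (separant f).vars ⊆ f.vars :=
  vars_subset_of_degreeOf_le (degreeOf_separant_le f)

lemma leader_le_of_vars_subset {f g : DPoly k n} (h : f.vars ⊆ g.vars) : leader f ≤ leader g :=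
  Finset.max_mono h

lemma rank_lt_of_degreeOf_lt {f g : DPoly k n} {u : DVar n} (hu : leader g = u)
    (hs : f.vars ⊆ g.vars) (hd : degreeOf u f < degreeOf u g) : rank f < rank g := by
  rcases (leader_le_of_vars_subset hs).lt_or_eq with h | h
  · exact rank_lt_of_leader_lt h
  · rw [hu] at h
    rw [rank_of_leader h, rank_of_leader hu, WithBot.coe_lt_coe, Prod.Lex.toLex_lt_toLex]
    exact Or.inr ⟨rfl, hd⟩

lemma degreeOf_initial_lt {f : DPoly k n} {u : DVar n} (h : leader f = u) :
    degreeOf u (initial f) < degreeOf u f := by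
  rw [notMem_vars_iff.mp (notMem_vars_initial h)]
  exact degreeOf_leader_pos h

lemma degreeOf_separant_lt {f : DPoly k n} {u : DVar n} (h : leader f = u) :
    degreeOf u (separant f) < degreeOf u f := by
  rw [separant_of_leader h]
  exact degreeOf_pderiv_self_lt (degreeOf_leader_pos h)

lemma rank_initial_lt {f : DPoly k n} (h : f ∉ constants k n) : rank (initial f) < rank f := by
  obtain ⟨u, hu⟩ := exists_leader h
  exact rank_lt_of_degreeOf_lt hu (vars_initial_subset f) (degreeOf_initial_lt hu)

lemma rank_separant_lt {f : DPoly k n} (h : f ∉ constants k n) : rank (separant f) < rank f := by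
  obtain ⟨u, hu⟩ := exists_leader h
  exact rank_lt_of_degreeOf_lt hu (vars_separant_subset f) (degreeOf_separant_lt hu)

lemma leadingCoeff_toUni {f : DPoly k n} {u : DVar n} (h : leader f = u) :
    (toUni u f).leadingCoeff = initial f := by
  rw [Polynomial.leadingCoeff, natDegree_toUni, coeff_toUni, initial_of_leader h]

lemma separant_ne_zero [CharZero k] {f : DPoly k n} {u : DVar n} (h : leader f = u) :
    separant f ≠ 0 := by
  intro h0
  rw [separant_of_leader h] at h0
  have h1 : (toUni u f).derivative = 0 := by rw [derivative_toUni, h0, map_zero]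
  have h2 := Polynomial.derivative_eq_zero.mp h1
  rw [natDegree_toUni] at h2
  exact absurd (degreeOf_leader_pos h) (by omega)

/-- A separant in the base field is equal to the initial. -/
lemma initial_eq_separant [CharZero k] {f : DPoly k n} {u : DVar n}
    (h : leader f = u) (hs : separant f ∈ constants k n) : initial f = separant f := by
  have hsep := separant_of_leader h
  have h1 : (toUni u f).derivative = Polynomial.C (separant f) := by
    rw [derivative_toUni, ← hsep, toUni_of_notMem]
    rw [mem_constants_iff.mp hs]; simp
  have hpos := degreeOf_leader_pos h
  -- In characteristic zero differentiation lowers a positive degree by exactly one, and here the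
  -- derivative has degree zero.
  have hd : degreeOf u f = 1 := by
    have h2 := Polynomial.natDegree_derivative (toUni u f)
    rw [h1, Polynomial.natDegree_C, natDegree_toUni] at h2
    omega
  have h3 := congrArg (fun p => p.coeff 0) h1
  simp only [Polynomial.coeff_derivative, Polynomial.coeff_C_zero] at h3
  rw [initial_of_leader h, hd, ← coeff_toUni, ← h3]
  simp

end Leader

/-! ## The derivation -/

section Delta

variable {k : Type*} [Field k] [Differential k] {n : ℕ}

/-- The polynomials in a given set of variables form a subalgebra, so by the Leibniz rule only
constants and variables have to be checked. -/
lemma vars_delta_subset (f : DPoly k n) {v : DVar n} (hv : v ∈ (delta k n f).vars) :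
    v ∈ f.vars ∨ ∃ w ∈ f.vars, v = w.shift 1 := by
  let W : Set (DVar n) := {v | v ∈ f.vars ∨ ∃ w ∈ f.vars, v = w.shift 1}
  have hle : supported k (f.vars : Set (DVar n)) ≤ supported k W :=
    supported_mono fun w hw => Or.inl hw
  have key : ∀ g ∈ supported k (f.vars : Set (DVar n)), delta k n g ∈ supported k W := by
    intro g hg
    rw [supported_eq_adjoin_X] at hg
    induction hg using Algebra.adjoin_induction with
    | mem x hx =>
      obtain ⟨w, hw, rfl⟩ := hx
      rw [delta_X]
      exact X_mem_supported.mpr (Or.inr ⟨w, hw, rfl⟩)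
    | algebraMap r =>
      rw [MvPolynomial.algebraMap_eq, delta_C]
      exact Subalgebra.algebraMap_mem _ _
    | add x y hx hy h1 h2 => rw [map_add]; exact add_mem h1 h2
    | mul x y hx hy h1 h2 =>
      rw [Derivation.leibniz, smul_eq_mul, smul_eq_mul]
      exact add_mem (mul_mem (hle hx) h2) (mul_mem (hle hy) h1)
  exact mem_supported.mp (key f (mem_supported_vars f)) hv

lemma shift_injective (j : ℕ) : Function.Injective (DVar.shift j : DVar n → DVar n) := by
  intro u v h
  rw [DVar.shift, DVar.shift, DVar.mk.injEq] at h
  exact DVar.ext h.1 (by omega)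

/-- The commutator of `∂/∂u'` and `δ` is the derivation `∂/∂u`; both sides obey the same product
rule, so the generators decide. It is the source of the separant as the coefficient of the leader of
`δ f`. -/
lemma pderiv_delta (u : DVar n) (f : DPoly k n) :
    pderiv (u.shift 1) (delta k n f) = delta k n (pderiv (u.shift 1) f) + pderiv u f := by
  induction f using MvPolynomial.induction_on with
  | C a => simp [delta_C]
  | add p q hp hq => simp only [map_add, hp, hq]; ring
  | mul_X p v hp =>
    have hX : pderiv (u.shift 1) (X (v.shift 1) : DPoly k n) = pderiv u (X v) := by
      by_cases h : v = u
      · subst h; simp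
      · rw [pderiv_X_of_ne h, pderiv_X_of_ne fun h' => h (shift_injective 1 h')]
    have hX' : delta k n (pderiv (u.shift 1) (X v : DPoly k n)) = 0 := by
      by_cases h : v = u.shift 1
      · subst h; simp
      · simp [pderiv_X_of_ne h]
    simp only [Derivation.leibniz, smul_eq_mul, map_add, hp, delta_X, hX, hX']
    ring

variable [LinearOrder (DVar n)]

lemma _root_.IsRanking.lt_shift (hrk : IsRanking n) (u : DVar n) : u < u.shift 1 := by
  refine lt_of_le_of_ne (hrk.le_shift 1 u) fun h => ?_
  have := congrArg DVar.ord h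
  simp [DVar.shift] at this

lemma _root_.IsRanking.le_iff_ord_le (hrk : IsRanking n) {u v : DVar n} (h : u.var = v.var) :
    u ≤ v ↔ u.ord ≤ v.ord := by
  have key : ∀ u v : DVar n, u.var = v.var → u.ord ≤ v.ord → u ≤ v := by
    intro u v h h'
    have : v = u.shift (v.ord - u.ord) := by
      ext
      · simp [DVar.shift, h]
      · simp [DVar.shift]; omega
    rw [this]
    exact hrk.le_shift _ _
  refine ⟨fun hle => ?_, key u v h⟩
  by_contra hlt
  have h1 := key v u h.symm (by omega)
  have : u = v := le_antisymm hle h1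
  subst this
  omega

variable [CharZero k]

/-- The derivative `u'` of the leader does not occur in `f`, so the commutator term of
`pderiv_delta` alone survives. It is the separant, which is free of `u'` and nonzero in
characteristic zero; thus `δ f` is linear in `u'`. -/
lemma degreeOf_delta (hrk : IsRanking n) {f : DPoly k n} {u : DVar n} (h : leader f = u) :
    pderiv (u.shift 1) (delta k n f) = separant f ∧ degreeOf (u.shift 1) (delta k n f) = 1 ∧
      coeffIn (u.shift 1) 1 (delta k n f) = separant f := by
  have hf : u.shift 1 ∉ f.vars := fun h' => absurd (le_leader h h') (not_le.mpr (hrk.lt_shift u))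
  have h1 : pderiv (u.shift 1) (delta k n f) = separant f := by
    rw [pderiv_delta, pderiv_eq_zero_of_notMem_vars hf, map_zero, zero_add, separant_of_leader h]
  have h2 : (toUni (u.shift 1) (delta k n f)).derivative = Polynomial.C (separant f) := by
    rw [derivative_toUni, h1, toUni_of_notMem fun h' => hf (vars_separant_subset f h')]
  have h3 := congrArg (fun p => p.coeff 0) h2
  simp only [Polynomial.coeff_derivative, Polynomial.coeff_C_zero, coeff_toUni] at h3
  have h4 : coeffIn (u.shift 1) 1 (delta k n f) = separant f := by rw [← h3]; simp
  refine ⟨h1, ?_, h4⟩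
  have h5 := Polynomial.natDegree_derivative (toUni (u.shift 1) (delta k n f))
  rw [h2, Polynomial.natDegree_C, natDegree_toUni] at h5
  have h6 : degreeOf (u.shift 1) (delta k n f) ≠ 0 := by
    intro h0
    apply separant_ne_zero h
    rw [← h4, coeffIn_eq_zero_of_lt (by omega)]
  omega

lemma leader_delta (hrk : IsRanking n) {f : DPoly k n} {u : DVar n} (h : leader f = u) :
    leader (delta k n f) = (u.shift 1 : DVar n) := by
  rw [leader_eq_iff]
  constructor
  · rw [mem_vars_iff_degreeOf_ne_zero, (degreeOf_delta hrk h).2.1]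
    exact one_ne_zero
  · intro v hv
    rcases vars_delta_subset f hv with hv | ⟨w, hw, rfl⟩
    · exact (le_leader h hv).trans (hrk.lt_shift u).le
    · exact hrk.shift_le_shift 1 u w (le_leader h hw)

lemma initial_delta (hrk : IsRanking n) {f : DPoly k n} {u : DVar n} (h : leader f = u) :
    initial (delta k n f) = separant f := by
  rw [initial_of_leader (leader_delta hrk h), (degreeOf_delta hrk h).2.1,
    (degreeOf_delta hrk h).2.2]

lemma separant_delta (hrk : IsRanking n) {f : DPoly k n} {u : DVar n} (h : leader f = u) :
    separant (delta k n f) = separant f := by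
  rw [separant_of_leader (leader_delta hrk h), (degreeOf_delta hrk h).1]

end Delta

/-! ## Remainders modulo an ideal -/

section Cancel

variable {k : Type*} [Field k] {n : ℕ}

/-- Multiplication by `h` is injective modulo `Q`. -/
def Cancels (Q : Ideal (DPoly k n)) (h : DPoly k n) : Prop := ∀ x, h * x ∈ Q → x ∈ Q

lemma Cancels.one (Q : Ideal (DPoly k n)) : Cancels Q 1 := fun x h => by rwa [one_mul] at h

lemma Cancels.mul {Q : Ideal (DPoly k n)} {a b : DPoly k n} (ha : Cancels Q a)
    (hb : Cancels Q b) : Cancels Q (a * b) :=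
  fun x h => hb x (ha _ (by rwa [← mul_assoc]))

lemma Cancels.pow {Q : Ideal (DPoly k n)} {a : DPoly k n} (ha : Cancels Q a) (e : ℕ) :
    Cancels Q (a ^ e) := by
  induction e with
  | zero => rw [pow_zero]; exact .one Q
  | succ e ih => rw [pow_succ]; exact ih.mul ha

lemma Cancels.of_mul_right {Q : Ideal (DPoly k n)} {a b : DPoly k n} (h : Cancels Q (a * b)) :
    Cancels Q b := fun x hx => h x (by rw [mul_assoc]; exact Q.mul_mem_left _ hx)

lemma Cancels.congr {Q : Ideal (DPoly k n)} {a b : DPoly k n} (ha : Cancels Q a)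
    (h : a - b ∈ Q) : Cancels Q b := fun x hx => ha x (by
  have : a * x = (a - b) * x + b * x := by ring
  rw [this]
  exact Q.add_mem (Q.mul_mem_right _ h) hx)

lemma Cancels.congr' {Q : Ideal (DPoly k n)} {a b : DPoly k n} (ha : Cancels Q b)
    (h : a - b ∈ Q) : Cancels Q a :=
  ha.congr (by rw [← neg_sub]; exact Q.neg_mem h)

lemma mem_iff_of_sub_mem {Q : Ideal (DPoly k n)} {P f r : DPoly k n} (hP : Cancels Q P)
    (h : P * f - r ∈ Q) : f ∈ Q ↔ r ∈ Q := by
  constructor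
  · intro hf
    have : r = P * f - (P * f - r) := by ring
    rw [this]
    exact Q.sub_mem (Q.mul_mem_left _ hf) h
  · intro hr
    apply hP
    have : P * f = (P * f - r) + r := by ring
    rw [this]
    exact Q.add_mem h hr

/-- Together with `mem_iff_of_sub_mem`, this lets a polynomial and its remainder replace each other,
both as equations and as inequations. The two directions are what the preservation of the ideals
rests on. -/
lemma cancels_iff_of_sub_mem {Q : Ideal (DPoly k n)} {P f r : DPoly k n} (hP : Cancels Q P)
    (h : P * f - r ∈ Q) : Cancels Q f ↔ Cancels Q r :=
  ⟨fun hf => (hP.mul hf).congr h, fun hr => (hr.congr' h).of_mul_right⟩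

lemma sub_mem_trans {Q : Ideal (DPoly k n)} {P P' a b c : DPoly k n} (h : P * a - b ∈ Q)
    (h' : P' * b - c ∈ Q) : P' * P * a - c ∈ Q := by
  have : P' * P * a - c = P' * (P * a - b) + (P' * b - c) := by ring
  rw [this]
  exact Q.add_mem (Q.mul_mem_left _ h) h'

end Cancel

/-! ## Pseudo-division -/

section PseudoDivision

/-- One step of pseudo-division over an arbitrary commutative ring, where leading coefficients may
be zero divisors. Positivity of the degree is needed because the difference may vanish. -/
lemma natDegree_cancelLead_lt {R : Type*} [CommRing R] (a f : Polynomial R)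
    (h : a.natDegree ≤ f.natDegree) (h0 : 0 < f.natDegree) :
    (Polynomial.C a.leadingCoeff * f - Polynomial.C f.leadingCoeff *
      Polynomial.X ^ (f.natDegree - a.natDegree) * a).natDegree < f.natDegree := by
  set p := Polynomial.C a.leadingCoeff * f - Polynomial.C f.leadingCoeff *
      Polynomial.X ^ (f.natDegree - a.natDegree) * a with hp
  have hle : p.natDegree ≤ f.natDegree := by
    refine (Polynomial.natDegree_sub_le _ _).trans (max_le (Polynomial.natDegree_C_mul_le _ _) ?_)
    refine Polynomial.natDegree_mul_le.trans ?_
    have := Polynomial.natDegree_C_mul_X_pow_le f.leadingCoeff (f.natDegree - a.natDegree)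
    omega
  have hc : p.coeff f.natDegree = 0 := by
    have : f.natDegree = a.natDegree + (f.natDegree - a.natDegree) := by omega
    rw [hp, Polynomial.coeff_sub, Polynomial.coeff_C_mul, mul_assoc, Polynomial.coeff_C_mul,
      Polynomial.coeff_natDegree, Polynomial.X_pow_mul]
    have h2 := Polynomial.coeff_mul_X_pow a (f.natDegree - a.natDegree) a.natDegree
    rw [← this] at h2
    rw [h2, Polynomial.coeff_natDegree]
    ring
  refine lt_of_le_of_ne hle fun heq => ?_
  rw [← heq, Polynomial.coeff_natDegree, Polynomial.leadingCoeff_eq_zero] at hc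
  rw [hc, Polynomial.natDegree_zero] at heq
  omega

lemma exists_pseudoDiv {R : Type*} [CommRing R] (a : Polynomial R) (ha : 0 < a.natDegree)
    (f : Polynomial R) : ∃ (e : ℕ) (q r : Polynomial R),
      Polynomial.C a.leadingCoeff ^ e * f = q * a + r ∧ r.natDegree < a.natDegree := by
  induction hN : f.natDegree using Nat.strong_induction_on generalizing f with
  | _ N ih =>
    by_cases h : f.natDegree < a.natDegree
    · exact ⟨0, 0, f, by simp, h⟩
    · obtain ⟨e, q, r, h1, h2⟩ := ih _
        ((natDegree_cancelLead_lt a f (by omega) (by omega)).trans_eq hN) _ rfl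
      refine ⟨e + 1, q + Polynomial.C a.leadingCoeff ^ e * (Polynomial.C f.leadingCoeff *
        Polynomial.X ^ (f.natDegree - a.natDegree)), r, ?_, h2⟩
      linear_combination h1

variable {k : Type*} [Field k] {n : ℕ} [LinearOrder (DVar n)]

lemma exists_pseudoRem {g : DPoly k n} {u : DVar n} (hu : leader g = u) (f : DPoly k n) :
    ∃ (e : ℕ) (q r : DPoly k n), initial g ^ e * f = q * g + r ∧
      degreeOf u r < degreeOf u g := by
  have hpos := degreeOf_leader_pos hu
  induction hN : degreeOf u f using Nat.strong_induction_on generalizing f with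
  | _ N ih =>
    by_cases h : degreeOf u f < degreeOf u g
    · exact ⟨0, 0, f, by simp, h⟩
    · set f' : DPoly k n := initial g * f - coeffIn u (degreeOf u f) f *
        X u ^ (degreeOf u f - degreeOf u g) * g with hf'
      have hdeg : degreeOf u f' < N := by
        have := natDegree_cancelLead_lt (toUni u g) (toUni u f)
          (by rw [natDegree_toUni, natDegree_toUni]; omega) (by rw [natDegree_toUni]; omega)
        rw [leadingCoeff_toUni hu, Polynomial.leadingCoeff, natDegree_toUni, natDegree_toUni,
          coeff_toUni] at this
        rw [← hN, ← natDegree_toUni, hf']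
        simpa only [map_sub, map_mul, map_pow, toUni_X_self,
          toUni_of_notMem (notMem_vars_initial hu),
          toUni_of_notMem (notMem_vars_coeffIn u _ f)] using this
      obtain ⟨e, q, r, h1, h2⟩ := ih _ hdeg f' rfl
      refine ⟨e + 1, q + initial g ^ e * (coeffIn u (degreeOf u f) f *
        X u ^ (degreeOf u f - degreeOf u g)), r, ?_, h2⟩
      rw [hf'] at h1
      linear_combination h1

/-- Compare the coefficients of `v^N` for `N` beyond the degree of `f`: the remainder has
coefficient `-q_N g`. Unless `q_N` vanishes, this has degree in `u` at least that of `g`, which is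
too large for a remainder. Hence the quotient `q` may be arbitrary. -/
lemma degreeOf_pseudoRem_le {f g q r : DPoly k n} {u v : DVar n} {e : ℕ} (hu : leader g = u)
    (hr : degreeOf u r < degreeOf u g) (h : initial g ^ e * f = q * g + r) (hv : v ∉ g.vars) :
    degreeOf v r ≤ degreeOf v f := by
  apply degreeOf_le_of_coeffIn
  intro N hN
  have hv' : v ∉ (initial g ^ e).vars := fun h' => hv (vars_initial_subset g (vars_pow _ _ h'))
  have h1 := congrArg (coeffIn v N) h
  rw [mul_comm, coeffIn_mul_of_notMem hv', coeffIn_eq_zero_of_lt hN, zero_mul, coeffIn_add,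
    coeffIn_mul_of_notMem hv] at h1
  by_cases hq : coeffIn v N q = 0
  · rw [hq, zero_mul, zero_add] at h1
    exact h1.symm
  · exfalso
    have h2 : coeffIn v N r = -coeffIn v N q * g := by linear_combination -h1
    have h3 := degreeOf_coeffIn_le v u N r
    rw [h2, degreeOf_mul_eq (neg_ne_zero.mpr hq) (ne_zero_of_leader hu)] at h3
    omega

/-- Pseudo-reduction by a finite set terminates: the degrees in the leaders of `B`, listed from the
highest leader downwards, decrease lexicographically. -/
theorem wellFounded_pseudoStep (B : Finset (DPoly k n)) :
    WellFounded fun r f : DPoly k n => PseudoStep B f r := by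
  let L : Set (DVar n) := {u | ∃ g ∈ B, leader g = u}
  have hL : L.Finite := by
    refine Set.Finite.subset (Set.Finite.biUnion B.finite_toSet fun g _ => g.vars.finite_toSet) ?_
    rintro u ⟨g, hg, hu⟩
    exact Set.mem_biUnion hg (leader_mem hu)
  have : Finite L := hL
  have hwf : WellFounded (Pi.Lex (fun a b : L => b < a) (fun {_} (a b : ℕ) => a < b)) :=
    Pi.Lex.wellFounded (r := fun a b : L => b < a) (s := fun _ (a b : ℕ) => a < b)
      fun _ => wellFounded_lt
  refine Subrelation.wf (r := InvImage _ fun (f : DPoly k n) (u : L) => degreeOf u.1 f) ?_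
    (InvImage.wf _ hwf)
  rintro r f ⟨g, hg, u, hu, hdf, hdr, e, q, heq⟩
  -- The highest leader in which the degree changes decides the lexicographic comparison. It is at
  -- least `u`. If it is `u`, the degree drops by the definition of pseudo-division; if it is
  -- higher, it does not occur in `g`, so its degree cannot rise.
  let S : Set L := {v | degreeOf v.1 r ≠ degreeOf v.1 f}
  have huS : (⟨u, g, hg, hu⟩ : L) ∈ S := by
    change degreeOf u r ≠ degreeOf u f
    omega
  obtain ⟨w, hw⟩ := S.toFinite.exists_maximal ⟨_, huS⟩
  have hwu : u ≤ w.1 := by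
    by_contra hlt
    exact hlt (hw.le_of_ge huS (not_le.mp hlt).le)
  refine ⟨w, fun j hj => ?_, ?_⟩
  · by_contra hne
    exact absurd (hw.le_of_ge (y := j) hne (le_of_lt hj)) (not_le.mpr hj)
  · rcases hwu.eq_or_lt with h | h
    · change degreeOf w.1 r < degreeOf w.1 f
      rw [← h]
      omega
    · refine lt_of_le_of_ne (degreeOf_pseudoRem_le hu hdr heq fun h' => ?_) hw.prop
      exact absurd (le_leader hu h') (not_le.mpr h)

lemma exists_algRem (B : Finset (DPoly k n)) (f : DPoly k n) : ∃ r, AlgRem B f r := by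
  induction f using (wellFounded_pseudoStep B).induction with
  | _ f ih =>
    by_cases h : ∀ g ∈ B, AlgReduced f g
    · exact ⟨f, .refl, h⟩
    · simp only [AlgReduced] at h
      push Not at h
      obtain ⟨g, hg, u, hu, hd⟩ := h
      obtain ⟨e, q, r, h1, h2⟩ := exists_pseudoRem hu f
      have hs : PseudoStep B f r := ⟨g, hg, u, hu, hd, h2, e, q, h1⟩
      obtain ⟨r', h3, h4⟩ := ih r hs
      exact ⟨r', .head hs h3, h4⟩

lemma exists_algRemSet (B G : Finset (DPoly k n)) : ∃ R, AlgRemSet B G R :=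
  ⟨_, fun g => (exists_algRem B g).choose, fun g _ => (exists_algRem B g).choose_spec, rfl⟩

lemma AlgRem.mem_vars {B : Finset (DPoly k n)} {f r : DPoly k n} (h : AlgRem B f r)
    {v : DVar n} (hv : v ∈ r.vars) : v ∈ f.vars ∨ ∃ g ∈ B, v ∈ g.vars := by
  replace h := h.1
  induction h with
  | refl => exact Or.inl hv
  | tail _ hs ih =>
    obtain ⟨g, hg, u, hu, hdf, hdr, e, q, heq⟩ := hs
    by_cases hvg : v ∈ g.vars
    · exact Or.inr ⟨g, hg, hvg⟩
    · apply ih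
      have := degreeOf_pseudoRem_le hu hdr heq hvg
      rw [mem_vars_iff_degreeOf_ne_zero] at hv ⊢
      omega

lemma AlgRem.exists_mul_sub_mem {Q : Ideal (DPoly k n)} {B : Finset (DPoly k n)}
    {f r : DPoly k n} (h : AlgRem B f r)
    (hB : ∀ g ∈ B, g ∈ Q ∧ Cancels Q (initial g)) :
    ∃ P, Cancels Q P ∧ P * f - r ∈ Q := by
  replace h := h.1
  induction h with
  | refl => exact ⟨1, .one Q, by simp⟩
  | tail _ hs ih =>
    obtain ⟨P, hP, hPf⟩ := ih
    obtain ⟨g, hg, u, hu, hdf, hdr, e, q, heq⟩ := hs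
    refine ⟨initial g ^ e * P, ((hB g hg).2.pow e).mul hP, sub_mem_trans hPf ?_⟩
    rw [heq, add_sub_cancel_right]
    exact Q.mul_mem_left _ (hB g hg).1

/-- The remainder of a polynomial all of whose variables are at most `u`, by polynomials whose
leaders are different from `u`: the coefficients of the powers of `u` and the derivative by `u`
are multiplied by a factor that cancels. -/
lemma AlgRem.exists_mul_sub_mem_of_leader_ne {Q : Ideal (DPoly k n)} {B : Finset (DPoly k n)}
    {f r : DPoly k n} {u : DVar n} (h : AlgRem B f r) (hf : ∀ v ∈ f.vars, v ≤ u)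
    (hne : ∀ g ∈ B, leader g ≠ u)
    (hB : ∀ g ∈ B, leader g < u → g ∈ Q ∧ Cancels Q (initial g)) :
    (∀ v ∈ r.vars, v ≤ u) ∧ degreeOf u r ≤ degreeOf u f ∧ ∃ P, Cancels Q P ∧ P * f - r ∈ Q ∧
      (∀ d, P * coeffIn u d f - coeffIn u d r ∈ Q) ∧ P * pderiv u f - pderiv u r ∈ Q := by
  replace h := h.1
  induction h with
  | refl => exact ⟨hf, le_rfl, 1, .one Q, by simp, by simp, by simp⟩
  | @tail b c _ hs ih =>
    obtain ⟨hb, hdb, P, hP, h1, h2, h3⟩ := ih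
    obtain ⟨g, hg, w, hw, hdf, hdr, e, q, heq⟩ := hs
    -- A divisor that is really used has its leader among the variables of the dividend, hence below
    -- `u`. This is why the hypothesis on the divisors is only required for leaders lower than `u`.
    have hwu : w < u := by
      refine lt_of_le_of_ne (hb w ?_) fun h' => hne g hg (by rw [hw, h'])
      have := degreeOf_leader_pos hw
      rw [mem_vars_iff_degreeOf_ne_zero]
      omega
    have hgu : leader g < u := by rw [hw]; exact WithBot.coe_lt_coe.mpr hwu
    have hug : u ∉ g.vars := fun h' => absurd (le_leader hw h') (not_le.mpr hwu)
    have hui : u ∉ (initial g ^ e).vars := fun h' => hug (vars_initial_subset g (vars_pow _ _ h'))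
    obtain ⟨hgQ, hgi⟩ := hB g hg hgu
    refine ⟨fun v hv => ?_, (degreeOf_pseudoRem_le hw hdr heq hug).trans hdb,
      initial g ^ e * P, (hgi.pow e).mul hP, sub_mem_trans h1 ?_,
      fun d => sub_mem_trans (h2 d) ?_, sub_mem_trans h3 ?_⟩
    · by_cases hvg : v ∈ g.vars
      · exact (le_leader hw hvg).trans hwu.le
      · have := degreeOf_pseudoRem_le hw hdr heq hvg
        apply hb
        rw [mem_vars_iff_degreeOf_ne_zero] at hv ⊢
        omega
    · rw [heq, add_sub_cancel_right]
      exact Q.mul_mem_left _ hgQ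
    · have := congrArg (coeffIn u d) heq
      rw [mul_comm, coeffIn_mul_of_notMem hui, coeffIn_add, coeffIn_mul_of_notMem hug, mul_comm]
        at this
      rw [this, add_sub_cancel_right]
      exact Q.mul_mem_left _ hgQ
    · have := congrArg (pderiv u) heq
      rw [Derivation.leibniz, map_add, Derivation.leibniz, pderiv_eq_zero_of_notMem_vars hui,
        pderiv_eq_zero_of_notMem_vars hug] at this
      simp only [smul_eq_mul, mul_zero, add_zero, zero_add] at this
      rw [this, add_sub_cancel_right]
      exact Q.mul_mem_right _ hgQ

end PseudoDivision

/-! ## Radicality over a radical ideal -/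

section Radicality

/-- Every irreducible factor of `a` divides `a' f`, so the squarefree part of `a` does. The cofactor
`a / rad a` divides `a'`. The product of the two divisibilities is the claim. -/
lemma dvd_derivative_sq_mul {K : Type*} [Field K] {a f : Polynomial K} (ha : a ≠ 0) {M : ℕ}
    (h : a ∣ a.derivative ^ M * f ^ 2) : a ∣ a.derivative ^ 2 * f := by
  have h1 : UniqueFactorizationMonoid.radical a ∣ a.derivative * f := by
    rw [← UniqueFactorizationMonoid.exists_dvd_pow_iff_radical_dvd ha]
    refine ⟨M + 2, h.trans ?_⟩
    rw [mul_pow]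
    exact mul_dvd_mul (pow_dvd_pow _ (by omega)) (pow_dvd_pow _ (by omega))
  have h2 := mul_dvd_mul h1 (divRadical_dvd_derivative a)
  rw [EuclideanDomain.radical_mul_divRadical] at h2
  exact h2.trans (dvd_of_eq (by ring))

/-- The relative version of `dvd_derivative_sq_mul`. The pseudo-remainder `r` of `a'^2 f` by `a`
vanishes modulo every prime over `I` that avoids the leading coefficient: over the residue field `a`
keeps its degree and divides `r`. As `I` is radical, it is the intersection of the primes over it.
-/
lemma derivative_sq_mul_mem {R : Type*} [CommRing R] {I : Ideal R} (hI : I.IsRadical)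
    {a f : Polynomial R} (ha : 0 < a.natDegree) {N M : ℕ}
    (h : Polynomial.C a.leadingCoeff ^ N * a.derivative ^ M * f ^ 2 ∈
      I.map Polynomial.C ⊔ Ideal.span {a}) :
    ∃ e, Polynomial.C a.leadingCoeff ^ e * a.derivative ^ 2 * f ∈
      I.map Polynomial.C ⊔ Ideal.span {a} := by
  obtain ⟨e, q, r, h1, h2⟩ := exists_pseudoDiv a ha (a.derivative ^ 2 * f)
  -- The additional factor takes care of the primes that contain the leading coefficient.
  refine ⟨e + 1, ?_⟩
  have hr : Polynomial.C a.leadingCoeff * r ∈ I.map Polynomial.C := by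
    rw [Ideal.mem_map_C_iff]
    intro j
    rw [Polynomial.coeff_C_mul]
    apply hI
    rw [Ideal.radical_eq_sInf, Ideal.mem_sInf]
    rintro P ⟨hP, hprime⟩
    by_cases hi : a.leadingCoeff ∈ P
    · exact P.mul_mem_right _ hi
    · apply P.mul_mem_left
      set φ := algebraMap R P.ResidueField with hφ
      have hker : ∀ x, φ x = 0 ↔ x ∈ P := fun x => P.algebraMap_residueField_eq_zero
      have hi' : φ a.leadingCoeff ≠ 0 := fun h' => hi ((hker _).mp h')
      have hdeg : (a.map φ).natDegree = a.natDegree :=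
        Polynomial.natDegree_map_of_leadingCoeff_ne_zero φ hi'
      have ha0 : a.map φ ≠ 0 := by
        intro h0
        rw [h0, Polynomial.natDegree_zero] at hdeg
        omega
      obtain ⟨x, hx, y, hy, hxy⟩ := Submodule.mem_sup.mp h
      obtain ⟨c, rfl⟩ := Ideal.mem_span_singleton'.mp hy
      have hx0 : x.map φ = 0 := by
        ext m
        rw [Polynomial.coeff_map, Polynomial.coeff_zero, hker]
        exact hP (Ideal.mem_map_C_iff.mp hx m)
      have h3 := congrArg (Polynomial.map φ) hxy
      simp only [Polynomial.map_add, Polynomial.map_mul, Polynomial.map_pow, Polynomial.map_C, hx0,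
        zero_add] at h3
      rw [← Polynomial.derivative_map, mul_assoc] at h3
      have hunit : IsUnit (Polynomial.C (φ a.leadingCoeff)) :=
        Polynomial.isUnit_C.mpr (isUnit_iff_ne_zero.mpr hi')
      have h4 : a.map φ ∣ (a.map φ).derivative ^ M * (f.map φ) ^ 2 := by
        rw [← (hunit.pow N).dvd_mul_left, ← h3]
        exact dvd_mul_left _ _
      have h5 := dvd_derivative_sq_mul ha0 h4
      have h6 := congrArg (Polynomial.map φ) h1
      simp only [Polynomial.map_add, Polynomial.map_mul, Polynomial.map_pow, Polynomial.map_C]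
        at h6
      rw [← Polynomial.derivative_map] at h6
      have h7 : a.map φ ∣ r.map φ := by
        rw [← dvd_add_right (dvd_mul_left (a.map φ) (q.map φ)), ← h6]
        exact h5.mul_left _
      have h8 : r.map φ = 0 := by
        apply Polynomial.eq_zero_of_dvd_of_natDegree_lt h7
        rw [hdeg]
        exact Polynomial.natDegree_map_le.trans_lt h2
      rw [← hker, ← Polynomial.coeff_map, h8, Polynomial.coeff_zero]
  have : Polynomial.C a.leadingCoeff ^ (e + 1) * a.derivative ^ 2 * f =
      Polynomial.C a.leadingCoeff * r + Polynomial.C a.leadingCoeff * q * a := by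
    linear_combination Polynomial.C a.leadingCoeff * h1
  rw [this]
  exact Submodule.add_mem_sup hr (Ideal.mul_mem_left _ _ (Ideal.mem_span_singleton_self a))

end Radicality

/-! ## Saturations and differential ideals -/

section Ideals

variable {k : Type*} [Field k] {n : ℕ}

lemma le_saturation (I : Ideal (DPoly k n)) (S : Set (DPoly k n)) : I ≤ saturation I S :=
  fun x hx => ⟨1, one_mem _, by rwa [one_mul]⟩

lemma cancels_saturation (I : Ideal (DPoly k n)) {S : Set (DPoly k n)} {h : DPoly k n}
    (hh : h ∈ S) : Cancels (saturation I S) h := by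
  rintro x ⟨s, hs, hx⟩
  exact ⟨s * h, mul_mem hs (Submonoid.subset_closure hh), by rwa [mul_assoc]⟩

lemma cancels_of_mem_closure {J : Ideal (DPoly k n)} {S : Set (DPoly k n)}
    (hS : ∀ h ∈ S, Cancels J h) {s : DPoly k n} (hs : s ∈ Submonoid.closure S) : Cancels J s := by
  induction hs using Submonoid.closure_induction with
  | mem x hx => exact hS x hx
  | one => exact .one J
  | mul x y _ _ hx hy => exact hx.mul hy

lemma saturation_le {I J : Ideal (DPoly k n)} {S : Set (DPoly k n)} (hIJ : I ≤ J)
    (hS : ∀ h ∈ S, Cancels J h) : saturation I S ≤ J := by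
  rintro x ⟨s, hs, hx⟩
  exact cancels_of_mem_closure hS hs x (hIJ hx)

lemma saturation_mono {I J : Ideal (DPoly k n)} {S T : Set (DPoly k n)} (hIJ : I ≤ J)
    (hST : S ⊆ T) : saturation I S ≤ saturation J T := by
  rintro x ⟨s, hs, hx⟩
  exact ⟨s, Submonoid.closure_mono hST hs, hIJ hx⟩

lemma isRadical_iff_sq {I : Ideal (DPoly k n)} : I.IsRadical ↔ ∀ x, x ^ 2 ∈ I → x ∈ I :=
  Ideal.isRadical_iff_pow_one_lt 2 one_lt_two

lemma isRadical_saturation {I : Ideal (DPoly k n)} (hI : I.IsRadical) (S : Set (DPoly k n)) :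
    (saturation I S).IsRadical := by
  rw [isRadical_iff_sq] at hI ⊢
  rintro x ⟨s, hs, hx⟩
  refine ⟨s, hs, hI _ ?_⟩
  have : (s * x) ^ 2 = s * (s * x ^ 2) := by ring
  rw [this]
  exact I.mul_mem_left _ hx

/-- The ideal quotient `Q : x`. -/
def quotientBy (Q : Ideal (DPoly k n)) (x : DPoly k n) : Ideal (DPoly k n) :=
  Submodule.comap (LinearMap.mulLeft (DPoly k n) x) Q

lemma mem_quotientBy {Q : Ideal (DPoly k n)} {x y : DPoly k n} :
    y ∈ quotientBy Q x ↔ x * y ∈ Q := Iff.rfl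

lemma isRadical_quotientBy {Q : Ideal (DPoly k n)} (hQ : Q.IsRadical) (x : DPoly k n) :
    (quotientBy Q x).IsRadical := by
  rw [isRadical_iff_sq] at hQ ⊢
  intro y hy
  rw [mem_quotientBy] at hy ⊢
  apply hQ
  have : (x * y) ^ 2 = x * (x * y ^ 2) := by ring
  rw [this]
  exact Q.mul_mem_left _ hy

variable [Differential k]

/-- From `s x` in `I` one gets `s^2 δx` in `I`, by multiplying `δ(s x)` by `s`. -/
lemma isDiffIdeal_saturation {I : Ideal (DPoly k n)} (hI : IsDiffIdeal I)
    (S : Set (DPoly k n)) : IsDiffIdeal (saturation I S) := by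
  rintro x ⟨s, hs, hx⟩
  refine ⟨s * s, mul_mem hs hs, ?_⟩
  have h1 := hI _ hx
  rw [Derivation.leibniz, smul_eq_mul, smul_eq_mul] at h1
  have : s * s * delta k n x =
      s * (s * delta k n x + x * delta k n s) - delta k n s * (s * x) := by ring
  rw [this]
  exact I.sub_mem (I.mul_mem_left _ h1) (I.mul_mem_left _ hx)

/-- Radicality is essential: differentiating `x y` only yields that the square of `x δy` lies in
`Q`. -/
lemma isDiffIdeal_quotientBy {Q : Ideal (DPoly k n)} (hQ : IsDiffIdeal Q) (hrad : Q.IsRadical)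
    (x : DPoly k n) : IsDiffIdeal (quotientBy Q x) := by
  intro y hy
  rw [mem_quotientBy] at hy ⊢
  rw [isRadical_iff_sq] at hrad
  apply hrad
  have h1 := hQ _ hy
  rw [Derivation.leibniz, smul_eq_mul, smul_eq_mul] at h1
  have : (x * delta k n y) ^ 2 = x * delta k n y * (x * delta k n y + y * delta k n x) -
      delta k n y * delta k n x * (x * y) := by ring
  rw [this]
  exact Q.sub_mem (Q.mul_mem_left _ h1) (Q.mul_mem_left _ hy)

lemma subset_diffIdeal (F : Set (DPoly k n)) : F ⊆ diffIdeal F := fun x hx => by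
  rw [SetLike.mem_coe, diffIdeal, Ideal.mem_sInf]
  exact fun _ hI => hI.1 hx

lemma isDiffIdeal_diffIdeal (F : Set (DPoly k n)) : IsDiffIdeal (diffIdeal F) := by
  intro x hx
  rw [diffIdeal, Ideal.mem_sInf] at hx ⊢
  exact fun _ hI => hI.2 _ (hx hI)

lemma diffIdeal_le {F : Set (DPoly k n)} {I : Ideal (DPoly k n)} (h : F ⊆ I)
    (hI : IsDiffIdeal I) : diffIdeal F ≤ I := sInf_le ⟨h, hI⟩

lemma subset_radDiffIdeal (F : Set (DPoly k n)) : F ⊆ radDiffIdeal F := fun x hx => by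
  rw [SetLike.mem_coe, radDiffIdeal, Ideal.mem_sInf]
  exact fun _ hI => hI.1 hx

lemma isDiffIdeal_radDiffIdeal (F : Set (DPoly k n)) : IsDiffIdeal (radDiffIdeal F) := by
  intro x hx
  rw [radDiffIdeal, Ideal.mem_sInf] at hx ⊢
  exact fun _ hI => hI.2.1 _ (hx hI)

lemma isRadical_radDiffIdeal (F : Set (DPoly k n)) : (radDiffIdeal F).IsRadical := by
  rw [isRadical_iff_sq]
  intro x hx
  rw [radDiffIdeal, Ideal.mem_sInf] at hx ⊢
  exact fun _ hI => isRadical_iff_sq.mp hI.2.2 _ (hx hI)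

lemma radDiffIdeal_le {F : Set (DPoly k n)} {I : Ideal (DPoly k n)} (h : F ⊆ I)
    (hI : IsDiffIdeal I) (hr : I.IsRadical) : radDiffIdeal F ≤ I := sInf_le ⟨h, hI, hr⟩

lemma radDiffIdeal_mono {F G : Set (DPoly k n)} (h : F ⊆ G) : radDiffIdeal F ≤ radDiffIdeal G :=
  radDiffIdeal_le (h.trans (subset_radDiffIdeal G)) (isDiffIdeal_radDiffIdeal G)
    (isRadical_radDiffIdeal G)

lemma diffIdeal_le_radDiffIdeal (F : Set (DPoly k n)) : diffIdeal F ≤ radDiffIdeal F :=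
  diffIdeal_le (subset_radDiffIdeal F) (isDiffIdeal_radDiffIdeal F)

/-- This inclusion makes a membership in `[A]` a matter of finitely many derivatives of elements of
`A`. -/
lemma diffIdeal_le_span (A : Set (DPoly k n)) :
    diffIdeal A ≤ Ideal.span {g | ∃ a ∈ A, ∃ j : ℕ, g = (delta k n)^[j] a} := by
  apply diffIdeal_le
  · exact fun a ha => Ideal.subset_span ⟨a, ha, 0, rfl⟩
  · intro x hx
    induction hx using Submodule.span_induction with
    | mem x hx =>
      obtain ⟨a, ha, j, rfl⟩ := hx
      rw [← Function.iterate_succ_apply' (delta k n)]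
      exact Ideal.subset_span ⟨a, ha, j + 1, rfl⟩
    | zero => rw [map_zero]; exact zero_mem _
    | add x y _ _ hx hy => rw [map_add]; exact add_mem hx hy
    | smul c x hx' hx =>
      rw [smul_eq_mul, Derivation.leibniz]
      exact add_mem (Ideal.mul_mem_left _ _ hx) (Ideal.mul_mem_right _ _ hx')

lemma iterate_delta_mem {I : Ideal (DPoly k n)} (hI : IsDiffIdeal I) {a : DPoly k n}
    (ha : a ∈ I) (j : ℕ) : (delta k n)^[j] a ∈ I := by
  induction j with
  | zero => exact ha
  | succ j ih => rw [Function.iterate_succ_apply']; exact hI _ ih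

/-- `{F} : H^∞`, the radical differential ideal of the system `F = 0, H ≠ 0`. -/
def sysIdeal (F H : Set (DPoly k n)) : Ideal (DPoly k n) := saturation (radDiffIdeal F) H

lemma subset_sysIdeal (F H : Set (DPoly k n)) : F ⊆ sysIdeal F H :=
  (subset_radDiffIdeal F).trans (le_saturation _ _)

lemma isDiffIdeal_sysIdeal (F H : Set (DPoly k n)) : IsDiffIdeal (sysIdeal F H) :=
  isDiffIdeal_saturation (isDiffIdeal_radDiffIdeal F) H

lemma isRadical_sysIdeal (F H : Set (DPoly k n)) : (sysIdeal F H).IsRadical :=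
  isRadical_saturation (isRadical_radDiffIdeal F) H

lemma cancels_sysIdeal (F : Set (DPoly k n)) {H : Set (DPoly k n)} {h : DPoly k n} (hh : h ∈ H) :
    Cancels (sysIdeal F H) h := cancels_saturation _ hh

/-- The universal property by which all inclusions between ideals of systems are shown. -/
lemma sysIdeal_le {F H : Set (DPoly k n)} {J : Ideal (DPoly k n)} (hF : F ⊆ J)
    (hd : IsDiffIdeal J) (hr : J.IsRadical) (hH : ∀ h ∈ H, Cancels J h) : sysIdeal F H ≤ J :=
  saturation_le (radDiffIdeal_le hF hd hr) hH

lemma sysIdeal_mono {F F' H H' : Set (DPoly k n)} (hF : F ⊆ F') (hH : H ⊆ H') :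
    sysIdeal F H ≤ sysIdeal F' H' := saturation_mono (radDiffIdeal_mono hF) hH

/-- Let `x` lie in both ideals on the right and let `J` be the one on the left. Saturating by `s`
costs a power of `s`, so radicality gives `x s` in `J`. Then `J : x` is a radical differential ideal
that contains `F` and `s` and modulo which `H` cancels; it therefore contains `x`, so `x^2` lies in
`J`. -/
lemma sysIdeal_eq_inf_insert (F H : Set (DPoly k n)) (s : DPoly k n) :
    sysIdeal F H = sysIdeal F (insert s H) ⊓ sysIdeal (insert s F) H := by
  apply le_antisymm
  · exact le_inf (sysIdeal_mono subset_rfl (Set.subset_insert _ _))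
      (sysIdeal_mono (Set.subset_insert _ _) subset_rfl)
  rintro x ⟨hx1, hx2⟩
  set J := sysIdeal F H with hJ
  have hrad : J.IsRadical := isRadical_sysIdeal F H
  have hsx : x * s ∈ J := by
    have hle : sysIdeal F (insert s H) ≤ saturation J {s} := by
      refine sysIdeal_le ((subset_sysIdeal F H).trans (le_saturation _ _))
        (isDiffIdeal_saturation (isDiffIdeal_sysIdeal F H) _) (isRadical_saturation hrad _) ?_
      rintro h (rfl | hh)
      · exact cancels_saturation _ rfl
      · rintro y ⟨t, ht, hty⟩
        exact ⟨t, ht, cancels_sysIdeal F hh _ (by rwa [mul_left_comm])⟩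
    obtain ⟨t, ht, htx⟩ := hle hx1
    obtain ⟨j, rfl⟩ := Submonoid.mem_closure_singleton.mp ht
    apply hrad
    refine ⟨j + 1, ?_⟩
    have : (x * s) ^ (j + 1) = x ^ j * s * (s ^ j * x) := by ring
    rw [this]
    exact J.mul_mem_left _ htx
  have hle : sysIdeal (insert s F) H ≤ quotientBy J x := by
    refine sysIdeal_le ?_ (isDiffIdeal_quotientBy (isDiffIdeal_sysIdeal F H) hrad x)
      (isRadical_quotientBy hrad x) ?_
    · rintro y (rfl | hy)
      · exact hsx
      · exact J.mul_mem_left _ (subset_sysIdeal F H hy)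
    · intro h hh y hy
      rw [mem_quotientBy] at hy ⊢
      exact cancels_sysIdeal F hh _ (by rwa [mul_left_comm])
  apply isRadical_iff_sq.mp hrad
  rw [pow_two]
  exact hle hx2

/-- The branch with `i` added to `F` is not saturated by `s`, in accordance with `splits`. This only
makes its ideal smaller, while it still contains the ideal on the left. -/
lemma sysIdeal_eq_inf_insert_insert (F H : Set (DPoly k n)) (s i : DPoly k n) :
    sysIdeal F H = sysIdeal F (insert i (insert s H)) ⊓
      (sysIdeal (insert s F) H ⊓ sysIdeal (insert i F) H) := by
  apply le_antisymm
  · refine le_inf (sysIdeal_mono subset_rfl ?_) (le_inf (sysIdeal_mono (Set.subset_insert _ _)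
      subset_rfl) (sysIdeal_mono (Set.subset_insert _ _) subset_rfl))
    exact (Set.subset_insert _ _).trans (Set.subset_insert _ _)
  · rintro x ⟨h1, h2, h3⟩
    rw [sysIdeal_eq_inf_insert F H s]
    refine ⟨?_, h2⟩
    rw [sysIdeal_eq_inf_insert F (insert s H) i]
    exact ⟨h1, sysIdeal_mono subset_rfl (Set.subset_insert _ _) h3⟩

end Ideals

/-! ## Regular systems -/

section Regular

variable {k : Type*} [Field k] {n : ℕ} [LinearOrder (DVar n)]

lemma mem_inisep {F : Finset (DPoly k n)} {h : DPoly k n} :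
    h ∈ inisep F ↔ ∃ f ∈ F, h = initial f ∨ h = separant f := by
  rw [inisep, Finset.mem_union, Finset.mem_image, Finset.mem_image]
  constructor
  · rintro (⟨f, hf, rfl⟩ | ⟨f, hf, rfl⟩)
    · exact ⟨f, hf, Or.inl rfl⟩
    · exact ⟨f, hf, Or.inr rfl⟩
  · rintro ⟨f, hf, rfl | rfl⟩
    · exact Or.inl ⟨f, hf, rfl⟩
    · exact Or.inr ⟨f, hf, rfl⟩

lemma inisep_mono {F G : Finset (DPoly k n)} (h : F ⊆ G) : inisep F ⊆ inisep G := by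
  intro x hx
  obtain ⟨f, hf, hx⟩ := mem_inisep.mp hx
  exact mem_inisep.mpr ⟨f, h hf, hx⟩

lemma initial_mem_inisep {F : Finset (DPoly k n)} {f : DPoly k n} (h : f ∈ F) :
    initial f ∈ inisep F := mem_inisep.mpr ⟨f, h, Or.inl rfl⟩

lemma separant_mem_inisep {F : Finset (DPoly k n)} {f : DPoly k n} (h : f ∈ F) :
    separant f ∈ inisep F := mem_inisep.mpr ⟨f, h, Or.inr rfl⟩

lemma coe_inisep_insert (a : DPoly k n) (T : Finset (DPoly k n)) :
    (inisep (insert a T) : Set (DPoly k n)) =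
      ({initial a, separant a} : Set (DPoly k n)) ∪ inisep T := by
  ext h
  rw [Set.mem_union, Finset.mem_coe, Finset.mem_coe, mem_inisep, mem_inisep,
    Finset.exists_mem_insert, Set.mem_insert_iff, Set.mem_singleton_iff]

/-- The ideal of a triangular set, saturated by the initials and separants, is radical. -/
theorem isRadical_saturation_inisep (T : Finset (DPoly k n)) (hT : ∀ f ∈ T, f ∉ constants k n)
    (hinj : Set.InjOn (leader : DPoly k n → _) T) :
    (saturation (Ideal.span (T : Set (DPoly k n))) (inisep T : Set (DPoly k n))).IsRadical := by
  induction T using Finset.induction_on_max_value (leader : DPoly k n → _) with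
  | empty =>
    apply isRadical_saturation
    rw [Finset.coe_empty, Ideal.span_empty, isRadical_iff_sq]
    intro x hx
    exact pow_eq_zero_iff two_ne_zero |>.mp hx
  | insert a T haT hmax ih =>
    obtain ⟨u, hu⟩ := exists_leader (hT a (Finset.mem_insert_self a T))
    -- The element with the highest leader is adjoined last, so `u` occurs only in `a`, and `T` acts
    -- on coefficients of polynomials in `u`.
    have huT : ∀ g ∈ T, u ∉ g.vars := by
      intro g hg hug
      apply haT
      have h1 : leader g = u := by
        rw [← hu]
        apply le_antisymm (hmax g hg)
        rw [hu]
        exact Finset.le_max hug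
      have : g = a := hinj (Finset.mem_coe.mpr (Finset.mem_insert_of_mem hg))
        (Finset.mem_coe.mpr (Finset.mem_insert_self a T)) (h1.trans hu.symm)
      exact this ▸ hg
    specialize ih (fun f hf => hT f (Finset.mem_insert_of_mem hf))
      (hinj.mono (by simp))
    set I := saturation (Ideal.span (T : Set (DPoly k n))) (inisep T : Set (DPoly k n)) with hI
    have hcl : ∀ h ∈ Submonoid.closure (inisep T : Set (DPoly k n)),
        toUni u h = Polynomial.C h := by
      intro h hh
      induction hh using Submonoid.closure_induction with
      | mem x hx =>
        apply toUni_of_notMem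
        obtain ⟨g, hg, rfl | rfl⟩ := mem_inisep.mp hx
        · exact fun h' => huT g hg (vars_initial_subset g h')
        · exact fun h' => huT g hg (vars_separant_subset g h')
      | one => simp
      | mul x y _ _ hx hy => rw [map_mul, hx, hy, map_mul]
    have hspan : ∀ x ∈ Ideal.span (T : Set (DPoly k n)),
        toUni u x ∈ (Ideal.span (T : Set (DPoly k n))).map Polynomial.C := by
      have : Ideal.span (T : Set (DPoly k n)) ≤
          ((Ideal.span (T : Set (DPoly k n))).map Polynomial.C).comap (toUni u) := by
        rw [Ideal.span_le]
        intro g hg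
        rw [SetLike.mem_coe, Ideal.mem_comap, toUni_of_notMem (huT g hg)]
        exact Ideal.mem_map_of_mem _ (Ideal.subset_span hg)
      exact this
    have hIu : ∀ x ∈ I, toUni u x ∈ I.map Polynomial.C := by
      rintro x ⟨h, hh, hx⟩
      have h1 := hspan _ hx
      rw [map_mul, hcl h hh, Ideal.mem_map_C_iff] at h1
      rw [Ideal.mem_map_C_iff]
      intro m
      have := h1 m
      rw [Polynomial.coeff_C_mul] at this
      exact ⟨h, hh, this⟩
    have hmono : Submonoid.closure (inisep T : Set (DPoly k n)) ≤
        Submonoid.closure (inisep (insert a T) : Set (DPoly k n)) :=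
      Submonoid.closure_mono (Finset.coe_subset.mpr (inisep_mono (Finset.subset_insert a T)))
    have hini : initial a ∈ Submonoid.closure (inisep (insert a T) : Set (DPoly k n)) :=
      Submonoid.subset_closure (initial_mem_inisep (Finset.mem_insert_self a T))
    have hsep : separant a ∈ Submonoid.closure (inisep (insert a T) : Set (DPoly k n)) :=
      Submonoid.subset_closure (separant_mem_inisep (Finset.mem_insert_self a T))
    have hTa : Ideal.span (T : Set (DPoly k n)) ≤
        Ideal.span ((insert a T : Finset (DPoly k n)) : Set (DPoly k n)) :=
      Ideal.span_mono (by simp)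
    have haa : a ∈ Ideal.span ((insert a T : Finset (DPoly k n)) : Set (DPoly k n)) :=
      Ideal.subset_span (by simp)
    rw [isRadical_iff_sq]
    rintro x ⟨h, hh, hx⟩
    -- The multiplier is split into powers of the initial and the separant of `a` and a factor `h2`
    -- that is free of `u`.
    obtain ⟨h1, hh1, h2, hh2, rfl⟩ : ∃ h1 ∈ Submonoid.closure {initial a, separant a},
        ∃ h2 ∈ Submonoid.closure (inisep T : Set (DPoly k n)), h1 * h2 = h := by
      rw [← Submonoid.mem_sup, ← Submonoid.closure_union, ← coe_inisep_insert]
      exact hh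
    obtain ⟨N, M, rfl⟩ := (Submonoid.mem_closure_pair _ _ _).mp hh1
    have hmem : ∀ y ∈ Ideal.span ((insert a T : Finset (DPoly k n)) : Set (DPoly k n)),
        toUni u y ∈ I.map Polynomial.C ⊔ Ideal.span {toUni u a} := by
      intro y hy
      rw [Finset.coe_insert, Ideal.span_insert] at hy
      obtain ⟨y1, hy1, y2, hy2, rfl⟩ := Submodule.mem_sup.mp hy
      obtain ⟨c, rfl⟩ := Ideal.mem_span_singleton'.mp hy1
      rw [map_add, map_mul, add_comm]
      exact Submodule.add_mem_sup (hIu _ (le_saturation _ _ hy2))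
        (Ideal.mul_mem_left _ _ (Ideal.mem_span_singleton_self _))
    -- Squaring `h2` together with `x` leaves exactly the form to which `derivative_sq_mul_mem`
    -- applies.
    have hx' : initial a ^ N * separant a ^ M * (h2 * x) ^ 2 ∈
        Ideal.span ((insert a T : Finset (DPoly k n)) : Set (DPoly k n)) := by
      have : initial a ^ N * separant a ^ M * (h2 * x) ^ 2 =
        h2 * (initial a ^ N * separant a ^ M * h2 * x ^ 2) := by ring
      rw [this]
      exact Ideal.mul_mem_left _ _ hx
    have h3 := hmem _ hx'
    have hlc : toUni u (initial a) = Polynomial.C (toUni u a).leadingCoeff := by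
      rw [leadingCoeff_toUni hu, toUni_of_notMem (notMem_vars_initial hu)]
    rw [map_mul, map_mul, map_pow, map_pow, map_pow, hlc, separant_of_leader hu,
      ← derivative_toUni] at h3
    obtain ⟨e, he⟩ := derivative_sq_mul_mem ih
      (by rw [natDegree_toUni]; exact degreeOf_leader_pos hu) h3
    rw [← hlc, derivative_toUni, ← separant_of_leader hu, ← map_pow, ← map_pow, ← map_mul,
      ← map_mul] at he
    obtain ⟨y, hy, z, hz, hyz⟩ := Submodule.mem_sup.mp he
    obtain ⟨c, rfl⟩ := Ideal.mem_span_singleton'.mp hz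
    -- Evaluation at `u` undoes `toUni`, and it maps polynomials with coefficients in `I` into `I`.
    have hyI : y.eval (X u) ∈ I := by
      have : I.map Polynomial.C ≤ I.comap (Polynomial.evalRingHom (X u : DPoly k n)) := by
        rw [Ideal.map_le_iff_le_comap]
        intro w hw
        simpa [Ideal.mem_comap] using hw
      exact this hy
    obtain ⟨h4, hh4, hy4⟩ := hyI
    have h5 := congrArg (Polynomial.eval (X u : DPoly k n)) hyz
    rw [Polynomial.eval_add, Polynomial.eval_mul, eval_toUni, eval_toUni] at h5
    refine ⟨h4 * (initial a ^ e * separant a ^ 2 * h2), mul_mem (hmono hh4)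
      (mul_mem (mul_mem (pow_mem hini _) (pow_mem hsep _)) (hmono hh2)), ?_⟩
    have : h4 * (initial a ^ e * separant a ^ 2 * h2) * x =
        h4 * y.eval (X u) + h4 * c.eval (X u) * a := by linear_combination -h4 * h5
    rw [this]
    exact add_mem (hTa hy4) (Ideal.mul_mem_left _ _ haa)

variable [Differential k]

lemma leader_iterate_delta [CharZero k] (hrk : IsRanking n) {a : DPoly k n} {u : DVar n}
    (hu : leader a = u) (j : ℕ) : leader ((delta k n)^[j] a) = (u.shift j : DVar n) ∧
      (initial ((delta k n)^[j] a) = initial a ∨ initial ((delta k n)^[j] a) = separant a) ∧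
      separant ((delta k n)^[j] a) = separant a := by
  induction j with
  | zero => exact ⟨hu, Or.inl rfl, rfl⟩
  | succ j ih =>
    obtain ⟨h1, h2, h3⟩ := ih
    rw [Function.iterate_succ_apply']
    exact ⟨leader_delta hrk h1, Or.inr (by rw [initial_delta hrk h1, h3]),
      by rw [separant_delta hrk h1, h3]⟩

/-- A membership in `[A]` uses finitely many derivatives of elements of `A`. Their leaders are
distinct because the leading variables of `A` are, and their initials and separants are initials and
separants of elements of `A`. Hence `isRadical_saturation_inisep` applies to them. -/
theorem isRadical_saturation_diffIdeal [CharZero k] (hrk : IsRanking n)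
    {A H : Finset (DPoly k n)} (hA : ∀ f ∈ A, f ∉ constants k n)
    (hlv : Set.InjOn (lv : DPoly k n → _) A) (hH : inisep A ⊆ H) :
    (saturation (diffIdeal (A : Set (DPoly k n))) (H : Set (DPoly k n))).IsRadical := by
  rw [isRadical_iff_sq]
  rintro x ⟨s, hs, hx⟩
  obtain ⟨T, hT, hxT⟩ := Submodule.mem_span_finite_of_mem_span (diffIdeal_le_span _ hx)
  have hTl : ∀ g ∈ T, ∃ a ∈ A, ∃ u : DVar n, leader a = u ∧ ∃ j : ℕ, g = (delta k n)^[j] a := by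
    intro g hg
    obtain ⟨a, ha, j, rfl⟩ := hT hg
    obtain ⟨u, hu⟩ := exists_leader (hA a ha)
    exact ⟨a, ha, u, hu, j, rfl⟩
  have hrad := isRadical_saturation_inisep T (by
      intro g hg
      obtain ⟨a, ha, u, hu, j, rfl⟩ := hTl g hg
      exact notMem_constants_of_leader (leader_iterate_delta hrk hu j).1) (by
      intro g hg g' hg' heq
      obtain ⟨a, ha, u, hu, j, rfl⟩ := hTl g hg
      obtain ⟨a', ha', u', hu', j', rfl⟩ := hTl g' hg'
      rw [(leader_iterate_delta hrk hu j).1, (leader_iterate_delta hrk hu' j').1] at heq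
      have heq := WithBot.coe_injective heq
      rw [DVar.shift, DVar.shift, DVar.mk.injEq] at heq
      have haa : a = a' := hlv ha ha' (by rw [lv_of_leader hu, lv_of_leader hu', heq.1])
      subst haa
      rw [hu] at hu'
      have := WithBot.coe_injective hu'
      subst this
      have : j = j' := by omega
      rw [this])
  have hsub : (inisep T : Set (DPoly k n)) ⊆ H := by
    intro h hh
    obtain ⟨g, hg, hh⟩ := mem_inisep.mp hh
    obtain ⟨a, ha, u, hu, j, rfl⟩ := hTl g hg
    apply hH
    rw [mem_inisep]
    obtain ⟨-, h1, h2⟩ := leader_iterate_delta hrk hu j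
    rw [h2] at hh
    refine ⟨a, ha, ?_⟩
    rcases hh with rfl | rfl
    · exact h1
    · exact Or.inr rfl
  have hle : saturation (Ideal.span (T : Set (DPoly k n))) (inisep T : Set (DPoly k n)) ≤
      saturation (diffIdeal (A : Set (DPoly k n))) (H : Set (DPoly k n)) := by
    refine saturation_mono ?_ hsub
    rw [Ideal.span_le]
    intro g hg
    obtain ⟨a, ha, u, hu, j, rfl⟩ := hTl g hg
    exact iterate_delta_mem (isDiffIdeal_diffIdeal _) (subset_diffIdeal _ ha) j
  have h1 : s * x ∈ saturation (Ideal.span (T : Set (DPoly k n)))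
      (inisep T : Set (DPoly k n)) := by
    apply isRadical_iff_sq.mp hrad
    apply le_saturation
    have : (s * x) ^ 2 = s * (s * x ^ 2) := by ring
    rw [this]
    exact Ideal.mul_mem_left _ _ hxT
  obtain ⟨t, ht, htx⟩ := hle h1
  exact ⟨t * s, mul_mem ht hs, by rwa [mul_assoc]⟩

/-- For a regular system `(A, H)`, the ideal `[A] : H^∞` is radical. -/
theorem sysIdeal_eq_of_inisep_subset [CharZero k] (hrk : IsRanking n)
    {A H : Finset (DPoly k n)} (hA : ∀ f ∈ A, f ∉ constants k n)
    (hlv : Set.InjOn (lv : DPoly k n → _) A) (hH : inisep A ⊆ H) :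
    sysIdeal (A : Set (DPoly k n)) (H : Set (DPoly k n)) =
      saturation (diffIdeal (A : Set (DPoly k n))) (H : Set (DPoly k n)) := by
  apply le_antisymm
  · exact sysIdeal_le ((subset_diffIdeal _).trans (le_saturation _ _))
      (isDiffIdeal_saturation (isDiffIdeal_diffIdeal _) _)
      (isRadical_saturation_diffIdeal hrk hA hlv hH) fun h hh => cancels_saturation _ hh
  · exact saturation_mono (diffIdeal_le_radDiffIdeal _) subset_rfl

end Regular

/-! ## The ordering of triples -/

section Termination

/-- On the derivatives of one indeterminate a ranking is the ordering by order. The elements of a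
set of derivatives that have least order for their indeterminate are finitely many, and a minimal
one among them is minimal in the set. -/
lemma _root_.IsRanking.wellFoundedLT {n : ℕ} [LinearOrder (DVar n)] (hrk : IsRanking n) :
    WellFoundedLT (DVar n) := by
  refine ⟨WellFounded.wellFounded_iff_has_min.mpr fun S hS => ?_⟩
  have hmin : ∀ v ∈ S, ∃ w ∈ S, w ≤ v ∧ ∀ x ∈ S, x.var = w.var → w.ord ≤ x.ord := by
    intro v hv
    have hne : ∃ j, (⟨v.var, j⟩ : DVar n) ∈ S := ⟨v.ord, hv⟩
    have hle := Nat.find_min' hne hv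
    refine ⟨⟨v.var, Nat.find hne⟩, Nat.find_spec hne,
      (hrk.le_iff_ord_le (u := ⟨v.var, Nat.find hne⟩) (v := v) rfl).mpr hle,
      fun x hx hxv => Nat.find_min' hne ?_⟩
    rw [← show x.var = v.var from hxv]
    exact hx
  let T : Set (DVar n) := {w | w ∈ S ∧ ∀ x ∈ S, x.var = w.var → w.ord ≤ x.ord}
  have hT : T.Finite := by
    refine Set.Finite.of_finite_image (f := DVar.var) (Set.toFinite _) ?_
    intro x hx y hy hxy
    exact DVar.ext hxy (le_antisymm (hx.2 y hy.1 hxy.symm) (hy.2 x hx.1 hxy))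
  obtain ⟨v, hv⟩ := hS
  obtain ⟨w, hw, -, hw'⟩ := hmin v hv
  obtain ⟨x, hx⟩ := hT.exists_minimal ⟨w, hw, hw'⟩
  refine ⟨x, hx.prop.1, fun y hy hyx => ?_⟩
  obtain ⟨z, hz, hzy, hz'⟩ := hmin y hy
  exact absurd (hx.le_of_le ⟨hz, hz'⟩ (hzy.trans hyx.le)) (not_le.mpr (hzy.trans_lt hyx))

variable {k : Type*} [Field k] {n : ℕ} [LinearOrder (DVar n)]

/-- The least rank of the elements of `F`. -/
def minRank (F : Finset (DPoly k n)) : WithTop (WithBot (DVar n ×ₗ ℕ)) :=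
  F.inf fun f => (rank f : WithTop (WithBot (DVar n ×ₗ ℕ)))

/-- The family of the least ranks of the elements of `A` with a given leading variable. -/
def rankFamily (A : Finset (DPoly k n)) (y : Fin n) : WithTop (WithBot (DVar n ×ₗ ℕ)) :=
  minRank (A.filter fun a => lv a = y)

/-- The ordering of triples that decreases along the algorithm. -/
def TripleLT (t' t : Triple k n) : Prop :=
  Prod.Lex (· < ·) (· < ·) (rankFamily t'.C, minRank t'.F) (rankFamily t.C, minRank t.F)

/-- The families of ranks are compared pointwise over finitely many indeterminates; an indeterminate
that is not leading has the value `⊤`. -/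
lemma wellFounded_tripleLT (hrk : IsRanking n) :
    WellFounded (TripleLT : Triple k n → Triple k n → Prop) := by
  have := hrk.wellFoundedLT
  exact InvImage.wf (fun t : Triple k n => (rankFamily t.C, minRank t.F))
    (WellFounded.prod_lex wellFounded_lt wellFounded_lt)

lemma minRank_le {F : Finset (DPoly k n)} {f : DPoly k n} (h : f ∈ F) :
    minRank F ≤ (rank f : WithTop (WithBot (DVar n ×ₗ ℕ))) :=
  Finset.inf_le h

lemma IsLeastRank.minRank_eq {F : Finset (DPoly k n)} {f : DPoly k n} (h : IsLeastRank F f) :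
    minRank F = (rank f : WithTop (WithBot (DVar n ×ₗ ℕ))) :=
  le_antisymm (minRank_le h.1) (Finset.le_inf fun g hg => WithTop.coe_le_coe.mpr (h.2 g hg))

lemma exists_isLeastRank {F : Finset (DPoly k n)} (h : F.Nonempty) : ∃ f, IsLeastRank F f :=
  Finset.exists_min_image F rank h

lemma mem_splits {t t' : Triple k n} {f : DPoly k n} (h : t' ∈ splits t f) :
    ∃ s, (s = separant f ∨ s = initial f) ∧ s ∉ constants k n ∧
      t' = ⟨insert s t.F, t.C, t.H⟩ := by
  rw [splits] at h
  split_ifs at h with h1 h2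
  · simp at h
  · rw [Finset.mem_insert] at h
    rcases h with rfl | h
    · exact ⟨_, Or.inl rfl, h1, rfl⟩
    · simp at h
  · rw [Finset.mem_insert, Finset.mem_singleton] at h
    rcases h with rfl | rfl
    · exact ⟨_, Or.inl rfl, h1, rfl⟩
    · exact ⟨_, Or.inr rfl, h2, rfl⟩

/-- The set `C` is kept, and the adjoined initial or separant has lower rank than `f`, whose rank
was the least one in `F`. -/
lemma tripleLT_of_mem_splits {t t' : Triple k n} {f : DPoly k n} (hf : IsLeastRank t.F f)
    (hc : f ∉ constants k n) (h : t' ∈ splits t f) : TripleLT t' t := by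
  obtain ⟨s, hs, -, rfl⟩ := mem_splits h
  refine Prod.Lex.right _ ?_
  rw [hf.minRank_eq]
  refine (minRank_le (Finset.mem_insert_self s t.F)).trans_lt (WithTop.coe_lt_coe.mpr ?_)
  rcases hs with rfl | rfl
  · exact rank_separant_lt hc
  · exact rank_initial_lt hc

/-- Replacing an element of a finite set by smaller ones. -/
lemma cutExpand_union {α : Type*} [DecidableEq α] {r : α → α → Prop} {U S : Finset α}
    {a : α} (h : ∀ b ∈ S, r b a) :
    Relation.CutExpand r (U ∪ S).val (a ::ₘ U.val) := by
  refine ⟨(S \ U).val, a, fun b hb => h b (Finset.mem_sdiff.mp hb).1, ?_⟩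
  have h1 : U ∪ S = U.disjUnion (S \ U) Finset.disjoint_sdiff := by
    rw [Finset.disjUnion_eq_union, Finset.union_sdiff_self_eq_union]
  rw [h1, Finset.disjUnion_val, ← Multiset.singleton_add]
  abel

end Termination

/-! ## The loop of Differentiate&Autoreduce -/

section Loop

variable {k : Type*} [Field k] {n : ℕ} [LinearOrder (DVar n)]

lemma mem_lvSet {F : Finset (DPoly k n)} {y : Fin n} :
    y ∈ lvSet F ↔ ∃ f ∈ F, ∃ u : DVar n, leader f = u ∧ u.var = y := by
  simp only [lvSet, Finset.mem_filter, Finset.mem_univ, true_and, lv_eq_iff]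

lemma mem_lowest {B : Finset (DPoly k n)} {b : DPoly k n} :
    b ∈ lowest B ↔ b ∈ B ∧ ∀ g ∈ B, lv g = lv b → rank b ≤ rank g := by
  simp only [lowest, Finset.mem_filter]

lemma mem_highest {B : Finset (DPoly k n)} {b : DPoly k n} :
    b ∈ highest B ↔ b ∈ B ∧ ∀ g ∈ B, lv g = lv b → rank g ≤ rank b := by
  simp only [highest, Finset.mem_filter]

lemma lowest_subset (B : Finset (DPoly k n)) : lowest B ⊆ B := Finset.filter_subset _ _

lemma exists_highest {B : Finset (DPoly k n)} {b : DPoly k n} (hb : b ∈ B) :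
    ∃ b' ∈ highest B, lv b' = lv b := by
  obtain ⟨b', hb', hmax⟩ := Finset.exists_max_image (B.filter fun g => lv g = lv b) rank
    ⟨b, Finset.mem_filter.mpr ⟨hb, rfl⟩⟩
  obtain ⟨h1, h2⟩ := Finset.mem_filter.mp hb'
  exact ⟨b', mem_highest.mpr ⟨h1, fun g hg hlv =>
    hmax g (Finset.mem_filter.mpr ⟨hg, hlv.trans h2⟩)⟩, h2⟩

/-- The conditions on the arguments of a call of Differentiate&Autoreduce. -/
structure CallSpec (A : Finset (DPoly k n)) (m : Fin n → ℕ) : Prop where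
  nonconst : ∀ c ∈ A, c ∉ constants k n
  lvInj : Set.InjOn (lv : DPoly k n → _) A
  ord_le : ∀ c ∈ A, ∀ v ∈ c.vars, v.ord ≤ m v.var

variable [Differential k]

lemma mem_candidates {m : Fin n → ℕ} {D B : Finset (DPoly k n)} {g : DPoly k n} :
    g ∈ candidates m D B ↔ g ∈ D ∨ ((∃ b ∈ highest B, delta k n b = g) ∧
      ∀ u : DVar n, leader g = u → u.ord ≤ m u.var) := by
  simp only [candidates, bounded, Finset.mem_union, Finset.mem_filter, Finset.mem_image]

lemma mem_divisors {D B : Finset (DPoly k n)} {g d : DPoly k n} :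
    d ∈ divisors D B g ↔ d ∈ B ∨ (g ∉ D ∧ d ≠ g ∧ ∃ c ∈ lowest B, delta k n c = d) := by
  rw [divisors]
  split_ifs with h
  · simp [h]
  · simp [h, Finset.mem_union, Finset.mem_erase, Finset.mem_image]

/-- The invariant of the loop of Differentiate&Autoreduce, called with `A` and `m`. -/
structure LoopInv (A : Finset (DPoly k n)) (m : Fin n → ℕ) (D B : Finset (DPoly k n)) :
    Prop where
  subset : D ⊆ A
  inj : Set.InjOn (leader : DPoly k n → _) B
  -- Leaders are treated in increasing order, so a new element of `B` never occurs through its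
  -- leader in the older ones.
  lt_cand : ∀ b ∈ B, ∀ g ∈ candidates m D B, leader b < leader g
  algRed : ∀ b ∈ B, ∀ b' ∈ B, b ≠ b' → AlgReduced b b'
  -- Above each treated element of `A` there is a gapless chain of derivatives, linear in their
  -- leaders except for the bottom one.
  origin : ∀ b ∈ B, ∃ c ∈ A, c ∉ D ∧ ∃ w u : DVar n, leader c = w ∧ leader b = u ∧
    w.var = u.var ∧ w.ord ≤ u.ord ∧ (w = u → degreeOf u b = degreeOf u c) ∧
    (w.ord < u.ord → degreeOf u b = 1) ∧
    ∀ j, w.ord ≤ j → j ≤ u.ord → ∃ e ∈ B, leader e = (⟨u.var, j⟩ : DVar n)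
  done : ∀ c ∈ A, c ∉ D → ∃ b ∈ B, leader b = leader c
  ord_le : ∀ b ∈ B, ∀ v ∈ b.vars, v.var ∈ lvSet A → v.ord ≤ m v.var
  card_le : A.card ≤ B.card + D.card
  -- The excess of `B.card + D.card` over `A.card` counts the differentiations made so far: moving
  -- an element from `D` to `B` does not change the sum.
  ord_add_le : ∀ b ∈ B, ∀ v ∈ b.vars, v.var ∉ lvSet A →
    v.ord + A.card ≤ m v.var + (B.card + D.card)
  forward : ∀ Q : Ideal (DPoly k n), IsDiffIdeal Q → (∀ c ∈ A, c ∈ Q) →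
    (∀ h ∈ inisep A, Cancels Q h) → (∀ b ∈ B, b ∈ Q) ∧ ∀ h ∈ inisep B, Cancels Q h
  -- Only the lowest elements are assumed to lie in `Q`, since only they are kept; the others are
  -- recovered as remainders of derivatives.
  backward : ∀ Q : Ideal (DPoly k n), IsDiffIdeal Q → (∀ b ∈ lowest B, b ∈ Q) →
    (∀ h ∈ inisep B, Cancels Q h) → (∀ b ∈ B, b ∈ Q) ∧ ∀ c ∈ A, c ∉ D →
      c ∈ Q ∧ Cancels Q (initial c) ∧ Cancels Q (separant c)

lemma loopInv_start (A : Finset (DPoly k n)) (m : Fin n → ℕ) : LoopInv A m A ∅ where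
  subset := subset_rfl
  inj := by simp
  lt_cand := by simp
  algRed := by simp
  origin := by simp
  done := fun c h h' => absurd h h'
  ord_le := by simp
  card_le := by simp
  ord_add_le := by simp
  forward := by simp [inisep]
  backward := fun _ _ _ _ => ⟨by simp, fun c h h' => absurd h h'⟩

namespace LoopInv

variable {A : Finset (DPoly k n)} {m : Fin n → ℕ} {D B : Finset (DPoly k n)}

lemma exists_leader (hI : LoopInv A m D B) {b : DPoly k n} (hb : b ∈ B) :
    ∃ u : DVar n, leader b = u := by
  obtain ⟨c, _, _, w, u, _, hu, _⟩ := hI.origin b hb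
  exact ⟨u, hu⟩

/-- The elements of `B` with the leading variable of an element of `A`. -/
lemma origin_of_lv (hI : LoopInv A m D B) (hA : CallSpec A m) {b c : DPoly k n} {u w : DVar n}
    (hb : b ∈ B) (hc : c ∈ A) (hu : leader b = u) (hw : leader c = w) (hvar : w.var = u.var) :
    c ∉ D ∧ w.ord ≤ u.ord ∧ (w = u → degreeOf u b = degreeOf u c) ∧
      (w.ord < u.ord → degreeOf u b = 1) ∧
      ∀ j, w.ord ≤ j → j ≤ u.ord → ∃ e ∈ B, leader e = (⟨u.var, j⟩ : DVar n) := by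
  obtain ⟨c', hc', hcD, w', u', hw', hu', hvar', hrest⟩ := hI.origin b hb
  have huu : u' = u := WithBot.coe_injective (hu'.symm.trans hu)
  subst huu
  have hcc : c' = c := hA.lvInj hc' hc (by rw [lv_of_leader hw', lv_of_leader hw, hvar', hvar])
  subst hcc
  have hww : w' = w := WithBot.coe_injective (hw'.symm.trans hw)
  subst hww
  exact ⟨hcD, hrest⟩

lemma var_mem_lvSet (hI : LoopInv A m D B) {b : DPoly k n} {u : DVar n} (hb : b ∈ B)
    (hu : leader b = u) : u.var ∈ lvSet A := by
  obtain ⟨c, hc, _, w, u', hw, hu', hvar, _⟩ := hI.origin b hb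
  have huu : u' = u := WithBot.coe_injective (hu'.symm.trans hu)
  subst huu
  exact mem_lvSet.mpr ⟨c, hc, w, hw, hvar⟩

lemma mem_lowest_of_leader (hrk : IsRanking n) (hI : LoopInv A m D B) (hA : CallSpec A m)
    {e c : DPoly k n} (he : e ∈ B) (hc : c ∈ A) (hec : leader e = leader c) : e ∈ lowest B := by
  refine mem_lowest.mpr ⟨he, fun b hb hlv => ?_⟩
  obtain ⟨w, hw⟩ := RG.exists_leader (hA.nonconst c hc)
  obtain ⟨u, hu⟩ := hI.exists_leader hb
  have hew := hec.trans hw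
  have hvar : w.var = u.var := by
    rw [lv_of_leader hu, lv_of_leader hew] at hlv
    exact (WithBot.coe_injective hlv).symm
  have hle := (hI.origin_of_lv hA hb hc hu hw hvar).2.1
  rcases ((hrk.le_iff_ord_le hvar).mpr hle).eq_or_lt with h | h
  · have : e = b := hI.inj he hb (by rw [hew, hu, h])
    rw [this]
  · refine (rank_lt_of_leader_lt ?_).le
    rw [hew, hu]
    exact WithBot.coe_lt_coe.mpr h

/-- The chain above an element of `A` begins at the leader of that element, and there the degree was
preserved. So the lowest elements have exactly the ranks of treated elements of `A`. -/
lemma exists_of_mem_lowest (hrk : IsRanking n) (hI : LoopInv A m D B)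
    {e : DPoly k n} (he : e ∈ lowest B) :
    ∃ c ∈ A, c ∉ D ∧ ∃ w : DVar n, leader c = w ∧ leader e = w ∧ rank e = rank c := by
  obtain ⟨c, hc, hcD, w, u, hw, hu, hvar, hle, hdeg, -, -⟩ := hI.origin e (lowest_subset B he)
  obtain ⟨b, hb, hbc⟩ := hI.done c hc hcD
  have h1 := leader_le_of_rank_le ((mem_lowest.mp he).2 b hb (by
    rw [lv_of_leader (hbc.trans hw), lv_of_leader hu, hvar]))
  rw [hbc, hw, hu, WithBot.coe_le_coe, hrk.le_iff_ord_le hvar.symm] at h1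
  have hwu : w = u := DVar.ext hvar (le_antisymm hle h1)
  subst hwu
  refine ⟨c, hc, hcD, w, hw, hu, ?_⟩
  rw [rank_eq_iff hw]
  exact ⟨hu, hdeg rfl⟩

lemma lowest_subset_insert (hI : LoopInv A m D B) {g r : DPoly k n} {u : DVar n}
    (hg : IsLeastRank (candidates m D B) g) (hu : leader g = u) (hr : leader r = u) :
    lowest B ⊆ lowest (insert r B) := by
  intro b hb
  obtain ⟨hbB, hmin⟩ := mem_lowest.mp hb
  refine mem_lowest.mpr ⟨Finset.mem_insert_of_mem hbB, fun x hx hlv => ?_⟩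
  rw [Finset.mem_insert] at hx
  rcases hx with rfl | hx
  · refine (rank_lt_of_leader_lt ?_).le
    rw [hr, ← hu]
    exact hI.lt_cand b hbB g hg.1
  · exact hmin x hx hlv

variable [CharZero k]

lemma leader_candidate (hrk : IsRanking n) (hI : LoopInv A m D B) (hA : CallSpec A m)
    {g : DPoly k n} (hg : g ∈ candidates m D B) : ∃ u : DVar n, leader g = u ∧
      (g ∈ D ∨ ∃ b ∈ highest B, ∃ w : DVar n, leader b = w ∧ g = delta k n b ∧
        u = w.shift 1 ∧ u.ord ≤ m u.var) := by
  rcases mem_candidates.mp hg with h | ⟨⟨b, hb, rfl⟩, h⟩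
  · obtain ⟨u, hu⟩ := RG.exists_leader (hA.nonconst g (hI.subset h))
    exact ⟨u, hu, Or.inl h⟩
  · obtain ⟨w, hw⟩ := hI.exists_leader (mem_highest.mp hb).1
    have hu := leader_delta hrk hw
    exact ⟨_, hu, Or.inr ⟨b, hb, w, hw, rfl, rfl, h _ hu⟩⟩

/-- Elements of `A` have distinct leading variables, and `B` has no element with the leading
variable of an untreated one. Two derivatives with the same leader come from elements of `B` with
the same leader. -/
lemma candidate_inj (hrk : IsRanking n) (hI : LoopInv A m D B) (hA : CallSpec A m)
    {g g' : DPoly k n} (hg : g ∈ candidates m D B) (hg' : g' ∈ candidates m D B)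
    (hlv : leader g = leader g') : g = g' := by
  have aux : ∀ {c b : DPoly k n} {u w : DVar n}, c ∈ D → b ∈ highest B → leader c = u →
      leader b = w → u ≠ w.shift 1 := by
    intro c b u w hc hb hu hw huw
    exact (hI.origin_of_lv hA (mem_highest.mp hb).1 (hI.subset hc) hw hu
      (by rw [huw, DVar.shift])).1 hc
  obtain ⟨u, hu, h⟩ := hI.leader_candidate hrk hA hg
  obtain ⟨u', hu', h'⟩ := hI.leader_candidate hrk hA hg'
  have huu : u = u' := WithBot.coe_injective (hu.symm.trans (hlv.trans hu'))
  subst huu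
  rcases h with h | ⟨b, hb, w, hw, rfl, huw, -⟩
  · rcases h' with h' | ⟨b', hb', w', hw', rfl, huw', -⟩
    · exact hA.lvInj (hI.subset h) (hI.subset h') (by rw [lv_of_leader hu, lv_of_leader hu'])
    · exact absurd huw' (aux h hb' hu hw')
  · rcases h' with h' | ⟨b', hb', w', hw', rfl, huw', -⟩
    · exact absurd huw (aux h' hb hu' hw)
    · have hww : w = w' := shift_injective 1 (huw.symm.trans huw')
      rw [hI.inj (mem_highest.mp hb).1 (mem_highest.mp hb').1 (by rw [hw, hw', hww])]

/-- All orders between that of an element of `A` and the bound occur in `B`, as long as no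
candidate of lower leader is left. -/
lemma exists_leader_eq (hrk : IsRanking n) (hI : LoopInv A m D B) (hA : CallSpec A m)
    {c : DPoly k n} {w : DVar n} (hc : c ∈ A) (hw : leader c = w) {j : ℕ} (hwj : w.ord ≤ j)
    (hjm : j ≤ m w.var)
    (hno : ∀ g ∈ candidates m D B, ∀ i ≤ j, leader g ≠ (⟨w.var, i⟩ : DVar n)) :
    c ∉ D ∧ ∃ e ∈ B, leader e = (⟨w.var, j⟩ : DVar n) ∧
      (w.ord < j → degreeOf (⟨w.var, j⟩ : DVar n) e = 1) := by
  have hcD : c ∉ D := fun h => hno c (mem_candidates.mpr (Or.inl h)) w.ord hwj hw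
  refine ⟨hcD, ?_⟩
  obtain ⟨b, hb, hbc⟩ := hI.done c hc hcD
  obtain ⟨b', hb', hlv⟩ := exists_highest hb
  obtain ⟨u, hu⟩ := hI.exists_leader (mem_highest.mp hb').1
  have hvar : w.var = u.var := by
    rw [lv_of_leader hu, lv_of_leader (hbc.trans hw)] at hlv
    exact (WithBot.coe_injective hlv).symm
  -- If the chain stopped below order `j`, the derivative of its top would be a candidate excluded
  -- by `hno`.
  have hle : j ≤ u.ord := by
    by_contra hlt
    have hl := leader_delta hrk hu
    refine hno (delta k n b') (mem_candidates.mpr (Or.inr ⟨⟨b', hb', rfl⟩, ?_⟩)) (u.ord + 1)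
      (by omega) (by rw [hl, hvar, DVar.shift])
    intro u' hu'
    rw [← WithBot.coe_injective (hl.symm.trans hu'), DVar.shift]
    change u.ord + 1 ≤ m u.var
    rw [← hvar]
    omega
  obtain ⟨e, he, hej⟩ := (hI.origin_of_lv hA (mem_highest.mp hb').1 hc hu hw hvar).2.2.2.2 j hwj hle
  rw [← hvar] at hej
  exact ⟨e, he, hej, (hI.origin_of_lv hA he hc hej hw rfl).2.2.2.1⟩

/-- The divisors of a candidate of least rank: none of them has its leader. -/
lemma leader_divisor_ne (hrk : IsRanking n) (hI : LoopInv A m D B) (hA : CallSpec A m)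
    {g d : DPoly k n} (hg : g ∈ candidates m D B) (hd : d ∈ divisors D B g) :
    leader d ≠ leader g := by
  rcases mem_divisors.mp hd with hd | ⟨hgD, hdg, c, hc, rfl⟩
  · exact (hI.lt_cand d hd g hg).ne
  · intro heq
    obtain ⟨u, hu, h⟩ := hI.leader_candidate hrk hA hg
    rcases h with h | ⟨b, hb, w, hw, rfl, huw, -⟩
    · exact hgD h
    · obtain ⟨w', hw'⟩ := hI.exists_leader (lowest_subset B hc)
      rw [leader_delta hrk hw', hu, huw] at heq
      have hww : w' = w := shift_injective 1 (WithBot.coe_injective heq)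
      apply hdg
      rw [hI.inj (lowest_subset B hc) (mem_highest.mp hb).1 (by rw [hw, hw', hww])]

/-- The remainder of a candidate, modulo a differential ideal that contains `B`. -/
lemma exists_mul_sub_mem (hrk : IsRanking n) (hI : LoopInv A m D B) (hA : CallSpec A m)
    {g r : DPoly k n} {u : DVar n} (hg : g ∈ candidates m D B) (hu : leader g = u)
    (hrem : AlgRem (divisors D B g) g r) {Q : Ideal (DPoly k n)} (hQ : IsDiffIdeal Q)
    (hB : ∀ b ∈ B, b ∈ Q) (hH : ∀ h ∈ inisep B, Cancels Q h) :
    (∀ v ∈ r.vars, v ≤ u) ∧ degreeOf u r ≤ degreeOf u g ∧ ∃ P, Cancels Q P ∧ P * g - r ∈ Q ∧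
      (∀ d, P * coeffIn u d g - coeffIn u d r ∈ Q) ∧ P * pderiv u g - pderiv u r ∈ Q := by
  refine hrem.exists_mul_sub_mem_of_leader_ne (fun v hv => le_leader hu hv)
    (fun d hd => hu ▸ hI.leader_divisor_ne hrk hA hg hd) fun d hd _ => ?_
  rcases mem_divisors.mp hd with hd | ⟨hgD, hdg, c, hc, rfl⟩
  · exact ⟨hB d hd, hH _ (initial_mem_inisep hd)⟩
  · obtain ⟨w, hw⟩ := hI.exists_leader (lowest_subset B hc)
    refine ⟨hQ _ (hB c (lowest_subset B hc)), ?_⟩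
    rw [initial_delta hrk hw]
    exact hH _ (separant_mem_inisep (lowest_subset B hc))

/-- A candidate lies in every differential ideal that contains `A`, and its initial and separant
cancel. -/
lemma candidate_mem (hrk : IsRanking n) (hI : LoopInv A m D B) (hA : CallSpec A m)
    {g : DPoly k n} (hg : g ∈ candidates m D B) {Q : Ideal (DPoly k n)} (hQ : IsDiffIdeal Q)
    (hAQ : ∀ c ∈ A, c ∈ Q) (hH : ∀ h ∈ inisep A, Cancels Q h) :
    g ∈ Q ∧ Cancels Q (initial g) ∧ Cancels Q (separant g) := by
  obtain ⟨hBQ, hHB⟩ := hI.forward Q hQ hAQ hH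
  obtain ⟨u, hu, h⟩ := hI.leader_candidate hrk hA hg
  rcases h with h | ⟨b, hb, w, hw, rfl, -, -⟩
  · exact ⟨hAQ g (hI.subset h), hH _ (initial_mem_inisep (hI.subset h)),
      hH _ (separant_mem_inisep (hI.subset h))⟩
  · have hbB := (mem_highest.mp hb).1
    rw [initial_delta hrk hw, separant_delta hrk hw]
    exact ⟨hQ _ (hBQ b hbB), hHB _ (separant_mem_inisep hbB), hHB _ (separant_mem_inisep hbB)⟩

/-- If the rank of a candidate drops, then the system is inconsistent. -/
lemma eq_top_of_rank_ne (hrk : IsRanking n) (hI : LoopInv A m D B) (hA : CallSpec A m)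
    {g r : DPoly k n} (hg : g ∈ candidates m D B) (hrem : AlgRem (divisors D B g) g r)
    (hr : rank r ≠ rank g) {Q : Ideal (DPoly k n)} (hQ : IsDiffIdeal Q)
    (hAQ : ∀ c ∈ A, c ∈ Q) (hH : ∀ h ∈ inisep A, Cancels Q h) : Q = ⊤ := by
  obtain ⟨hBQ, hHB⟩ := hI.forward Q hQ hAQ hH
  obtain ⟨u, hu, -⟩ := hI.leader_candidate hrk hA hg
  obtain ⟨-, hgi, -⟩ := hI.candidate_mem hrk hA hg hQ hAQ hH
  obtain ⟨hle, hdeg, P, hP, -, hco, -⟩ := hI.exists_mul_sub_mem hrk hA hg hu hrem hQ hBQ hHB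
  have hlt : degreeOf u r < degreeOf u g := by
    refine lt_of_le_of_ne hdeg fun h => hr ?_
    rw [rank_eq_iff hu, leader_eq_iff]
    refine ⟨⟨?_, hle⟩, h⟩
    rw [mem_vars_iff_degreeOf_ne_zero, h]
    exact (degreeOf_leader_pos hu).ne'
  -- The coefficient of the leading power vanishes in the remainder, so a product of two cancelling
  -- factors lies in `Q`.
  have h1 := hco (degreeOf u g)
  rw [coeffIn_eq_zero_of_lt hlt, sub_zero, ← initial_of_leader hu] at h1
  rw [Ideal.eq_top_iff_one]
  exact hP.mul hgi 1 (by rwa [mul_one])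

section Step

variable {g r : DPoly k n} {u : DVar n}

/-- Old candidates other than `g` have higher leaders, since leaders of candidates are distinct; the
only possible new candidate is `δ r`. -/
lemma leader_lt_candidate_insert (hrk : IsRanking n) (hI : LoopInv A m D B) (hA : CallSpec A m)
    (hg : IsLeastRank (candidates m D B) g) (hu : leader g = u) (hr : leader r = u)
    {h : DPoly k n} (hh : h ∈ candidates m (D.erase g) (insert r B)) :
    (u : WithBot (DVar n)) < leader h := by
  have aux : h ∈ candidates m D B → h ≠ g → (u : WithBot (DVar n)) < leader h := by
    intro hc hne
    refine lt_of_le_of_ne (hu ▸ leader_le_of_rank_le (hg.2 h hc)) fun heq => hne ?_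
    exact hI.candidate_inj hrk hA hc hg.1 (heq.symm.trans hu.symm)
  rcases mem_candidates.mp hh with hD | ⟨⟨b, hb, rfl⟩, hm⟩
  · rw [Finset.mem_erase] at hD
    exact aux (mem_candidates.mpr (Or.inl hD.2)) hD.1
  · obtain ⟨hbB, hmax⟩ := mem_highest.mp hb
    rw [Finset.mem_insert] at hbB
    rcases hbB with rfl | hbB
    · rw [leader_delta hrk hr]
      exact WithBot.coe_lt_coe.mpr (hrk.lt_shift u)
    · refine aux (mem_candidates.mpr (Or.inr ⟨⟨b, mem_highest.mpr ⟨hbB, fun x hx hlv =>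
        hmax x (Finset.mem_insert_of_mem hx) hlv⟩, rfl⟩, hm⟩)) ?_
      -- If `g` were the derivative of `b`, then `r` would be above `b` in the same chain, so `b`
      -- would no longer be the highest element.
      rintro rfl
      obtain ⟨w, hw⟩ := hI.exists_leader hbB
      have hl := leader_delta hrk hw
      have huw : w.shift 1 = u := WithBot.coe_injective (hl.symm.trans hu)
      have h1 := leader_le_of_rank_le (hmax r (Finset.mem_insert_self r B) (by
        rw [lv_of_leader hr, lv_of_leader hw, ← huw, DVar.shift]))
      rw [hr, hw, ← huw, WithBot.coe_le_coe] at h1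
      exact absurd h1 (not_le.mpr (hrk.lt_shift w))

/-- The remainder of a derivative does not involve a leading variable to an order that exceeds
the bound. -/
lemma ord_le_of_delta (hrk : IsRanking n) (hI : LoopInv A m D B) (hA : CallSpec A m)
    (hg : IsLeastRank (candidates m D B) g) (hu : leader g = u) (hr : leader r = u)
    (hrem : AlgRem (divisors D B g) g r) (hgD : g ∉ D) {v : DVar n} (hv : v ∈ r.vars)
    (hvA : v.var ∈ lvSet A) : v.ord ≤ m v.var := by
  obtain ⟨u', hu', hcase⟩ := hI.leader_candidate hrk hA hg.1
  have huu : u' = u := WithBot.coe_injective (hu'.symm.trans hu)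
  subst huu
  rcases hcase with h | ⟨b, hb, x, hx, hgb, hux, hum⟩
  · exact absurd h hgD
  by_contra hlt
  rw [not_le] at hlt
  have hB : ∀ b ∈ B, v ∉ b.vars := fun b hb hvb => absurd (hI.ord_le b hb v hvb hvA) (by omega)
  -- `v` is the derivative of a variable of an element of `B`
  obtain ⟨a, ha, hva, ha'⟩ : ∃ a ∈ B, v ∈ (delta k n a).vars ∧ (a = b ∨ a ∈ lowest B) := by
    rcases hrem.mem_vars hv with h | ⟨d, hd, hvd⟩
    · exact ⟨b, (mem_highest.mp hb).1, hgb ▸ h, Or.inl rfl⟩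
    · rcases mem_divisors.mp hd with hd | ⟨-, -, c, hc, rfl⟩
      · exact absurd hvd (hB d hd)
      · exact ⟨c, lowest_subset B hc, hvd, Or.inr hc⟩
  obtain ⟨s, hs, rfl⟩ := (vars_delta_subset a hva).resolve_left (hB a ha)
  have hsm : s.ord = m s.var := by
    have h1 := hI.ord_le a ha s hs hvA
    have h2 : m s.var < s.ord + 1 := hlt
    omega
  obtain ⟨c, hc, w, hw, hws⟩ := mem_lvSet.mp hvA
  change w.var = s.var at hws
  have hwm : w.ord ≤ m w.var := hA.ord_le c hc w (leader_mem hw)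
  have hvu : s.shift 1 ≤ u' := le_leader hr hv
  have hs_eq : (⟨w.var, m w.var⟩ : DVar n) = s := DVar.ext hws (by rw [hws, hsm])
  -- All derivatives of this indeterminate up to the bound are lower than the leader of `g`, so no
  -- candidate with such a leader is left and the chain already reaches `s`.
  obtain ⟨hcD, e, he, hes, hdeg⟩ := hI.exists_leader_eq hrk hA hc hw hwm le_rfl (by
    intro h hh i hi heq
    have h1 := leader_le_of_rank_le (hg.2 h hh)
    rw [hu, heq, WithBot.coe_le_coe] at h1
    have h2 : (⟨w.var, i⟩ : DVar n) ≤ s := by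
      rw [hrk.le_iff_ord_le (show (⟨w.var, i⟩ : DVar n).var = s.var from hws), hsm, ← hws]
      exact hi
    exact absurd (hvu.trans (h1.trans h2)) (not_le.mpr (hrk.lt_shift s)))
  rw [hs_eq] at hes hdeg
  have hus : u' ≠ s.shift 1 := by
    rintro rfl
    change s.ord + 1 ≤ m s.var at hum
    omega
  rcases hwm.lt_or_eq with hlt' | heq
  · -- the element of `B` with leader `s` is linear in `s`
    have hd1 := hdeg hlt'
    have hae : a ≠ e := by
      rintro rfl
      rcases ha' with rfl | ha'
      · rw [hx] at hes
        exact hus (by rw [hux, WithBot.coe_injective hes])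
      -- A lowest element has leader of order at most `w.ord`, which is less than the order of `s`.
      · obtain ⟨b0, hb0, hb0c⟩ := hI.done c hc hcD
        have h1 := leader_le_of_rank_le ((mem_lowest.mp ha').2 b0 hb0 (by
          rw [lv_of_leader (hb0c.trans hw), lv_of_leader hes, hws]))
        rw [hes, hb0c, hw, WithBot.coe_le_coe, hrk.le_iff_ord_le hws.symm, hsm, ← hws] at h1
        omega
    have h1 := hI.algRed a ha e he hae s hes
    rw [hd1] at h1
    rw [mem_vars_iff_degreeOf_ne_zero] at hs
    omega
  · -- the derivative of the lowest element is a divisor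
    have hsw : s = w := by
      rw [← hs_eq]
      exact DVar.ext rfl heq.symm
    have hel : e ∈ lowest B := hI.mem_lowest_of_leader hrk hA he hc (by rw [hes, hw, hsw])
    have hne : delta k n e ≠ g := by
      intro h
      have h1 := leader_delta hrk hes
      rw [h, hu] at h1
      exact hus (WithBot.coe_injective h1)
    have h1 := hrem.2 _ (mem_divisors.mpr (Or.inr ⟨hgD, hne, e, hel, rfl⟩)) _
      (leader_delta hrk hes)
    rw [(degreeOf_delta hrk hes).2.1] at h1
    rw [mem_vars_iff_degreeOf_ne_zero] at hv
    omega

/-- Since the rank is preserved, `r` takes the place of `g` in the chain of leaders. Coefficients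
and the derivative with respect to the leader are transformed by the same cancelling factor as `g`
itself, which transports memberships, initials and separants in both directions. -/
theorem insert_rem (hrk : IsRanking n) (hI : LoopInv A m D B) (hA : CallSpec A m)
    (hg : IsLeastRank (candidates m D B) g) (hrem : AlgRem (divisors D B g) g r)
    (hrank : rank r = rank g) :
    r ∉ B ∧ LoopInv A m (D.erase g) (insert r B) := by
  obtain ⟨u, hu, hcase⟩ := hI.leader_candidate hrk hA hg.1
  obtain ⟨hr, hdeg⟩ := (rank_eq_iff hu).mp hrank
  have hlt : ∀ b ∈ B, leader b < u := fun b hb => hu ▸ hI.lt_cand b hb g hg.1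
  have hrB : r ∉ B := fun h => absurd (hlt r h) (by rw [hr]; exact lt_irrefl _)
  have hcard : (insert r B).card = B.card + 1 := Finset.card_insert_of_notMem hrB
  have hcardD : g ∈ D → (D.erase g).card + 1 = D.card := Finset.card_erase_add_one
  -- The sum is unchanged if `g` comes from `D`, and grows by one if `g` is a derivative.
  have hsum : (B.card + D.card : ℕ) ≤ (insert r B).card + (D.erase g).card := by
    by_cases h : g ∈ D
    · have := hcardD h; omega
    · rw [Finset.erase_eq_of_notMem h]; omega
  have hini : initial r = coeffIn u (degreeOf u g) r := by rw [initial_of_leader hr, hdeg]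
  refine ⟨hrB, ⟨(Finset.erase_subset _ _).trans hI.subset, ?_, ?_, ?_, ?_, ?_, ?_,
    hI.card_le.trans hsum, ?_, ?_, ?_⟩⟩
  · rw [Finset.coe_insert, Set.injOn_insert hrB]
    refine ⟨hI.inj, ?_⟩
    rintro ⟨b, hb, hbr⟩
    exact absurd (hlt b hb) (by rw [hbr, hr]; exact lt_irrefl _)
  · intro b hb h hh
    have h1 := hI.leader_lt_candidate_insert hrk hA hg hu hr hh
    rw [Finset.mem_insert] at hb
    rcases hb with rfl | hb
    · rwa [hr]
    · exact (hlt b hb).trans h1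
  · intro b hb b' hb' hne
    rw [Finset.mem_insert] at hb hb'
    rcases hb with rfl | hb
    · rcases hb' with rfl | hb'
      · exact absurd rfl hne
      · exact hrem.2 b' (mem_divisors.mpr (Or.inl hb'))
    · rcases hb' with rfl | hb'
      · intro v hv
        have hvu : v = u := WithBot.coe_injective (hv.symm.trans hr)
        subst hvu
        have : v ∉ b.vars := fun h => absurd (Finset.le_max h) (not_le.mpr (hlt b hb))
        rw [notMem_vars_iff.mp this]
        exact degreeOf_leader_pos hr
      · exact hI.algRed b hb b' hb' hne
  · intro b hb
    rw [Finset.mem_insert] at hb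
    rcases hb with rfl | hb
    · rcases hcase with hgD | ⟨b0, hb0, x, hx, rfl, rfl, -⟩
      · refine ⟨g, hI.subset hgD, Finset.notMem_erase _ _, u, u, hu, hr, rfl, le_rfl,
          fun _ => hdeg, fun h => absurd h (lt_irrefl _), fun j h1 h2 => ⟨b,
          Finset.mem_insert_self _ _, ?_⟩⟩
        rw [hr]
        congr 1
        exact DVar.ext rfl (le_antisymm h1 h2)
      · obtain ⟨c, hc, hcD, w, x', hw, hx', hvar, hle, -, -, hfill⟩ :=
          hI.origin b0 (mem_highest.mp hb0).1
        have hxx : x' = x := WithBot.coe_injective (hx'.symm.trans hx)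
        subst hxx
        refine ⟨c, hc, fun h => hcD (Finset.mem_of_mem_erase h), w, x'.shift 1, hw, hr, hvar,
          le_trans hle (Nat.le_succ _), ?_, fun _ => ?_, fun j h1 h2 => ?_⟩
        · intro h
          have := congrArg DVar.ord h
          simp only [DVar.shift] at this
          omega
        · rw [hdeg, (degreeOf_delta hrk hx).2.1]
        · change j ≤ x'.ord + 1 at h2
          rcases h2.eq_or_lt with rfl | h2
          · exact ⟨b, Finset.mem_insert_self _ _, hr⟩
          · obtain ⟨e, he, hej⟩ := hfill j h1 (by omega)
            exact ⟨e, Finset.mem_insert_of_mem he, hej⟩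
    · obtain ⟨c, hc, hcD, w, x, hw, hx, hvar, hle, h1, h2, hfill⟩ := hI.origin b hb
      refine ⟨c, hc, fun h => hcD (Finset.mem_of_mem_erase h), w, x, hw, hx, hvar, hle, h1, h2,
        fun j hj1 hj2 => ?_⟩
      obtain ⟨e, he, hej⟩ := hfill j hj1 hj2
      exact ⟨e, Finset.mem_insert_of_mem he, hej⟩
  · intro c hc hcD
    by_cases h : c ∈ D
    · have : c = g := by
        by_contra hne
        exact hcD (Finset.mem_erase.mpr ⟨hne, h⟩)
      exact ⟨r, Finset.mem_insert_self _ _, by rw [hr, this, hu]⟩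
    · obtain ⟨b, hb, hbc⟩ := hI.done c hc h
      exact ⟨b, Finset.mem_insert_of_mem hb, hbc⟩
  · intro b hb v hv hvA
    rw [Finset.mem_insert] at hb
    rcases hb with rfl | hb
    · by_cases hgD : g ∈ D
      · rcases hrem.mem_vars hv with h | ⟨d, hd, hvd⟩
        · exact hA.ord_le g (hI.subset hgD) v h
        · rcases mem_divisors.mp hd with hd | ⟨h, -⟩
          · exact hI.ord_le d hd v hvd hvA
          · exact absurd hgD h
      · exact hI.ord_le_of_delta hrk hA hg hu hr hrem hgD hv hvA
    · exact hI.ord_le b hb v hv hvA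
  · intro b hb v hv hvA
    rw [Finset.mem_insert] at hb
    rcases hb with rfl | hb
    · have hBv : ∀ d ∈ B, v ∈ d.vars →
          v.ord + A.card ≤ m v.var + ((insert b B).card + (D.erase g).card) := fun d hd hvd =>
        (hI.ord_add_le d hd v hvd hvA).trans (by omega)
      -- Differentiation raises an order by at most one, which the growth of `B.card + D.card` pays
      -- for.
      have hδ : g ∉ D → ∀ d ∈ B, v ∈ (delta k n d).vars →
          v.ord + A.card ≤ m v.var + ((insert b B).card + (D.erase g).card) := by
        intro hgD d hd hvd
        rcases vars_delta_subset d hvd with h | ⟨s, hs, rfl⟩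
        · exact hBv d hd h
        · have h1 := hI.ord_add_le d hd s hs hvA
          rw [hcard, Finset.erase_eq_of_notMem hgD]
          change s.ord + 1 + A.card ≤ m s.var + _
          omega
      rcases hrem.mem_vars hv with h | ⟨d, hd, hvd⟩
      · rcases hcase with hgD | ⟨b0, hb0, x, hx, rfl, -, -⟩
        · have h1 := hA.ord_le g (hI.subset hgD) v h
          have h2 := hI.card_le
          omega
        · by_cases hgD : delta k n b0 ∈ D
          · have h1 := hA.ord_le _ (hI.subset hgD) v h
            have h2 := hI.card_le
            omega
          · exact hδ hgD b0 (mem_highest.mp hb0).1 h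
      · rcases mem_divisors.mp hd with hd | ⟨hgD, -, c, hc, rfl⟩
        · exact hBv d hd hvd
        · exact hδ hgD c (lowest_subset B hc) hvd
    · exact (hI.ord_add_le b hb v hv hvA).trans (by omega)
  · intro Q hQ hAQ hH
    obtain ⟨hBQ, hHB⟩ := hI.forward Q hQ hAQ hH
    obtain ⟨hgQ, hgi, hgs⟩ := hI.candidate_mem hrk hA hg.1 hQ hAQ hH
    obtain ⟨-, -, P, hP, h1, h2, h3⟩ := hI.exists_mul_sub_mem hrk hA hg.1 hu hrem hQ hBQ hHB
    constructor
    · intro b hb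
      rw [Finset.mem_insert] at hb
      rcases hb with rfl | hb
      · exact (mem_iff_of_sub_mem hP h1).mp hgQ
      · exact hBQ b hb
    · intro h hh
      obtain ⟨b, hb, hb'⟩ := mem_inisep.mp hh
      rw [Finset.mem_insert] at hb
      rcases hb with rfl | hb
      · rcases hb' with rfl | rfl
        · rw [hini]
          rw [initial_of_leader hu] at hgi
          exact (cancels_iff_of_sub_mem hP (h2 _)).mp hgi
        · rw [separant_of_leader hr]
          rw [separant_of_leader hu] at hgs
          exact (cancels_iff_of_sub_mem hP h3).mp hgs
      · exact hHB h (mem_inisep.mpr ⟨b, hb, hb'⟩)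
  · intro Q hQ hlow hH
    have hHB : ∀ h ∈ inisep B, Cancels Q h := fun h hh =>
      hH h (inisep_mono (Finset.subset_insert r B) hh)
    have hHr : ∀ h, h = initial r ∨ h = separant r → Cancels Q h := fun h hh =>
      hH h (mem_inisep.mpr ⟨r, Finset.mem_insert_self r B, hh⟩)
    obtain ⟨hBQ, hAQ⟩ := hI.backward Q hQ
      (fun b hb => hlow b (hI.lowest_subset_insert hg hu hr hb)) hHB
    obtain ⟨-, -, P, hP, h1, h2, h3⟩ := hI.exists_mul_sub_mem hrk hA hg.1 hu hrem hQ hBQ hHB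
    -- If `g` comes from `D`, then `r` begins a new chain and is a lowest element. Otherwise `g` is
    -- the derivative of an element already known to lie in `Q`.
    have hrQ : r ∈ Q := by
      rcases hcase with hgD | ⟨b0, hb0, x, hx, rfl, -, -⟩
      · refine hlow r (mem_lowest.mpr ⟨Finset.mem_insert_self r B, fun b hb hlv => ?_⟩)
        rw [Finset.mem_insert] at hb
        rcases hb with rfl | hb
        · exact le_rfl
        · obtain ⟨x, hx⟩ := hI.exists_leader hb
          rw [lv_of_leader hx, lv_of_leader hr] at hlv
          exact absurd hgD (hI.origin_of_lv hA hb (hI.subset hgD) hx hu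
            (WithBot.coe_injective hlv).symm).1
      · exact (mem_iff_of_sub_mem hP h1).mp (hQ _ (hBQ b0 (mem_highest.mp hb0).1))
    constructor
    · intro b hb
      rw [Finset.mem_insert] at hb
      rcases hb with rfl | hb
      · exact hrQ
      · exact hBQ b hb
    · intro c hc hcD
      by_cases h : c ∈ D
      · have : c = g := by
          by_contra hne
          exact hcD (Finset.mem_erase.mpr ⟨hne, h⟩)
        subst this
        refine ⟨(mem_iff_of_sub_mem hP h1).mpr hrQ, ?_, ?_⟩
        · rw [initial_of_leader hu, cancels_iff_of_sub_mem hP (h2 _), ← hini]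
          exact hHr _ (Or.inl rfl)
        · rw [separant_of_leader hu, cancels_iff_of_sub_mem hP h3, ← separant_of_leader hr]
          exact hHr _ (Or.inr rfl)
      · exact hAQ c hc h

end Step

end LoopInv

end Loop

/-! ## The result of Differentiate&Autoreduce -/

section Exit

variable {k : Type*} [Field k] {n : ℕ}

lemma maxOrd_le_iff {F : Finset (DPoly k n)} {y : Fin n} {c : ℕ} :
    maxOrd F y ≤ c ↔ ∀ f ∈ F, ∀ v ∈ f.vars, v.var = y → v.ord ≤ c := by
  simp only [maxOrd, Finset.sup_le_iff, Finset.mem_filter, and_imp]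

lemma ord_le_maxOrd {F : Finset (DPoly k n)} {f : DPoly k n} (hf : f ∈ F) {v : DVar n}
    (hv : v ∈ f.vars) : v.ord ≤ maxOrd F v.var :=
  maxOrd_le_iff.mp le_rfl f hf v hv rfl

variable [LinearOrder (DVar n)]

lemma card_lvSet_le (A : Finset (DPoly k n)) : (lvSet A).card ≤ A.card := by
  have h : (lvSet A).image WithBot.some ⊆ A.image lv := by
    intro z hz
    obtain ⟨y, hy, rfl⟩ := Finset.mem_image.mp hz
    obtain ⟨f, hf, u, hu, rfl⟩ := mem_lvSet.mp hy
    exact Finset.mem_image.mpr ⟨f, hf, lv_of_leader hu⟩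
  rw [← Finset.card_image_of_injective (lvSet A) WithBot.coe_injective]
  exact (Finset.card_le_card h).trans Finset.card_image_le

/-- The value at an indeterminate that is not leading is arbitrary. -/
lemma CallSpec.exists_lowOrd {A : Finset (DPoly k n)} {m : Fin n → ℕ} (hA : CallSpec A m) :
    ∃ a : Fin n → ℕ, ∀ c ∈ A, ∀ w : DVar n, leader c = w → a w.var = w.ord := by
  have h : ∀ y : Fin n, ∃ j : ℕ, ∀ c ∈ A, ∀ w : DVar n, leader c = w → w.var = y → j = w.ord := by
    intro y
    by_cases hy : ∃ c ∈ A, ∃ w : DVar n, leader c = w ∧ w.var = y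
    · obtain ⟨c, hc, w, hw, rfl⟩ := hy
      refine ⟨w.ord, fun c' hc' w' hw' hvar => ?_⟩
      have : c' = c := hA.lvInj hc' hc (by rw [lv_of_leader hw, lv_of_leader hw', hvar])
      subst this
      rw [WithBot.coe_injective (hw.symm.trans hw')]
    · exact ⟨0, fun c hc w hw hvar => absurd ⟨c, hc, w, hw, hvar⟩ hy⟩
  choose a ha using h
  exact ⟨a, fun c hc w hw => ha _ c hc w hw rfl⟩

variable [Differential k]

namespace LoopInv

variable {A : Finset (DPoly k n)} {m : Fin n → ℕ} {D B : Finset (DPoly k n)}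

lemma exists_lowest (hrk : IsRanking n) (hI : LoopInv A m D B) (hA : CallSpec A m)
    {c : DPoly k n} (hc : c ∈ A) (hcD : c ∉ D) : ∃ b ∈ lowest B, rank b = rank c := by
  obtain ⟨w, hw⟩ := RG.exists_leader (hA.nonconst c hc)
  obtain ⟨b, hb, hbc⟩ := hI.done c hc hcD
  have hbw := hbc.trans hw
  refine ⟨b, hI.mem_lowest_of_leader hrk hA hb hc hbc, ?_⟩
  rw [rank_eq_iff hw]
  exact ⟨hbw, (hI.origin_of_lv hA hb hc hbw hw rfl).2.2.1 rfl⟩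

/-- The leaders of `B` are distinct, and those that are derivatives of `y` have orders between `a y`
and `m y`. -/
lemma card_le_sum (hI : LoopInv A m D B) (hA : CallSpec A m) {a : Fin n → ℕ}
    (ha : ∀ c ∈ A, ∀ w : DVar n, leader c = w → a w.var = w.ord) :
    B.card ≤ ∑ y ∈ lvSet A, (m y + 1 - a y) := by
  have hB : ∀ b : B, ∃ u : DVar n, leader b.1 = u := fun b => hI.exists_leader b.2
  choose φ hφ using hB
  have h : B.attach.card ≤ ((lvSet A).sigma fun y => Finset.Icc (a y) (m y)).card := by
    refine Finset.card_le_card_of_injOn (fun b => ⟨(φ b).var, (φ b).ord⟩) ?_ ?_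
    · intro b _
      rw [Finset.mem_coe, Finset.mem_sigma, Finset.mem_Icc]
      have hmem := hI.var_mem_lvSet b.2 (hφ b)
      obtain ⟨c, hc, w, hw, hvar⟩ := mem_lvSet.mp hmem
      refine ⟨hmem, ?_, hI.ord_le b.1 b.2 _ (leader_mem (hφ b)) hmem⟩
      change a (φ b).var ≤ (φ b).ord
      rw [← hvar, ha c hc w hw]
      exact (hI.origin_of_lv hA b.2 hc (hφ b) hw hvar).2.1
    · intro b _ b' _ heq
      simp only [Sigma.mk.injEq] at heq
      apply Subtype.ext
      refine hI.inj b.2 b'.2 ?_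
      rw [hφ b, hφ b', DVar.ext heq.1 (eq_of_heq heq.2)]
  rw [Finset.card_attach, Finset.card_sigma] at h
  simpa using h

/-- This coarse bound makes the loop finite; it depends on `m` alone. -/
lemma card_le_sum_succ (hI : LoopInv A m D B) (hA : CallSpec A m) :
    B.card ≤ ∑ y, (m y + 1) := by
  obtain ⟨a, ha⟩ := hA.exists_lowOrd
  refine (hI.card_le_sum hA ha).trans ((Finset.sum_le_sum fun y _ => Nat.sub_le _ _).trans ?_)
  exact Finset.sum_le_sum_of_subset (Finset.subset_univ _)

variable [CharZero k]

/-- At the end of the loop, a polynomial that is algebraically reduced does not involve proper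
derivatives of the leaders of `A`. -/
lemma ord_le_of_algReduced (hrk : IsRanking n) (hI : LoopInv A m D B) (hA : CallSpec A m)
    (hdone : candidates m D B = ∅) {x : DPoly k n}
    (hx : ∀ v ∈ x.vars, v.var ∈ lvSet A → v.ord ≤ m v.var)
    (hred : ∀ e ∈ B, e ∉ lowest B → AlgReduced x e) {c : DPoly k n} (hc : c ∈ A) {w v : DVar n}
    (hw : leader c = w) (hv : v ∈ x.vars) (hvar : v.var = w.var) : v.ord ≤ w.ord := by
  by_contra hlt
  rw [not_le] at hlt
  have hvm : v.ord ≤ m w.var := hvar ▸ hx v hv (mem_lvSet.mpr ⟨c, hc, w, hw, hvar.symm⟩)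
  obtain ⟨-, e, he, hev, hdeg⟩ := hI.exists_leader_eq hrk hA hc hw hlt.le hvm (by simp [hdone])
  have hv_eq : (⟨w.var, v.ord⟩ : DVar n) = v := DVar.ext hvar.symm rfl
  rw [hv_eq] at hev hdeg
  -- The leader of a lowest element is that of an element of `A`, so here its order would be
  -- `w.ord`. This matters because a lowest element is not reduced with respect to itself.
  have hlow : e ∉ lowest B := by
    intro h
    obtain ⟨c', hc', -, w', hw', hew', -⟩ := hI.exists_of_mem_lowest hrk h
    have hvw : v = w' := WithBot.coe_injective (hev.symm.trans hew')
    subst hvw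
    have : c' = c := hA.lvInj hc' hc (by rw [lv_of_leader hw', lv_of_leader hw, hvar])
    subst this
    have := WithBot.coe_injective (hw.symm.trans hw')
    subst this
    exact lt_irrefl _ hlt
  have h1 := hred e he hlow v hev
  rw [hdeg hlt] at h1
  rw [mem_vars_iff_degreeOf_ne_zero] at hv
  omega

/-- The polynomials that occur in a system constructed from the result `B`. -/
lemma ord_le_of_exit (hrk : IsRanking n) (hI : LoopInv A m D B) (hA : CallSpec A m)
    (hdone : candidates m D B = ∅) {x : DPoly k n}
    (hx : (∃ g, (∀ v ∈ g.vars, v.ord ≤ m v.var) ∧ AlgRem B g x) ∨ x ∈ lowest B ∨ x ∈ inisep B) :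
    (∀ c ∈ A, ∀ w v : DVar n, leader c = w → v ∈ x.vars → v.var = w.var → v.ord ≤ w.ord) ∧
      ∀ v ∈ x.vars, v.var ∉ lvSet A → v.ord + A.card ≤ m v.var + B.card := by
  have hD : D = ∅ := Finset.eq_empty_of_forall_notMem fun c hc => by
    have : c ∈ candidates m D B := mem_candidates.mpr (Or.inl hc)
    simp [hdone] at this
  have hcard := hI.card_le
  have hout : ∀ b ∈ B, ∀ v ∈ b.vars, v.var ∉ lvSet A → v.ord + A.card ≤ m v.var + B.card := by
    intro b hb v hv hvA
    have := hI.ord_add_le b hb v hv hvA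
    rwa [hD, Finset.card_empty, add_zero] at this
  rw [hD, Finset.card_empty, add_zero] at hcard
  rcases hx with ⟨g, hg, hrem⟩ | hx | hx
  · refine ⟨fun c hc w v hw hv hvar => hI.ord_le_of_algReduced hrk hA hdone (fun v hv hvA => ?_)
      (fun e he _ => hrem.2 e he) hc hw hv hvar, fun v hv hvA => ?_⟩
    · rcases hrem.mem_vars hv with h | ⟨b, hb, hvb⟩
      · exact hg v h
      · exact hI.ord_le b hb v hvb hvA
    · rcases hrem.mem_vars hv with h | ⟨b, hb, hvb⟩
      · have := hg v h
        omega
      · exact hout b hb v hvb hvA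
  · have hxB := lowest_subset B hx
    refine ⟨fun c hc w v hw hv hvar => hI.ord_le_of_algReduced hrk hA hdone (hI.ord_le x hxB)
      (fun e he hel => hI.algRed x hxB e he ?_) hc hw hv hvar, hout x hxB⟩
    rintro rfl
    exact hel hx
  · obtain ⟨b, hb, hxb⟩ := mem_inisep.mp hx
    have hdeg : ∀ v, degreeOf v x ≤ degreeOf v b := by
      rcases hxb with rfl | rfl
      · exact degreeOf_initial_le b
      · exact degreeOf_separant_le b
    have hvars := vars_subset_of_degreeOf_le hdeg
    refine ⟨fun c hc w v hw hv hvar => hI.ord_le_of_algReduced hrk hA hdone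
      (fun v hv => hI.ord_le b hb v (hvars hv)) (fun e he _ u hu => ?_) hc hw hv hvar,
      fun v hv => hout b hb v (hvars hv)⟩
    by_cases hbe : b = e
    · subst hbe
      rcases hxb with rfl | rfl
      · exact degreeOf_initial_lt hu
      · exact degreeOf_separant_lt hu
    · exact (hdeg u).trans_lt (hI.algRed b hb e he hbe u hu)

/-- The number of differentiations is at most `B.card - A.card`. The chains contain at most `m z - a
z + 1` elements each, and `A` has at least as many elements as leading variables, so the ones
cancel. -/
lemma maxOrd_le_of_exit (hrk : IsRanking n) (hI : LoopInv A m D B) (hA : CallSpec A m)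
    (hdone : candidates m D B = ∅) {X : Finset (DPoly k n)}
    (hX : ∀ x ∈ X, (∃ g, (∀ v ∈ g.vars, v.ord ≤ m v.var) ∧ AlgRem B g x) ∨ x ∈ lowest B ∨
      x ∈ inisep B) :
    ∃ a : Fin n → ℕ, (∀ y ∈ lvSet A, a y ≤ m y) ∧ (∀ y ∈ lvSet A, maxOrd X y ≤ a y) ∧
      ∀ y ∉ lvSet A, maxOrd X y ≤ m y + ∑ z ∈ lvSet A, (m z - a z) := by
  obtain ⟨a, ha⟩ := hA.exists_lowOrd
  have ham : ∀ y ∈ lvSet A, a y ≤ m y := by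
    intro y hy
    obtain ⟨c, hc, w, hw, rfl⟩ := mem_lvSet.mp hy
    rw [ha c hc w hw]
    exact hA.ord_le c hc w (leader_mem hw)
  refine ⟨a, ham, fun y hy => maxOrd_le_iff.mpr fun x hx v hv hvy => ?_,
    fun y hy => maxOrd_le_iff.mpr fun x hx v hv hvy => ?_⟩
  · obtain ⟨c, hc, w, hw, rfl⟩ := mem_lvSet.mp hy
    rw [ha c hc w hw]
    exact (hI.ord_le_of_exit hrk hA hdone (hX x hx)).1 c hc w v hw hv hvy
  · subst hvy
    have h1 := (hI.ord_le_of_exit hrk hA hdone (hX x hx)).2 v hv hy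
    have h2 := hI.card_le_sum hA ha
    have h3 : ∑ y ∈ lvSet A, (m y + 1 - a y) = ∑ y ∈ lvSet A, (m y - a y) + (lvSet A).card := by
      rw [Finset.card_eq_sum_ones, ← Finset.sum_add_distrib]
      refine Finset.sum_congr rfl fun y hy => ?_
      have := ham y hy
      omega
    have h4 := card_lvSet_le A
    omega

end LoopInv

end Exit

/-! ## Bounds for orders -/

section Bounds

variable {k : Type*} [Field k] {n : ℕ}

/-- The bound for a system with the set `Z` of leading variables, `X` being the set of all its
elements. -/
def OrderBound (M : ℕ) (Z : Finset (Fin n)) (X : Finset (DPoly k n)) : Prop :=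
  sumOrd X ≤ (n - 1).factorial * M ∧
    (Z.card < n → weightedOrd Z X ≤ (∏ i ∈ Finset.range Z.card, (n - (i + 1))) * M)

lemma sumOrd_eq_add (Z : Finset (Fin n)) (X : Finset (DPoly k n)) :
    sumOrd X = ∑ y ∈ Z, maxOrd X y + ∑ y ∈ Zᶜ, maxOrd X y := by
  rw [sumOrd, Finset.sum_add_sum_compl]

lemma sumOrd_le_weightedOrd {Z : Finset (Fin n)} (hZ : Z.card < n) (X : Finset (DPoly k n)) :
    sumOrd X ≤ weightedOrd Z X := by
  rw [sumOrd_eq_add Z, weightedOrd]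
  have : 1 ≤ n - Z.card := by omega
  gcongr
  exact Nat.le_mul_of_pos_left _ this

lemma prod_range_le_factorial {l : ℕ} (h : l < n) :
    ∏ i ∈ Finset.range l, (n - (i + 1)) ≤ (n - 1).factorial := by
  have h1 : ∏ i ∈ Finset.range l, (n - (i + 1)) = (n - 1).descFactorial l := by
    rw [Nat.descFactorial_eq_prod_range]
    exact Finset.prod_congr rfl fun i _ => by omega
  rw [h1, ← Nat.factorial_mul_descFactorial (show l ≤ n - 1 by omega)]
  exact Nat.le_mul_of_pos_left _ (Nat.factorial_pos _)

lemma orderBound_of {M : ℕ} {Z : Finset (Fin n)} {X : Finset (DPoly k n)}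
    (h1 : Z.card < n → weightedOrd Z X ≤ (∏ i ∈ Finset.range Z.card, (n - (i + 1))) * M)
    (h2 : Z.card = n → sumOrd X ≤ (n - 1).factorial * M) : OrderBound M Z X := by
  refine ⟨?_, h1⟩
  have hle : Z.card ≤ n := (Finset.card_le_univ Z).trans_eq (Fintype.card_fin n)
  rcases hle.lt_or_eq with h | h
  · exact ((sumOrd_le_weightedOrd h X).trans (h1 h)).trans
      (Nat.mul_le_mul_right _ (prod_range_le_factorial h))
  · exact h2 h

/-- The indeterminate `y` had weight one and now has weight `n - |Z| - 1`; the other weights do not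
increase. Multiplication by this number therefore suffices. -/
lemma weightedOrd_insert_le {Z : Finset (Fin n)} {y : Fin n} (hy : y ∉ Z) (hZ : Z.card + 1 < n)
    (X : Finset (DPoly k n)) :
    weightedOrd (insert y Z) X ≤ (n - (Z.card + 1)) * weightedOrd Z X := by
  rw [weightedOrd, weightedOrd, Finset.card_insert_of_notMem hy, Finset.sum_insert hy]
  have h1 : ∑ z ∈ Zᶜ, maxOrd X z = maxOrd X y + ∑ z ∈ (insert y Z)ᶜ, maxOrd X z := by
    rw [Finset.compl_insert, Finset.add_sum_erase _ _ (Finset.mem_compl.mpr hy)]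
  rw [h1]
  obtain ⟨p, hp⟩ : ∃ p, n - (Z.card + 1) = p + 1 := ⟨n - (Z.card + 1) - 1, by omega⟩
  have hp' : n - Z.card = p + 2 := by omega
  rw [hp, hp']
  generalize ∑ z ∈ Z, maxOrd X z = a
  generalize ∑ z ∈ (insert y Z)ᶜ, maxOrd X z = b
  generalize maxOrd X y = c
  nlinarith [Nat.zero_le (p * b), Nat.zero_le (p * a), Nat.zero_le (p * p * a)]

/-- The bound is inherited by the system constructed from the result of Differentiate&Autoreduce. -/
lemma OrderBound.of_exit {M : ℕ} {Z Z' : Finset (Fin n)} {X X' : Finset (DPoly k n)}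
    (h : OrderBound M Z X) {y : Fin n} (hZ : Z' = insert y Z) {a : Fin n → ℕ}
    (ha : ∀ y ∈ Z', a y ≤ maxOrd X y) (hin : ∀ y ∈ Z', maxOrd X' y ≤ a y)
    (hout : ∀ y ∉ Z', maxOrd X' y ≤ maxOrd X y + ∑ z ∈ Z', (maxOrd X z - a z)) :
    OrderBound M Z' X' := by
  apply orderBound_of
  · intro hlt
    -- Each of the `n - |Z'|` remaining indeterminates gains at most the total drop of the orders
    -- over `Z'`. As these orders are weighted by `n - |Z'|`, gain and loss balance.
    have h1 : weightedOrd Z' X' ≤ weightedOrd Z' X := by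
      have h2 : ∑ z ∈ Z'ᶜ, maxOrd X' z ≤
          ∑ z ∈ Z'ᶜ, maxOrd X z + (n - Z'.card) * ∑ z ∈ Z', (maxOrd X z - a z) := by
        have hc : n - Z'.card = Z'ᶜ.card := by rw [Finset.card_compl, Fintype.card_fin]
        rw [hc, ← smul_eq_mul, ← Finset.sum_const, ← Finset.sum_add_distrib]
        exact Finset.sum_le_sum fun z hz => hout z (Finset.mem_compl.mp hz)
      have h3 : ∑ z ∈ Z', maxOrd X z = ∑ z ∈ Z', a z + ∑ z ∈ Z', (maxOrd X z - a z) := by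
        rw [← Finset.sum_add_distrib]
        refine Finset.sum_congr rfl fun z hz => ?_
        have := ha z hz
        omega
      have h4 : ∑ z ∈ Z', maxOrd X' z ≤ ∑ z ∈ Z', a z := Finset.sum_le_sum hin
      rw [weightedOrd, weightedOrd, h3, mul_add]
      have := Nat.mul_le_mul_left (n - Z'.card) h4
      omega
    refine h1.trans ?_
    by_cases hy : y ∈ Z
    · rw [Finset.insert_eq_of_mem hy] at hZ
      subst hZ
      exact h.2 hlt
    · have hcard : Z'.card = Z.card + 1 := by rw [hZ, Finset.card_insert_of_notMem hy]
      have h5 := weightedOrd_insert_le hy (by omega) X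
      rw [← hZ] at h5
      rw [hcard, Finset.prod_range_succ]
      calc weightedOrd Z' X ≤ (n - (Z.card + 1)) * weightedOrd Z X := h5
        _ ≤ (n - (Z.card + 1)) * ((∏ i ∈ Finset.range Z.card, (n - (i + 1))) * M) :=
          Nat.mul_le_mul_left _ (h.2 (by omega))
        _ = _ := by ring
  -- If every indeterminate is leading, the weight of `Z'` would be zero. Then the unweighted sum is
  -- used, in which no term increases.
  · intro heq
    have hZ' : Z' = Finset.univ := by
      rw [← Finset.card_eq_iff_eq_univ, heq, Fintype.card_fin]
    refine le_trans (Finset.sum_le_sum fun y _ => ?_) h.1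
    have hy : y ∈ Z' := by rw [hZ']; exact Finset.mem_univ y
    exact (hin y hy).trans (ha y hy)

lemma orderBound_start (F H : Finset (DPoly k n)) (hn : 0 < n) :
    OrderBound (sumOrd (F ∪ H)) ∅ (F ∪ ∅ ∪ H) := by
  apply orderBound_of
  · intro _
    simp [weightedOrd, sumOrd]
  · intro h
    rw [Finset.card_empty] at h
    omega

lemma OrderBound.mono {M : ℕ} {Z : Finset (Fin n)} {X X' : Finset (DPoly k n)}
    (h : OrderBound M Z X) (hle : ∀ y, maxOrd X' y ≤ maxOrd X y) : OrderBound M Z X' := by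
  refine ⟨(Finset.sum_le_sum fun y _ => hle y).trans h.1, fun hZ => le_trans ?_ (h.2 hZ)⟩
  rw [weightedOrd, weightedOrd]
  gcongr <;> exact hle _

end Bounds

/-! ### Nonzero constants in ideals -/

section Constants

variable {k : Type*} [Field k] {n : ℕ}

lemma eq_top_of_mem_constants {Q : Ideal (DPoly k n)} {a : DPoly k n} (ha : a ∈ Q) (h0 : a ≠ 0)
    (hc : a ∈ constants k n) : Q = ⊤ := by
  obtain ⟨x, rfl⟩ := hc
  refine Ideal.eq_top_of_isUnit_mem Q ha ?_
  exact (isUnit_iff_ne_zero.mpr fun h => h0 (by rw [h, map_zero])).map C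

lemma sysIdeal_insert_eq_top [Differential k] {F H : Set (DPoly k n)} {a : DPoly k n}
    (h0 : a ≠ 0) (hc : a ∈ constants k n) : sysIdeal (insert a F) H = ⊤ :=
  eq_top_of_mem_constants (subset_sysIdeal _ _ (Set.mem_insert a F)) h0 hc

end Constants

/-! ## The triples -/

section Triples

variable {k : Type*} [Field k] {n : ℕ} [LinearOrder (DVar n)]

/-- The properties of the triples in `U`. -/
structure TripleInv (t : Triple k n) : Prop where
  nonempty : t.F.Nonempty
  nonconst : ∀ f ∈ t.F, f ∉ constants k n
  nonconst' : ∀ c ∈ t.C, c ∉ constants k n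
  lvInj : Set.InjOn (lv : DPoly k n → _) t.C
  reduced : ∀ f ∈ t.F, ∀ c ∈ t.C, Reduced f c
  inisep_subset : inisep t.C ⊆ t.H

lemma mem_newG {t : Triple k n} {f g : DPoly k n} :
    g ∈ newG t f ↔ g ≠ f ∧ (g ∈ t.F ∨ (g ∈ t.C ∧ lv g = lv f)) := by
  simp only [newG, conflict, Finset.mem_erase, Finset.mem_union, Finset.mem_filter]

lemma mem_newC {t : Triple k n} {f c : DPoly k n} :
    c ∈ newC t f ↔ c = f ∨ (c ∈ t.C ∧ lv c ≠ lv f) := by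
  simp only [newC, conflict, Finset.mem_insert, Finset.mem_sdiff, Finset.mem_filter]
  tauto

/-- A call only redistributes the polynomials of `F` and `C`, so it changes neither the equations
nor the orders. -/
lemma newG_union_newC {t : Triple k n} {f : DPoly k n} (hf : f ∈ t.F) :
    newG t f ∪ newC t f = t.F ∪ t.C := by
  ext g
  rw [Finset.mem_union, Finset.mem_union, mem_newG, mem_newC]
  by_cases h : g = f
  · subst h; simp [hf]
  · tauto

lemma callOrd_eq {t : Triple k n} {f : DPoly k n} (hf : f ∈ t.F) :
    callOrd t f = maxOrd (t.F ∪ t.C ∪ t.H) := by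
  funext y
  rw [callOrd, newG_union_newC hf]

lemma lvSet_newC {t : Triple k n} {f : DPoly k n} {u : DVar n} (hu : leader f = u) :
    lvSet (newC t f) = insert u.var (lvSet t.C) := by
  ext y
  rw [Finset.mem_insert, mem_lvSet, mem_lvSet]
  constructor
  · rintro ⟨c, hc, w, hw, rfl⟩
    rcases mem_newC.mp hc with rfl | ⟨hc, -⟩
    · rw [WithBot.coe_injective (hw.symm.trans hu)]
      exact Or.inl rfl
    · exact Or.inr ⟨c, hc, w, hw, rfl⟩
  · rintro (rfl | ⟨c, hc, w, hw, rfl⟩)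
    · exact ⟨f, mem_newC.mpr (Or.inl rfl), u, hu, rfl⟩
    · by_cases h : lv c = lv f
      · rw [lv_of_leader hw, lv_of_leader hu] at h
        exact ⟨f, mem_newC.mpr (Or.inl rfl), u, hu, (WithBot.coe_injective h).symm⟩
      · exact ⟨c, mem_newC.mpr (Or.inr ⟨hc, h⟩), w, hw, rfl⟩

namespace TripleInv

variable {t : Triple k n} {f : DPoly k n}

lemma callSpec (ht : TripleInv t) (hf : f ∈ t.F) : CallSpec (newC t f) (callOrd t f) where
  nonconst := by
    intro c hc
    rcases mem_newC.mp hc with rfl | ⟨hc, -⟩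
    · exact ht.nonconst c hf
    · exact ht.nonconst' c hc
  lvInj := by
    intro c hc c' hc' h
    rcases mem_newC.mp hc with rfl | ⟨hc, hne⟩
    · rcases mem_newC.mp hc' with rfl | ⟨hc', hne'⟩
      · rfl
      · exact absurd h.symm hne'
    · rcases mem_newC.mp hc' with rfl | ⟨hc', hne'⟩
      · exact absurd h hne
      · exact ht.lvInj hc hc' h
  ord_le := fun c hc v hv =>
    ord_le_maxOrd (Finset.mem_union_left _ (Finset.mem_union_right _ hc)) hv

/-- Reducedness with respect to `c` forbids proper derivatives of its leader and bounds the degree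
in it. Replacing `c` by `f` is therefore a descent. -/
lemma rank_lt (hrk : IsRanking n) (ht : TripleInv t) (hf : f ∈ t.F) {c : DPoly k n}
    (hc : c ∈ t.C) (hlv : lv c = lv f) : rank f < rank c := by
  obtain ⟨w, hw⟩ := exists_leader (ht.nonconst' c hc)
  obtain ⟨u, hu⟩ := exists_leader (ht.nonconst f hf)
  have hvar : u.var = w.var := by
    rw [lv_of_leader hw, lv_of_leader hu] at hlv
    exact (WithBot.coe_injective hlv).symm
  obtain ⟨h1, h2⟩ := ht.reduced f hf c hc
  have h3 : u.ord ≤ w.ord := not_lt.mp fun h => h1 w hw u (leader_mem hu) ⟨hvar, h⟩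
  rcases ((hrk.le_iff_ord_le hvar).mpr h3).lt_or_eq with h | h
  · apply rank_lt_of_leader_lt
    rw [hu, hw]
    exact WithBot.coe_lt_coe.mpr h
  · subst h
    rw [rank_of_leader hu, rank_of_leader hw, WithBot.coe_lt_coe, Prod.Lex.toLex_lt_toLex]
    exact Or.inr ⟨rfl, h2 u hw⟩

lemma of_mem_splits (ht : TripleInv t) (hf : f ∈ t.F) {t' : Triple k n}
    (h : t' ∈ splits t f) : TripleInv t' := by
  obtain ⟨s, hs, hsc, rfl⟩ := mem_splits h
  have hdeg : ∀ v, degreeOf v s ≤ degreeOf v f := by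
    rcases hs with rfl | rfl
    · exact degreeOf_separant_le f
    · exact degreeOf_initial_le f
  refine ⟨⟨s, Finset.mem_insert_self s t.F⟩, ?_, ht.nonconst', ht.lvInj, ?_, ht.inisep_subset⟩
  · intro g hg
    rcases Finset.mem_insert.mp hg with rfl | hg
    · exact hsc
    · exact ht.nonconst g hg
  · intro g hg c hc
    rcases Finset.mem_insert.mp hg with rfl | hg
    · obtain ⟨h1, h2⟩ := ht.reduced f hf c hc
      exact ⟨fun u hu v hv => h1 u hu v (vars_subset_of_degreeOf_le hdeg hv),
        fun u hu => (hdeg u).trans_lt (h2 u hu)⟩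
    · exact ht.reduced g hg c hc

/-- The polynomials that occur in the system constructed from the result of the call. -/
lemma exit_cases {B RF RH : Finset (DPoly k n)}
    (hG : AlgRemSet B (newG t f) RF) (hH : AlgRemSet B t.H RH) :
    ∀ x ∈ RF.erase 0 ∪ lowest B ∪ (RH ∪ inisep B),
      (∃ g, (∀ v ∈ g.vars, v.ord ≤ callOrd t f v.var) ∧ AlgRem B g x) ∨ x ∈ lowest B ∨
        x ∈ inisep B := by
  obtain ⟨ρ, hρ, rfl⟩ := hG
  obtain ⟨σ, hσ, rfl⟩ := hH
  intro x hx
  simp only [Finset.mem_union] at hx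
  rcases hx with (hx | hx) | hx | hx
  · obtain ⟨g, hg, rfl⟩ := Finset.mem_image.mp (Finset.mem_of_mem_erase hx)
    exact Or.inl ⟨g, fun v hv => ord_le_maxOrd
      (Finset.mem_union_left _ (Finset.mem_union_left _ hg)) hv, hρ g hg⟩
  · exact Or.inr (Or.inl hx)
  · obtain ⟨g, hg, rfl⟩ := Finset.mem_image.mp hx
    exact Or.inl ⟨g, fun v hv => ord_le_maxOrd (Finset.mem_union_right _ hg) hv, hσ g hg⟩
  · exact Or.inr (Or.inr hx)

end TripleInv

lemma orderBound_of_mem_splits {t t' : Triple k n} {f : DPoly k n} {M : ℕ} (hf : f ∈ t.F)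
    (hb : OrderBound M (lvSet t.C) (t.F ∪ t.C ∪ t.H)) (h : t' ∈ splits t f) :
    OrderBound M (lvSet t'.C) (t'.F ∪ t'.C ∪ t'.H) := by
  obtain ⟨s, hs, -, rfl⟩ := mem_splits h
  refine hb.mono fun y => maxOrd_le_iff.mpr ?_
  have hvars : s.vars ⊆ f.vars := by
    rcases hs with rfl | rfl
    · exact vars_separant_subset f
    · exact vars_initial_subset f
  rintro g hg v hv rfl
  simp only [Finset.mem_union, Finset.mem_insert] at hg
  by_cases hgs : g = s
  · subst hgs
    exact ord_le_maxOrd (Finset.mem_union_left _ (Finset.mem_union_left _ hf)) (hvars hv)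
  · refine ord_le_maxOrd (f := g) ?_ hv
    simp only [Finset.mem_union]
    tauto

variable [Differential k]

/-- The ideal `{F ∪ C} : H^∞` of a triple. -/
def tripleIdeal (t : Triple k n) : Ideal (DPoly k n) :=
  sysIdeal ((t.F : Set (DPoly k n)) ∪ t.C) t.H

/-- The ideal of a triple, saturated by the initial and the separant of `f`. -/
def callIdeal (t : Triple k n) (f : DPoly k n) : Ideal (DPoly k n) :=
  sysIdeal ((t.F : Set (DPoly k n)) ∪ t.C) (insert (initial f) (insert (separant f) t.H))

/-- A branch omitted in `splits` adjoins a nonzero constant, so its ideal is the unit ideal. If the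
separant is constant, so is the initial, which justifies omitting both branches. -/
lemma tripleIdeal_eq [CharZero k] (t : Triple k n) {f : DPoly k n} {u : DVar n}
    (hu : leader f = u) :
    tripleIdeal t = callIdeal t f ⊓ ⨅ t' ∈ splits t f, tripleIdeal t' := by
  rw [tripleIdeal, sysIdeal_eq_inf_insert_insert _ _ (separant f) (initial f), callIdeal]
  congr 1
  have hins : ∀ s : DPoly k n, tripleIdeal ⟨insert s t.F, t.C, t.H⟩ =
      sysIdeal (insert s ((t.F : Set (DPoly k n)) ∪ t.C)) t.H := by
    intro s
    rw [tripleIdeal, Finset.coe_insert, Set.insert_union]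
  rw [splits]
  split_ifs with h1 h2
  · have h3 : initial f ∈ constants k n := initial_eq_separant hu h1 ▸ h1
    simp [sysIdeal_insert_eq_top (separant_ne_zero hu) h1,
      sysIdeal_insert_eq_top (initial_ne_zero hu) h3]
  · rw [Finset.iInf_insert, hins, sysIdeal_insert_eq_top (initial_ne_zero hu) h2]
    simp
  · rw [Finset.iInf_insert, Finset.iInf_singleton, hins, hins]

namespace TripleInv

variable {t : Triple k n} {f : DPoly k n}

lemma mem_callIdeal {g : DPoly k n} (hg : g ∈ t.F ∪ t.C) : g ∈ callIdeal t f := by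
  apply subset_sysIdeal
  simpa using hg

lemma newC_mem_callIdeal (hf : f ∈ t.F) : ∀ c ∈ newC t f, c ∈ callIdeal t f := fun _ hc =>
  mem_callIdeal (newG_union_newC hf ▸ Finset.mem_union_right _ hc)

lemma cancels_inisep_newC (ht : TripleInv t) :
    ∀ h ∈ inisep (newC t f), Cancels (callIdeal t f) h := by
  intro h hh
  apply cancels_sysIdeal
  obtain ⟨c, hc, hcc⟩ := mem_inisep.mp hh
  rcases mem_newC.mp hc with rfl | ⟨hc, -⟩
  · rcases hcc with rfl | rfl
    · exact Set.mem_insert _ _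
    · exact Set.mem_insert_of_mem _ (Set.mem_insert _ _)
  · exact Set.mem_insert_of_mem _ (Set.mem_insert_of_mem _
      (ht.inisep_subset (mem_inisep.mpr ⟨c, hc, hcc⟩)))

variable {D B RF RH : Finset (DPoly k n)}

/-- Every remainder is congruent, up to a cancelling factor, to an element that lies in the ideal of
the call or cancels modulo it. -/
lemma exit_forward (ht : TripleInv t) (hf : f ∈ t.F)
    (hI : LoopInv (newC t f) (callOrd t f) D B)
    (hG : AlgRemSet B (newG t f) RF) (hH : AlgRemSet B t.H RH) :
    (∀ r ∈ RF, r ∈ callIdeal t f) ∧ (∀ b ∈ B, b ∈ callIdeal t f) ∧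
      ∀ h ∈ RH ∪ inisep B, Cancels (callIdeal t f) h := by
  obtain ⟨hBQ, hHB⟩ := hI.forward (callIdeal t f) (isDiffIdeal_sysIdeal _ _)
    (newC_mem_callIdeal hf) ht.cancels_inisep_newC
  have hBB : ∀ b ∈ B, b ∈ callIdeal t f ∧ Cancels (callIdeal t f) (initial b) := fun b hb =>
    ⟨hBQ b hb, hHB _ (initial_mem_inisep hb)⟩
  obtain ⟨ρ, hρ, rfl⟩ := hG
  obtain ⟨σ, hσ, rfl⟩ := hH
  refine ⟨fun r hr => ?_, hBQ, fun h hh => ?_⟩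
  · obtain ⟨g, hg, rfl⟩ := Finset.mem_image.mp hr
    obtain ⟨P, hP, hPg⟩ := (hρ g hg).exists_mul_sub_mem hBB
    exact (mem_iff_of_sub_mem hP hPg).mp
      (mem_callIdeal (newG_union_newC hf ▸ Finset.mem_union_left _ hg))
  · rcases Finset.mem_union.mp hh with hh | hh
    · obtain ⟨g, hg, rfl⟩ := Finset.mem_image.mp hh
      obtain ⟨P, hP, hPg⟩ := (hσ g hg).exists_mul_sub_mem hBB
      refine (cancels_iff_of_sub_mem hP hPg).mp (cancels_sysIdeal _ ?_)
      exact Set.mem_insert_of_mem _ (Set.mem_insert_of_mem _ hg)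
    · exact hHB h hh

lemma callIdeal_eq_top_of_discard (ht : TripleInv t) (hf : f ∈ t.F)
    (hI : LoopInv (newC t f) (callOrd t f) D B)
    (hG : AlgRemSet B (newG t f) RF) (hH : AlgRemSet B t.H RH)
    (hbad : (∃ r ∈ RF.erase 0, r ∈ constants k n) ∨ (0 : DPoly k n) ∈ RH ∪ inisep B) :
    callIdeal t f = ⊤ := by
  obtain ⟨h1, -, h2⟩ := ht.exit_forward hf hI hG hH
  rcases hbad with ⟨r, hr, hrc⟩ | h0
  · obtain ⟨hr0, hr⟩ := Finset.mem_erase.mp hr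
    exact eq_top_of_mem_constants (h1 r hr) hr0 hrc
  · rw [Ideal.eq_top_iff_one]
    exact h2 0 h0 1 (by rw [zero_mul]; exact zero_mem _)

lemma notMem_of_candidates_eq_empty {m : Fin n → ℕ} (hdone : candidates m D B = ∅)
    (c : DPoly k n) : c ∉ D := fun hc => by
  have : c ∈ candidates m D B := mem_candidates.mpr (Or.inl hc)
  simp [hdone] at this

/-- The systems before and after a call of Differentiate&Autoreduce define the same ideal. -/
lemma callIdeal_eq (ht : TripleInv t) (hf : f ∈ t.F)
    (hI : LoopInv (newC t f) (callOrd t f) D B)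
    (hdone : candidates (callOrd t f) D B = ∅)
    (hG : AlgRemSet B (newG t f) RF) (hH : AlgRemSet B t.H RH) :
    callIdeal t f = sysIdeal (((RF.erase 0 : Finset (DPoly k n)) : Set (DPoly k n)) ∪ lowest B)
      ((RH ∪ inisep B : Finset (DPoly k n)) : Set (DPoly k n)) := by
  obtain ⟨h1, h2, h3⟩ := ht.exit_forward hf hI hG hH
  set Q := sysIdeal (((RF.erase 0 : Finset (DPoly k n)) : Set (DPoly k n)) ∪ lowest B)
      ((RH ∪ inisep B : Finset (DPoly k n)) : Set (DPoly k n)) with hQ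
  have hRF : ∀ r ∈ RF, r ∈ Q := by
    intro r hr
    by_cases h0 : r = 0
    · rw [h0]; exact zero_mem _
    · exact subset_sysIdeal _ _ (Or.inl (Finset.mem_coe.mpr (Finset.mem_erase.mpr ⟨h0, hr⟩)))
  have hlow : ∀ b ∈ lowest B, b ∈ Q := fun b hb => subset_sysIdeal _ _ (Or.inr hb)
  have hHQ : ∀ h ∈ RH ∪ inisep B, Cancels Q h := fun h hh => cancels_sysIdeal _ hh
  have hQd : IsDiffIdeal Q := isDiffIdeal_sysIdeal _ _
  obtain ⟨hBQ, hCQ⟩ := hI.backward Q hQd hlow fun h hh => hHQ h (Finset.mem_union_right _ hh)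
  have hBB : ∀ b ∈ B, b ∈ Q ∧ Cancels Q (initial b) := fun b hb =>
    ⟨hBQ b hb, hHQ _ (Finset.mem_union_right _ (initial_mem_inisep hb))⟩
  have hCQ' : ∀ c ∈ newC t f, c ∈ Q ∧ Cancels Q (initial c) ∧ Cancels Q (separant c) :=
    fun c hc => hCQ c hc (notMem_of_candidates_eq_empty hdone c)
  apply le_antisymm
  · obtain ⟨ρ, hρ, rfl⟩ := hG
    obtain ⟨σ, hσ, rfl⟩ := hH
    refine sysIdeal_le ?_ hQd (isRadical_sysIdeal _ _) ?_
    · intro g hg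
      rw [← Finset.coe_union, Finset.mem_coe, ← newG_union_newC hf, Finset.mem_union] at hg
      rcases hg with hg | hg
      · obtain ⟨P, hP, hPg⟩ := (hρ g hg).exists_mul_sub_mem hBB
        exact (mem_iff_of_sub_mem hP hPg).mpr (hRF _ (Finset.mem_image_of_mem ρ hg))
      · exact (hCQ' g hg).1
    · have hfC := hCQ' f (mem_newC.mpr (Or.inl rfl))
      rintro h (rfl | rfl | hh)
      · exact hfC.2.1
      · exact hfC.2.2
      · obtain ⟨P, hP, hPh⟩ := (hσ h hh).exists_mul_sub_mem hBB
        exact (cancels_iff_of_sub_mem hP hPh).mpr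
          (hHQ _ (Finset.mem_union_left _ (Finset.mem_image_of_mem σ hh)))
  · refine sysIdeal_le ?_ (isDiffIdeal_sysIdeal _ _) (isRadical_sysIdeal _ _) h3
    rintro g (hg | hg)
    · exact h1 g (Finset.mem_of_mem_erase hg)
    · exact h2 g (lowest_subset B hg)

lemma lvSet_lowest (hrk : IsRanking n) (ht : TripleInv t) (hf : f ∈ t.F)
    (hI : LoopInv (newC t f) (callOrd t f) D B) (hdone : candidates (callOrd t f) D B = ∅)
    : lvSet (lowest B) = lvSet (newC t f) := by
  ext y
  rw [mem_lvSet, mem_lvSet]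
  constructor
  · rintro ⟨b, hb, u, hu, rfl⟩
    obtain ⟨c, hc, -, w, hw, hbw, -⟩ := hI.exists_of_mem_lowest hrk hb
    exact ⟨c, hc, w, hw, by rw [WithBot.coe_injective (hu.symm.trans hbw)]⟩
  · rintro ⟨c, hc, w, hw, rfl⟩
    obtain ⟨b, hb, hbc⟩ := hI.exists_lowest hrk (ht.callSpec hf) hc
      (notMem_of_candidates_eq_empty hdone c)
    exact ⟨b, hb, w, ((rank_eq_iff hw).mp hbc).1, rfl⟩

lemma nonconst_lowest (hI : LoopInv (newC t f) (callOrd t f) D B)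
    : ∀ b ∈ lowest B, b ∉ constants k n := by
  intro b hb
  obtain ⟨u, hu⟩ := hI.exists_leader (lowest_subset B hb)
  exact notMem_constants_of_leader hu

lemma lvInj_lowest (hI : LoopInv (newC t f) (callOrd t f) D B)
    : Set.InjOn (lv : DPoly k n → _) (lowest B) := by
  intro b hb b' hb' h
  obtain ⟨hbB, h1⟩ := mem_lowest.mp hb
  obtain ⟨hbB', h2⟩ := mem_lowest.mp hb'
  exact hI.inj hbB hbB' (le_antisymm (leader_le_of_rank_le (h1 b' hbB' h.symm))
    (leader_le_of_rank_le (h2 b hbB h)))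

/-- The lowest elements of `B` reproduce the ranks of `newC t f`. There `f` stands in place of
elements of higher rank with the same leading variable; if there were none, the old value was `⊤`.
-/
lemma tripleLT_exit (hrk : IsRanking n) (ht : TripleInv t) (hf : f ∈ t.F)
    (hI : LoopInv (newC t f) (callOrd t f) D B) (hdone : candidates (callOrd t f) D B = ∅)
    (F H : Finset (DPoly k n)) : TripleLT ⟨F, lowest B, H⟩ t := by
  apply Prod.Lex.left
  have hA := ht.callSpec hf
  have hle : ∀ c ∈ newC t f, ∀ y : Fin n, lv c = y →
      rankFamily (lowest B) y ≤ (rank c : WithTop (WithBot (DVar n ×ₗ ℕ))) := by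
    intro c hc y hy
    obtain ⟨b, hb, hbc⟩ := hI.exists_lowest hrk hA hc (notMem_of_candidates_eq_empty hdone c)
    obtain ⟨w, hw, hwy⟩ := lv_eq_iff.mp hy
    rw [← hbc]
    refine minRank_le (Finset.mem_filter.mpr ⟨hb, ?_⟩)
    rw [lv_of_leader ((rank_eq_iff hw).mp hbc).1, hwy]
  obtain ⟨u, hu⟩ := exists_leader (ht.nonconst f hf)
  have hfC : f ∈ newC t f := mem_newC.mpr (Or.inl rfl)
  rw [Pi.lt_def]
  refine ⟨fun y => Finset.le_inf fun c hc => ?_, u.var, ?_⟩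
  · obtain ⟨hc, hy⟩ := Finset.mem_filter.mp hc
    by_cases h : lv c = lv f
    · exact (hle f hfC y (h ▸ hy)).trans
        (WithTop.coe_le_coe.mpr (ht.rank_lt hrk hf hc h).le)
    · exact hle c (mem_newC.mpr (Or.inr ⟨hc, h⟩)) y hy
  · refine (hle f hfC u.var (lv_of_leader hu)).trans_lt ?_
    rw [rankFamily, minRank, Finset.lt_inf_iff (WithTop.coe_lt_top _)]
    intro c hc
    obtain ⟨hc, hy⟩ := Finset.mem_filter.mp hc
    exact WithTop.coe_lt_coe.mpr (ht.rank_lt hrk hf hc (hy.trans (lv_of_leader hu).symm))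

variable [CharZero k]

lemma orderBound_exit (hrk : IsRanking n) (ht : TripleInv t) (hf : f ∈ t.F)
    (hI : LoopInv (newC t f) (callOrd t f) D B) (hdone : candidates (callOrd t f) D B = ∅)
    (hG : AlgRemSet B (newG t f) RF) (hH : AlgRemSet B t.H RH)
    {M : ℕ} (hb : OrderBound M (lvSet t.C) (t.F ∪ t.C ∪ t.H)) :
    OrderBound M (lvSet (lowest B)) (RF.erase 0 ∪ lowest B ∪ (RH ∪ inisep B)) := by
  obtain ⟨a, h1, h2, h3⟩ := hI.maxOrd_le_of_exit hrk (ht.callSpec hf) hdone (exit_cases hG hH)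
  obtain ⟨u, hu⟩ := exists_leader (ht.nonconst f hf)
  rw [lvSet_lowest hrk ht hf hI hdone]
  rw [callOrd_eq hf] at h1 h3
  exact hb.of_exit (lvSet_newC hu) h1 h2 h3

lemma partiallyReduced_exit (hrk : IsRanking n) (ht : TripleInv t) (hf : f ∈ t.F)
    (hI : LoopInv (newC t f) (callOrd t f) D B) (hdone : candidates (callOrd t f) D B = ∅)
    (hG : AlgRemSet B (newG t f) RF) (hH : AlgRemSet B t.H RH) {x a : DPoly k n}
    (hx : x ∈ RF.erase 0 ∪ lowest B ∪ (RH ∪ inisep B)) (ha : a ∈ lowest B) :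
    PartiallyReduced x a := by
  rintro u hu v hv ⟨hvar, hlt⟩
  obtain ⟨c, hc, -, w, hw, haw, -⟩ := hI.exists_of_mem_lowest hrk ha
  have huw : u = w := WithBot.coe_injective (hu.symm.trans haw)
  subst huw
  exact absurd ((hI.ord_le_of_exit hrk (ht.callSpec hf) hdone (exit_cases hG hH x hx)).1 c hc u v
    hw hv hvar) (not_le.mpr hlt)

/-- Partial reducedness comes from the order bounds at the end of the loop, algebraic reducedness
from the invariant of the loop. -/
lemma isRegularSystem_exit (hrk : IsRanking n) (ht : TripleInv t) (hf : f ∈ t.F)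
    (hI : LoopInv (newC t f) (callOrd t f) D B) (hdone : candidates (callOrd t f) D B = ∅)
    (hG : AlgRemSet B (newG t f) RF) (hH : AlgRemSet B t.H RH)
    : IsRegularSystem (lowest B) (RH ∪ inisep B) := by
  refine ⟨⟨nonconst_lowest hI, fun x hx a ha hne => ⟨?_, ?_⟩⟩, fun x hx a ha => ?_, ?_⟩
  · exact partiallyReduced_exit hrk ht hf hI hdone hG hH
      (Finset.mem_union_left _ (Finset.mem_union_right _ hx)) ha
  · exact hI.algRed x (lowest_subset B hx) a (lowest_subset B ha) hne
  · exact partiallyReduced_exit hrk ht hf hI hdone hG hH (Finset.mem_union_right _ hx) ha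
  · exact (inisep_mono (lowest_subset B)).trans Finset.subset_union_right

lemma of_result (hrk : IsRanking n) (ht : TripleInv t) (hf : f ∈ t.F)
    (hI : LoopInv (newC t f) (callOrd t f) D B) (hdone : candidates (callOrd t f) D B = ∅)
    (hG : AlgRemSet B (newG t f) RF) (hH : AlgRemSet B t.H RH)
    (hconst : ∀ r ∈ RF.erase 0, r ∉ constants k n) (hne : (RF.erase 0).Nonempty) :
    TripleInv ⟨RF.erase 0, lowest B, RH ∪ inisep B⟩ := by
  refine ⟨hne, hconst, nonconst_lowest hI, lvInj_lowest hI, fun x hx a ha => ⟨?_, ?_⟩,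
    (inisep_mono (lowest_subset B)).trans Finset.subset_union_right⟩
  · exact partiallyReduced_exit hrk ht hf hI hdone hG hH
      (Finset.mem_union_left _ (Finset.mem_union_left _ hx)) ha
  · obtain ⟨ρ, hρ, rfl⟩ := hG
    obtain ⟨g, hg, rfl⟩ := Finset.mem_image.mp (Finset.mem_of_mem_erase hx)
    exact (hρ g hg).2 a (lowest_subset B ha)

end TripleInv

end Triples

/-! ## The configurations -/

section Measure

variable {k : Type*} [Field k] {n : ℕ} [LinearOrder (DVar n)]

/-- The measure that decreases along the runs of RGBound. -/
def configMeasure : Config k n → Multiset (Triple k n) × WithTop ℕ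
  -- With `⊤` here, entering a call is a descent, because the triple under treatment stays in the
  -- multiset until the call returns.
  | .main U _ => (U.val, ⊤)
  | .auto U _ t f _ B => (t ::ₘ U.val, ((∑ y, (callOrd t f y + 1) - B.card : ℕ) : WithTop ℕ))

/-- The ordering of the measures of configurations. -/
def MeasureLT : Multiset (Triple k n) × WithTop ℕ → Multiset (Triple k n) × WithTop ℕ → Prop :=
  Prod.Lex (Relation.CutExpand TripleLT) (· < ·)

lemma wellFounded_measureLT (hrk : IsRanking n) :
    WellFounded (MeasureLT : Multiset (Triple k n) × WithTop ℕ → _ → Prop) :=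
  WellFounded.prod_lex (wellFounded_tripleLT hrk).cutExpand wellFounded_lt

lemma measureLT_main {U S : Finset (Triple k n)} {T T' : Finset (Sys k n)} {t : Triple k n}
    {f : DPoly k n} {D B : Finset (DPoly k n)} (h : ∀ t' ∈ S, TripleLT t' t) :
    MeasureLT (configMeasure (.main (U ∪ S) T')) (configMeasure (.auto U T t f D B)) :=
  Prod.Lex.left _ _ (cutExpand_union h)

end Measure

/-! ### The ideal represented by the pending triples and the output -/

section TotalIdeal

variable {k : Type*} [Field k] [Differential k] {n : ℕ}

/-- The intersection of the ideals of the triples in `U` and of the systems in `T`. -/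
def totalIdeal (U : Finset (Triple k n)) (T : Finset (Sys k n)) : Ideal (DPoly k n) :=
  (⨅ t ∈ U, tripleIdeal t) ⊓
    ⨅ s ∈ T, saturation (diffIdeal (s.A : Set (DPoly k n))) (s.H : Set (DPoly k n))

lemma totalIdeal_union (U S : Finset (Triple k n)) (T : Finset (Sys k n)) :
    totalIdeal (U ∪ S) T = totalIdeal U T ⊓ ⨅ t ∈ S, tripleIdeal t := by
  rw [totalIdeal, totalIdeal, Finset.iInf_union, inf_right_comm]

lemma totalIdeal_insert (U : Finset (Triple k n)) (t : Triple k n) (T : Finset (Sys k n)) :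
    totalIdeal (insert t U) T = totalIdeal U T ⊓ tripleIdeal t := by
  rw [totalIdeal, totalIdeal, Finset.iInf_insert, inf_assoc, inf_comm]

lemma totalIdeal_insert_sys (U : Finset (Triple k n)) (s : Sys k n) (T : Finset (Sys k n)) :
    totalIdeal U (insert s T) = totalIdeal U T ⊓
      saturation (diffIdeal (s.A : Set (DPoly k n))) (s.H : Set (DPoly k n)) := by
  rw [totalIdeal, totalIdeal, Finset.iInf_insert, inf_assoc]
  congr 1
  exact inf_comm _ _

end TotalIdeal

/-! ### Invariance, progress and descent -/

section Configurations

variable {k : Type*} [Field k] [Differential k] {n : ℕ} [LinearOrder (DVar n)]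

/-- The invariant of a triple together with the bound for its orders. -/
def TripleSpec (M : ℕ) (t : Triple k n) : Prop :=
  TripleInv t ∧ OrderBound M (lvSet t.C) (t.F ∪ t.C ∪ t.H)

/-- The properties of the systems in `T`. -/
def SysSpec (M : ℕ) (s : Sys k n) : Prop :=
  IsRegularSystem s.A s.H ∧ sumOrd (s.A ∪ s.H) ≤ (n - 1).factorial * M

/-- The invariant of RGBound, with the bound `M` and the ideal `I`. -/
def ConfigInv (M : ℕ) (I : Ideal (DPoly k n)) : Config k n → Prop
  | .main U T => (∀ t ∈ U, TripleSpec M t) ∧ (∀ s ∈ T, SysSpec M s) ∧ I = totalIdeal U T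
  | .auto U T t f D B => (∀ t' ∈ insert t U, TripleSpec M t') ∧ (∀ s ∈ T, SysSpec M s) ∧
      I = totalIdeal (insert t U) T ∧ IsLeastRank t.F f ∧
      LoopInv (newC t f) (callOrd t f) D B

/-- Least-rank elements exist in nonempty finite sets and remainders always exist, so the case
distinctions of the algorithm are exhaustive. -/
theorem ConfigInv.progress {M : ℕ} {I : Ideal (DPoly k n)} {c : Config k n}
    (h : ConfigInv M I c) : (∃ T : Finset (Sys k n), c = .main ∅ T) ∨ ∃ c', Step c c' := by
  cases c with
  | main U T =>
    rcases U.eq_empty_or_nonempty with rfl | ⟨t, ht⟩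
    · exact Or.inl ⟨T, rfl⟩
    · obtain ⟨f, hf⟩ := exists_isLeastRank (h.1 t ht).1.nonempty
      exact Or.inr ⟨_, .call U T t f ht hf⟩
  | auto U T t f D B =>
    right
    rcases (candidates (callOrd t f) D B).eq_empty_or_nonempty with hdone | hne
    · obtain ⟨RF, hG⟩ := exists_algRemSet B (newG t f)
      obtain ⟨RH, hH⟩ := exists_algRemSet B t.H
      by_cases hbad : (∃ r ∈ RF.erase 0, r ∈ constants k n) ∨ (0 : DPoly k n) ∈ RH ∪ inisep B
      · exact ⟨_, .discard U T t f D B RF RH hdone hG hH hbad⟩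
      · rw [not_or] at hbad
        rcases (RF.erase 0).eq_empty_or_nonempty with hempty | hne
        · exact ⟨_, .output U T t f D B RF RH hdone hG hH hbad.2 hempty⟩
        · exact ⟨_, .push U T t f D B RF RH hdone hG hH
            (fun r hr hc => hbad.1 ⟨r, hr, hc⟩) hbad.2 hne⟩
    · obtain ⟨g, hg⟩ := exists_isLeastRank hne
      obtain ⟨r, hr⟩ := exists_algRem (divisors D B g) g
      by_cases hrank : rank r = rank g
      · exact ⟨_, .loop U T t f D B g r hg hr hrank⟩
      · exact ⟨_, .unit U T t f D B g r hg hr hrank⟩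

lemma configInv_start {F H : Finset (DPoly k n)} (hF : F.Nonempty)
    (hconst : ∀ f ∈ F, f ∉ constants k n) :
    ConfigInv (sumOrd (F ∪ H)) (saturation (radDiffIdeal (F : Set (DPoly k n)))
      (H : Set (DPoly k n))) (start F H) := by
  obtain ⟨f, hf⟩ := hF
  obtain ⟨u, -⟩ := exists_leader (hconst f hf)
  refine ⟨?_, by simp, ?_⟩
  · intro t ht
    rw [Finset.mem_singleton] at ht
    subst ht
    refine ⟨⟨⟨f, hf⟩, hconst, by simp, by simp, by simp, by simp [inisep]⟩, ?_⟩
    have h0 : lvSet (∅ : Finset (DPoly k n)) = ∅ := by simp [lvSet]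
    change OrderBound _ (lvSet (∅ : Finset (DPoly k n))) (F ∪ ∅ ∪ H)
    rw [h0]
    exact orderBound_start F H (Fin.pos u.var)
  · simp [totalIdeal, tripleIdeal, sysIdeal]

variable [CharZero k]

/-- The invariant is preserved, and the measure decreases. -/
theorem ConfigInv.step (hrk : IsRanking n) {M : ℕ} {I : Ideal (DPoly k n)} {c c' : Config k n}
    (h : ConfigInv M I c) (hs : Step c c') :
    ConfigInv M I c' ∧ MeasureLT (configMeasure c') (configMeasure c) := by
  -- The four transitions that end a call differ only in the triples `S` and the outputs that
  -- replace the ideal of the call; the splitting branches are treated once and for all.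
  have finish : ∀ {U : Finset (Triple k n)} {T T' : Finset (Sys k n)} {t : Triple k n}
      {f : DPoly k n} {D B : Finset (DPoly k n)} (S : Finset (Triple k n)),
      ConfigInv M I (.auto U T t f D B) → (∀ t' ∈ S, TripleSpec M t' ∧ TripleLT t' t) →
      (∀ s ∈ T', SysSpec M s) →
      totalIdeal U T ⊓ callIdeal t f = totalIdeal U T' ⊓ ⨅ t' ∈ S, tripleIdeal t' →
      ConfigInv M I (.main (U ∪ (S ∪ splits t f)) T') ∧
        MeasureLT (configMeasure (.main (U ∪ (S ∪ splits t f)) T'))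
          (configMeasure (.auto U T t f D B)) := by
    rintro U T T' t f D B S ⟨hU, -, hideal, hf, -⟩ hS hT' heq
    obtain ⟨ht, htb⟩ := hU t (Finset.mem_insert_self t U)
    have hfc := ht.nonconst f hf.1
    obtain ⟨u, hu⟩ := exists_leader hfc
    refine ⟨⟨fun t' ht' => ?_, hT', ?_⟩, measureLT_main fun t' ht' => ?_⟩
    · rw [Finset.mem_union, Finset.mem_union] at ht'
      rcases ht' with ht' | ht' | ht'
      · exact hU t' (Finset.mem_insert_of_mem ht')
      · exact (hS t' ht').1
      · exact ⟨ht.of_mem_splits hf.1 ht', orderBound_of_mem_splits hf.1 htb ht'⟩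
    · rw [hideal, totalIdeal_insert, tripleIdeal_eq t hu, ← inf_assoc, heq, totalIdeal_union,
        Finset.iInf_union, inf_assoc]
    · rcases Finset.mem_union.mp ht' with ht' | ht'
      · exact (hS t' ht').2
      · exact tripleLT_of_mem_splits hf hfc ht'
  cases hs with
  | call U T t f ht hf =>
    obtain ⟨hU, hT, hideal⟩ := h
    refine ⟨⟨?_, hT, ?_, hf, loopInv_start _ _⟩, ?_⟩
    · rwa [Finset.insert_erase ht]
    · rwa [Finset.insert_erase ht]
    · rw [configMeasure, configMeasure, Finset.erase_val, Multiset.cons_erase ht]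
      exact Prod.Lex.right _ (WithTop.coe_lt_top _)
  | loop U T t f D B g gbar hg hrem hrank =>
    obtain ⟨hU, hT, hideal, hf, hI⟩ := h
    have hA := (hU t (Finset.mem_insert_self t U)).1.callSpec hf.1
    obtain ⟨hgB, hI'⟩ := hI.insert_rem hrk hA hg hrem hrank
    refine ⟨⟨hU, hT, hideal, hf, hI'⟩, Prod.Lex.right _ (Nat.cast_lt.mpr ?_)⟩
    -- The bound is applied to the enlarged set, so that the truncated subtraction decreases
    -- strictly.
    have h1 := hI'.card_le_sum_succ hA
    rw [Finset.card_insert_of_notMem hgB] at h1 ⊢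
    omega
  | unit U T t f D B g gbar hg hrem hrank =>
    have h' := h
    obtain ⟨hU, hT, hideal, hf, hI⟩ := h
    have ht := (hU t (Finset.mem_insert_self t U)).1
    have htop : callIdeal t f = ⊤ := hI.eq_top_of_rank_ne hrk (ht.callSpec hf.1) hg.1 hrem hrank
      (isDiffIdeal_sysIdeal _ _) (TripleInv.newC_mem_callIdeal hf.1) ht.cancels_inisep_newC
    -- The ideal of the call is the unit ideal, so dropping it does not affect the intersection.
    have := finish (T' := T) ∅ h' (by simp) hT (by simp [htop])
    rwa [Finset.empty_union] at this
  | discard U T t f D B RF RH hdone hG hH hbad =>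
    have h' := h
    obtain ⟨hU, hT, hideal, hf, hI⟩ := h
    have ht := (hU t (Finset.mem_insert_self t U)).1
    have htop := ht.callIdeal_eq_top_of_discard hf.1 hI hG hH hbad
    have := finish (T' := T) ∅ h' (by simp) hT (by simp [htop])
    rwa [Finset.empty_union] at this
  | output U T t f D B RF RH hdone hG hH hH0 hempty =>
    have h' := h
    obtain ⟨hU, hT, hideal, hf, hI⟩ := h
    obtain ⟨ht, htb⟩ := hU t (Finset.mem_insert_self t U)
    have hreg := ht.isRegularSystem_exit hrk hf.1 hI hdone hG hH
    have hb := (ht.orderBound_exit hrk hf.1 hI hdone hG hH htb).1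
    rw [hempty, Finset.empty_union] at hb
    have hid := ht.callIdeal_eq hf.1 hI hdone hG hH
    rw [hempty, Finset.coe_empty, Set.empty_union, sysIdeal_eq_of_inisep_subset hrk hreg.1.1
      (TripleInv.lvInj_lowest hI) hreg.2.2] at hid
    have := finish (T' := insert ⟨lowest B, RH ∪ inisep B⟩ T) ∅ h' (by simp) (by
      intro s hs
      rcases Finset.mem_insert.mp hs with rfl | hs
      · exact ⟨hreg, hb⟩
      · exact hT s hs) (by
      rw [totalIdeal_insert_sys, hid]
      simp)
    rwa [Finset.empty_union] at this
  | push U T t f D B RF RH hdone hG hH hconst hH0 hne =>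
    have h' := h
    obtain ⟨hU, hT, hideal, hf, hI⟩ := h
    obtain ⟨ht, htb⟩ := hU t (Finset.mem_insert_self t U)
    have := finish (T' := T) {⟨RF.erase 0, lowest B, RH ∪ inisep B⟩} h' (by
      intro t' ht'
      rw [Finset.mem_singleton] at ht'
      subst ht'
      exact ⟨⟨ht.of_result hrk hf.1 hI hdone hG hH hconst hne,
        ht.orderBound_exit hrk hf.1 hI hdone hG hH htb⟩,
        ht.tripleLT_exit hrk hf.1 hI hdone _ _⟩) hT (by
      rw [Finset.iInf_singleton, ht.callIdeal_eq hf.1 hI hdone hG hH]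
      rfl)
    rw [Finset.insert_union, ← Finset.union_insert, Finset.insert_eq]
    exact this

/-- The measure is known to decrease only under the invariant, so accessibility is proved for
configurations that satisfy it rather than for all. -/
theorem ConfigInv.acc (hrk : IsRanking n) {M : ℕ} {I : Ideal (DPoly k n)} {c : Config k n}
    (h : ConfigInv M I c) : Acc (fun c' c : Config k n => Step c c') c := by
  have hwf := InvImage.wf (configMeasure (k := k) (n := n)) (wellFounded_measureLT hrk)
  induction c using hwf.induction with
  | _ c ih =>
    refine ⟨c, fun c' hs => ?_⟩
    obtain ⟨h1, h2⟩ := h.step hrk hs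
    exact ih c' h2 h1

lemma Reachable.configInv (hrk : IsRanking n) {F H : Finset (DPoly k n)} (hF : F.Nonempty)
    (hconst : ∀ f ∈ F, f ∉ constants k n) {c : Config k n} (h : Reachable F H c) :
    ConfigInv (sumOrd (F ∪ H)) (saturation (radDiffIdeal (F : Set (DPoly k n)))
      (H : Set (DPoly k n))) c := by
  induction h with
  | refl => exact configInv_start hF hconst
  | tail _ hs ih => exact (ih.step hrk hs).1

end Configurations

end RG

end

open RG
theorem mainTheorem1 {k : Type*} [Field k] [CharZero k] [Differential k] {n : ℕ}
    [LinearOrder (DVar n)] (hrk : IsRanking n)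
    (F₀ H₀ : Finset (DPoly k n)) (hF₀ : F₀.Nonempty) (hconst : ∀ f ∈ F₀, f ∉ constants k n) :
    -- termination: pseudo-reduction terminates, all runs are finite, and a run can only stop
    -- at the head of the main loop with `U = ∅`
    (∀ B : Finset (DPoly k n), WellFounded fun r f : DPoly k n => PseudoStep B f r) ∧
    Acc (fun c' c : Config k n => Step c c') (start F₀ H₀) ∧
    (∀ c : Config k n, Reachable F₀ H₀ c →
      (∃ T : Finset (Sys k n), c = .main ∅ T) ∨ ∃ c' : Config k n, Step c c') ∧
    -- the intermediate systems
    (∀ (U : Finset (Triple k n)) (T : Finset (Sys k n)), Reachable F₀ H₀ (.main U T) →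
      ∀ t ∈ U,
        sumOrd (t.F ∪ t.C ∪ t.H) ≤ (n - 1).factorial * sumOrd (F₀ ∪ H₀) ∧
        ((lvSet t.C).card < n →
          weightedOrd (lvSet t.C) (t.F ∪ t.C ∪ t.H) ≤
            (∏ i ∈ Finset.range (lvSet t.C).card, (n - (i + 1))) * sumOrd (F₀ ∪ H₀))) ∧
    -- the output
    (∀ T : Finset (Sys k n), Reachable F₀ H₀ (.main ∅ T) →
      (∀ s ∈ T, IsRegularSystem s.A s.H ∧
        sumOrd (s.A ∪ s.H) ≤ (n - 1).factorial * sumOrd (F₀ ∪ H₀)) ∧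
      saturation (radDiffIdeal (F₀ : Set (DPoly k n))) (H₀ : Set (DPoly k n)) =
        ⨅ s ∈ T, saturation (diffIdeal (s.A : Set (DPoly k n))) (s.H : Set (DPoly k n))) := by
  refine ⟨wellFounded_pseudoStep, (configInv_start hF₀ hconst).acc hrk,
    fun c hc => (hc.configInv hrk hF₀ hconst).progress,
    fun U T hUT t ht => ((hUT.configInv hrk hF₀ hconst).1 t ht).2, fun T hT => ?_⟩
  obtain ⟨-, h1, h2⟩ := hT.configInv hrk hF₀ hconst
  refine ⟨h1, h2.trans ?_⟩
  simp [totalIdeal]
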